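/- **Theorem 2.** Fix integers $d_1\ge 0$ (number of features) and $m\ge 1$ (batch size), a learning rate $\tau>0$, a coefficient $\alpha\in\mathbb R$ and an activation function $\sigma\in C^4(\mathbb R)$ such that $\sigma,\sigma',\dots,\sigma^{(4)}$ have at most polynomial growth. Let $P_c$ be a probability law on $\mathbb R^{d_1}$ with all moments finite, and let $\nu$ be a centred, possibly degenerate, Gaussian law on $\mathbb R^2$ (the law of the two additive noises $(\gamma^{(1)},\gamma^{(2)})$ at one coordinate). *Training.* For every $N\ge d_1$ let $A\in\mathbb R^{N\times N}$ be an orthogonal matrix, let $U=\sqrt N A_{:,:d_1}$ be the feature matrix, and let $w_0\in\mathbb R^N$ with $\|w_0\|_2=\sqrt N$; $A$ and $w_0$ may be random. Training samples are i.i.d. and independent of $(A,w_0)$: a sample is $x=A\binom{c}{\tilde a}$ with views $x^{(\ell)}=x+\gamma^{(\ell)}$, $\ell=1,2$, where $c\sim P_c$, $\tilde a\sim\mathcal N(0,I_{N-d_1})$, the pairs $(\gamma^{(1)}_i,\gamma^{(2)}_i)$, $i\le N$, are i.i.d. with law $\nu$, and $c,\tilde a,\gamma$ are independent. Put $y^{(\ell)}(w)=\sigma(w^\top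 x^{(\ell)}/\sqrt N)$, and for a batch of $m$ samples and numbers $\eta_1,\eta_2$ $$F(w;\eta)=-\frac1m\sum_{b=1}^m\big(y^{(1)}_b(w)-\eta_1\big)\big(y^{(2)}_b(w)-\eta_2\big).$$ Step $k$ uses a fresh batch and L2 regularization only: $$\tilde w_k=w_k-\tau\nabla_w F(w_k;\eta)-\frac{\tau}{N}\alpha w_k,\qquad w_{k+1}=\sqrt N\,\frac{\tilde w_k}{\|\tilde w_k\|_2},$$ where $\eta_\ell$ is the population mean of $y^{(\ell)}(w_k)$ given $A$ and $w_k$, through which no gradient is taken. Let $q^N_k=\frac1N U^\top w_k$ be the cosine similarity. *Limit.* For $q\in\mathbb R^{d_1}$ with $\|q\|\le 1$ let $\langle\cdot\rangle$ be the expectation over independent $c\sim P_c$, $e\sim\mathcal N(0,1)$, $(\gamma^{(1)},\gamma^{(2)})\sim\nu$, and put $$\Theta_\ell=c^\top q+\sqrt{1-q^\top q}\,e+\gamma^{(\ell)},\quad \bar y^{(\ell)}=\langle\sigma(\Theta_\ell)\rangle,\quad f_{\ell\ell'}=-2\big(\sigma(\Theta_\ell)-\bar y^{(\ell)}\big)\sigma'(\Theta_{\ell'}),\quad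 f'_{\ell\ell'}=\Big(\frac{\partial}{\partial\Theta_1}+\frac{\partial}{\partial\Theta_2}\Big)f_{\ell\ell'},$$ $$g(q)=\frac\tau2\langle c f_{12}+c f_{21}\rangle-\frac\tau2\,q\,\big(\langle f'_{12}\rangle+\langle f'_{21}\rangle\big),$$ $$\Lambda(q)=\frac{\tau^2}{4m}\Big[\big(1+\langle(\gamma^{(2)})^2\rangle\big)\langle f_{12}^2\rangle+\big(1+\langle(\gamma^{(1)})^2\rangle\big)\langle f_{21}^2\rangle+2\big(1+\langle\gamma^{(1)}\gamma^{(2)}\rangle\big)\langle f_{12}f_{21}\rangle\Big].$$ If $q^N_0\to q_0$ in probability as $N\to\infty$ for some deterministic $q_0$, then the closed ODE $$\frac{dq}{dt}=q\Big(q^\top g(q)-\tfrac12\Lambda(q)\Big)-g(q),\qquad q(0)=q_0,$$ has exactly one solution $t\mapsto q_t$ on $[0,\infty)$ with values in the closed unit ball, and for every $t\ge0$, $q^N_{\lfloor tN\rfloor}\to q_t$ in probability as $N\to\infty$. In particular the limit does not depend on $\alpha$, so it is the same as without regularization ($\alpha=0$). -/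

import Mathlib

open MeasureTheory ProbabilityTheory Filter Topology

open scoped RealInnerProductSpace

noncomputable section

namespace ContrastiveDynamics

/-! ### Data model

The ambient dimension is `N = d + n`, where `d` is the number of features and `n` the number of
background directions. -/

/-- The randomness of one training sample in dimension `N = d + n`: the hidden variable `c`, the
background noise in the hidden space, and the two additive (augmentation) noises; the noise of
branch `l` at coordinate `i` is `s.noise i l`. -/
abbrev Sample (d n : ℕ) : Type :=
  EuclideanSpace ℝ (Fin d) × (Fin n → ℝ) × (Fin (d + n) → Fin 2 → ℝ)

/-- The hidden variable. -/
def Sample.hidden {d n : ℕ} (s : Sample d n) : EuclideanSpace ℝ (Fin d) := s.1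

/-- The background noise in the hidden space. -/
def Sample.background {d n : ℕ} (s : Sample d n) : Fin n → ℝ := s.2.1

/-- The additive noises. -/
def Sample.noise {d n : ℕ} (s : Sample d n) : Fin (d + n) → Fin 2 → ℝ := s.2.2

/-- The law of one sample: the hidden variable has law `Pc`, the background noise is standard
Gaussian, the pairs of additive noises at the coordinates are i.i.d. with law `ν` (a law on pairs
of reals, so the two branches may be correlated), and the three groups are independent. -/
def sampleLaw {d : ℕ} (n : ℕ) (Pc : Measure (EuclideanSpace ℝ (Fin d)))
    (ν : Measure (Fin 2 → ℝ)) : Measure (Sample d n) :=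
  Pc.prod ((Measure.pi fun _ : Fin n => gaussianReal 0 1).prod
    (Measure.pi fun _ : Fin (d + n) => ν))

/-- The raw data vector `x = A [c; a]`. -/
def dataVec {d n : ℕ} (A : Matrix (Fin (d + n)) (Fin (d + n)) ℝ) (s : Sample d n) :
    EuclideanSpace ℝ (Fin (d + n)) :=
  WithLp.toLp 2 (A.mulVec (Fin.append (WithLp.ofLp s.hidden) s.background))

/-- The augmented view `x + γ` of branch `l`. -/
def view {d n : ℕ} (A : Matrix (Fin (d + n)) (Fin (d + n)) ℝ) (s : Sample d n) (l : Fin 2) :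
    EuclideanSpace ℝ (Fin (d + n)) :=
  dataVec A s + WithLp.toLp 2 (fun i => s.noise i l)

/-- The feature matrix `U`: the first `d` columns of `√N A`. -/
def featureMatrix {d n : ℕ} (A : Matrix (Fin (d + n)) (Fin (d + n)) ℝ) :
    Matrix (Fin (d + n)) (Fin d) ℝ :=
  fun i j => √((d + n : ℕ) : ℝ) * A i (Fin.castAdd n j)

/-! ### The one-layer model and its training -/

/-- The output `σ(wᵀ x / √N)` of branch `l`. -/
def output {d n : ℕ} (σ : ℝ → ℝ) (A : Matrix (Fin (d + n)) (Fin (d + n)) ℝ) (s : Sample d n)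
    (l : Fin 2) (w : EuclideanSpace ℝ (Fin (d + n))) : ℝ :=
  σ (⟪w, view A s l⟫ / √((d + n : ℕ) : ℝ))

/-- The population mean of the output of branch `l`, given the weights `w`. -/
def popMean {d n : ℕ} (σ : ℝ → ℝ) (Pc : Measure (EuclideanSpace ℝ (Fin d)))
    (ν : Measure (Fin 2 → ℝ)) (A : Matrix (Fin (d + n)) (Fin (d + n)) ℝ)
    (w : EuclideanSpace ℝ (Fin (d + n))) (l : Fin 2) : ℝ :=
  ∫ s, output σ A s l w ∂(sampleLaw n Pc ν)

/-- The loss of a batch for a single output channel: minus the cross-covariance of the two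
branches along the batch, centred at given numbers `ybar 0`, `ybar 1`. -/
def loss {d n m : ℕ} (σ : ℝ → ℝ) (A : Matrix (Fin (d + n)) (Fin (d + n)) ℝ)
    (ybar : Fin 2 → ℝ) (batch : Fin m → Sample d n) (w : EuclideanSpace ℝ (Fin (d + n))) : ℝ :=
  -((1 / (m : ℝ)) * ∑ b, (output σ A (batch b) 0 w - ybar 0) * (output σ A (batch b) 1 w - ybar 1))

/-- The gradient step `w - τ ∇F(w) - (τ / N) φ(w)` with the centring numbers in the loss equal to
the population means at the current weights; no gradient is taken through these means, and `φ` is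
applied entrywise. -/
def gradStep {d n m : ℕ} (σ φ : ℝ → ℝ) (τ : ℝ) (Pc : Measure (EuclideanSpace ℝ (Fin d)))
    (ν : Measure (Fin 2 → ℝ)) (A : Matrix (Fin (d + n)) (Fin (d + n)) ℝ)
    (batch : Fin m → Sample d n) (w : EuclideanSpace ℝ (Fin (d + n))) :
    EuclideanSpace ℝ (Fin (d + n)) :=
  w - τ • gradient (loss σ A (popMean σ Pc ν A w) batch) w
    - (τ / ((d + n : ℕ) : ℝ)) • WithLp.toLp 2 (fun i => φ (w i))

/-- Rescaling to Euclidean norm `√N`. -/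
def rescale {N : ℕ} (w : EuclideanSpace ℝ (Fin N)) : EuclideanSpace ℝ (Fin N) :=
  (√(N : ℝ) / ‖w‖) • w

/-- The weights after `k` steps of one-pass SGD from `w₀`; step `k` uses the batch `batches k`. -/
def weights {d n m : ℕ} (σ φ : ℝ → ℝ) (τ : ℝ) (Pc : Measure (EuclideanSpace ℝ (Fin d)))
    (ν : Measure (Fin 2 → ℝ)) (A : Matrix (Fin (d + n)) (Fin (d + n)) ℝ)
    (w₀ : EuclideanSpace ℝ (Fin (d + n))) (batches : ℕ → Fin m → Sample d n) :
    ℕ → EuclideanSpace ℝ (Fin (d + n))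
  | 0 => w₀
  | k + 1 => rescale (gradStep σ φ τ Pc ν A (batches k)
      (weights σ φ τ Pc ν A w₀ batches k))

/-- The cosine similarities `Uᵀ w / N` of the weights with the features. -/
def cosSim {d n : ℕ} (A : Matrix (Fin (d + n)) (Fin (d + n)) ℝ)
    (w : EuclideanSpace ℝ (Fin (d + n))) : EuclideanSpace ℝ (Fin d) :=
  (1 / ((d + n : ℕ) : ℝ)) • WithLp.toLp 2 ((featureMatrix A).transpose.mulVec (WithLp.ofLp w))

/-! ### The limiting equation -/

/-- The variables of the limiting expectations: the hidden variable `c`, the Gaussian `e`, and the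
two additive noises `γ`. -/
abbrev EffVar (d : ℕ) : Type := EuclideanSpace ℝ (Fin d) × ℝ × (Fin 2 → ℝ)

/-- The law under which the bracket `⟨·⟩` is taken: `c ∼ Pc`, `e ∼ N(0,1)`, `γ ∼ ν`,
independent. -/
def effLaw {d : ℕ} (Pc : Measure (EuclideanSpace ℝ (Fin d))) (ν : Measure (Fin 2 → ℝ)) :
    Measure (EffVar d) :=
  Pc.prod ((gaussianReal 0 1).prod ν)

/-- `Θ_l = cᵀ q + √(1 - qᵀ q) e + γ_l`. -/
def Theta {d : ℕ} (q : EuclideanSpace ℝ (Fin d)) (v : EffVar d) (l : Fin 2) : ℝ :=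
  ⟪v.1, q⟫ + √(1 - ⟪q, q⟫) * v.2.1 + v.2.2 l

/-- `ȳ_l = ⟨σ(Θ_l)⟩`. -/
def ybar {d : ℕ} (σ : ℝ → ℝ) (Pc : Measure (EuclideanSpace ℝ (Fin d)))
    (ν : Measure (Fin 2 → ℝ)) (q : EuclideanSpace ℝ (Fin d)) (l : Fin 2) : ℝ :=
  ∫ v, σ (Theta q v l) ∂(effLaw Pc ν)

/-- `f_{l l'}(θ) = -2 (σ(θ_l) - y_l) σ'(θ_{l'})`, for given centring numbers `y`. -/
def fFun (σ : ℝ → ℝ) (y : Fin 2 → ℝ) (l l' : Fin 2) (θ : Fin 2 → ℝ) : ℝ :=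
  -2 * (σ (θ l) - y l) * deriv σ (θ l')

/-- `f'_{l l'}(θ) = (∂/∂θ₁ + ∂/∂θ₂) f_{l l'}(θ)`. -/
def fFun' (σ : ℝ → ℝ) (y : Fin 2 → ℝ) (l l' : Fin 2) (θ : Fin 2 → ℝ) : ℝ :=
  ∑ j : Fin 2, deriv (fun x => fFun σ y l l' (Function.update θ j x)) (θ j)

/-- `g = (τ/2) ⟨c f₁₂ + c f₂₁⟩ - (τ/2) (⟨f'₁₂⟩ + ⟨f'₂₁⟩) q`. -/
def gVec {d : ℕ} (σ : ℝ → ℝ) (τ : ℝ) (Pc : Measure (EuclideanSpace ℝ (Fin d)))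
    (ν : Measure (Fin 2 → ℝ)) (q : EuclideanSpace ℝ (Fin d)) : EuclideanSpace ℝ (Fin d) :=
  (τ / 2) • (∫ v, (fFun σ (ybar σ Pc ν q) 0 1 (Theta q v) • v.1
      + fFun σ (ybar σ Pc ν q) 1 0 (Theta q v) • v.1) ∂(effLaw Pc ν))
    - ((τ / 2) * ((∫ v, fFun' σ (ybar σ Pc ν q) 0 1 (Theta q v) ∂(effLaw Pc ν))
      + ∫ v, fFun' σ (ybar σ Pc ν q) 1 0 (Theta q v) ∂(effLaw Pc ν))) • q

/-- `Λ = τ²/(4m) [(1+⟨γ₂²⟩)⟨f₁₂²⟩ + (1+⟨γ₁²⟩)⟨f₂₁²⟩ + 2(1+⟨γ₁γ₂⟩)⟨f₁₂ f₂₁⟩]`. -/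
def LambdaCoef {d : ℕ} (σ : ℝ → ℝ) (τ : ℝ) (m : ℕ) (Pc : Measure (EuclideanSpace ℝ (Fin d)))
    (ν : Measure (Fin 2 → ℝ)) (q : EuclideanSpace ℝ (Fin d)) : ℝ :=
  τ ^ 2 / (4 * m) *
    ((1 + ∫ γ, γ 1 ^ 2 ∂ν) * (∫ v, fFun σ (ybar σ Pc ν q) 0 1 (Theta q v) ^ 2 ∂(effLaw Pc ν))
    + (1 + ∫ γ, γ 0 ^ 2 ∂ν) * (∫ v, fFun σ (ybar σ Pc ν q) 1 0 (Theta q v) ^ 2 ∂(effLaw Pc ν))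
    + 2 * (1 + ∫ γ, γ 0 * γ 1 ∂ν) *
      (∫ v, fFun σ (ybar σ Pc ν q) 0 1 (Theta q v) * fFun σ (ybar σ Pc ν q) 1 0 (Theta q v)
        ∂(effLaw Pc ν)))

/-- `q : [0, ∞) → closed unit ball` solves `dq/dt = q (qᵀ g - Λ/2) - g` with initial value `q₀`
(values of `q` at negative times are irrelevant). -/
def IsSolution {d : ℕ} (σ : ℝ → ℝ) (τ : ℝ) (m : ℕ) (Pc : Measure (EuclideanSpace ℝ (Fin d)))
    (ν : Measure (Fin 2 → ℝ)) (q₀ : EuclideanSpace ℝ (Fin d))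
    (q : ℝ → EuclideanSpace ℝ (Fin d)) : Prop :=
  q 0 = q₀ ∧ ∀ t, 0 ≤ t → ‖q t‖ ≤ 1 ∧
    HasDerivWithinAt q
      ((⟪q t, gVec σ τ Pc ν (q t)⟫ - LambdaCoef σ τ m Pc ν (q t) / 2) • q t
        - gVec σ τ Pc ν (q t)) (Set.Ici 0) t

end ContrastiveDynamics

end

noncomputable section

namespace ContrastiveDynamics

/-! ### Random variables with all moments -/

section

/-! Consider the unit vector `u = w / √N`; its coordinates `q = Q u` along the feature columns (`Q =
hiddenProj A`) are the cosine similarities. A step sends `u` to `(1 - τα/N) u - G/N` and normalizes,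
where `G` is the batch gradient direction. Expanding the normalization, `q` moves by `(1/N) (-Q G +
(⟪u, G⟫ - ‖G‖²/(2N)) q)` up to an error of mean `O(N⁻²)` (`norm_normalized_step_sub_le`). The factor
`1 - τα/N` only changes the length of `u`, which normalization undoes at this order; hence `α` is
absent from the limit.

The mean over a fresh batch is almost explicit. Given `u`, the preactivations have exactly the
limiting law, because background and additive noises are Gaussian and `u` is a unit vector
(`map_sampleProj`); in particular the population mean is a function of `q`. The tangential part of
the drift is exact: noise in directions orthogonal to `u` is independent of the preactivations and
drops out, and Gaussian integration by parts turns the background coordinate into `f'`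
(`integral_inner_sampleDir_eq`). Finally `‖G‖²/N` has mean `Λ + O(N^(-1/2))`: inner products of two
views divided by `N` concentrate (`exists_integral_viewDev_sq_le`), and distinct samples of a batch
contribute only the squared norm of the mean of `G`, which is bounded in `N`.

Let `D` be the difference of `q` after `k` steps and the solution at time `k/N`. The fluctuations of
a step are centred given the past, their squares are `O(N⁻²)`, and the error of the drift is
`O(N^(-3/2))` per step. So the mean of `‖D‖²` grows by at most a factor `1 + C/N` and a term `C
N^(-3/2)` in each step (`exists_integral_potential_step_le`). A discrete Grönwall inequality over
`tN` steps and Markov's inequality give convergence in probability.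

For the equation itself the difficulty is that `√(1 - ‖q‖²)` is not Lipschitz at the sphere. It
multiplies a Gaussian variable, so by integration by parts the derivative of a bracket in `s = √(1 -
‖q‖²)` has a factor `s`: brackets are Lipschitz in `s² = 1 - ‖q‖²`, hence in `q` up to the boundary
(`lipBdd_bracket`). On the sphere the radial component of the field is `-Λ/2 ≤ 0`, so solutions stay
in the closed ball and exist for all times (`exists_isBallSolution`). -/

/-- `X` has absolute moments of all orders under `μ`. -/
def AllMoments {Ω : Type*} [MeasurableSpace Ω] (X : Ω → ℝ) (μ : Measure Ω) : Prop :=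
  AEStronglyMeasurable X μ ∧ ∀ k : ℕ, Integrable (fun ω => |X ω| ^ k) μ

namespace AllMoments

variable {Ω Ω' : Type*} [MeasurableSpace Ω] [MeasurableSpace Ω'] {μ : Measure Ω} {X Y : Ω → ℝ}

lemma integrable_pow (hX : AllMoments X μ) (k : ℕ) : Integrable (fun ω => X ω ^ k) μ := by
  refine (hX.2 k).mono' (hX.1.pow k) (Eventually.of_forall fun ω => ?_)
  simp

lemma integrable (hX : AllMoments X μ) : Integrable X μ := by
  simpa using hX.integrable_pow 1

lemma of_le (hY : AllMoments Y μ) (hX : AEStronglyMeasurable X μ) (h : ∀ ω, |X ω| ≤ |Y ω|) :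
    AllMoments X μ := by
  refine ⟨hX, fun k => (hY.2 k).mono' ?_ (Eventually.of_forall fun ω => ?_)⟩
  · exact (continuous_abs.comp_aestronglyMeasurable hX).pow k
  · rw [Real.norm_of_nonneg (by positivity)]
    exact pow_le_pow_left₀ (abs_nonneg _) (h ω) k

lemma mul (hX : AllMoments X μ) (hY : AllMoments Y μ) : AllMoments (fun ω => X ω * Y ω) μ := by
  have hm : AEStronglyMeasurable (fun ω => X ω * Y ω) μ := hX.1.mul hY.1
  refine ⟨hm, fun k => ((hX.2 (k * 2)).add (hY.2 (k * 2))).mono' ?_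
    (Eventually.of_forall fun ω => ?_)⟩
  · exact (continuous_abs.comp_aestronglyMeasurable hm).pow k
  · rw [Real.norm_of_nonneg (by positivity), abs_mul, mul_pow]
    simp only [Pi.add_apply, pow_mul]
    nlinarith [sq_nonneg (|X ω| ^ k - |Y ω| ^ k), sq_nonneg (|X ω| ^ k), sq_nonneg (|Y ω| ^ k)]

lemma add (hX : AllMoments X μ) (hY : AllMoments Y μ) : AllMoments (fun ω => X ω + Y ω) μ := by
  have hm : AEStronglyMeasurable (fun ω => X ω + Y ω) μ := hX.1.add hY.1
  refine ⟨hm, fun k => (((hX.2 k).add (hY.2 k)).const_mul (2 ^ (k - 1))).mono' ?_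
    (Eventually.of_forall fun ω => ?_)⟩
  · exact (continuous_abs.comp_aestronglyMeasurable hm).pow k
  · rw [Real.norm_of_nonneg (by positivity)]
    exact (pow_le_pow_left₀ (abs_nonneg _) (abs_add_le _ _) k).trans
      (add_pow_le (abs_nonneg _) (abs_nonneg _) k)

lemma const [IsFiniteMeasure μ] (c : ℝ) : AllMoments (fun _ => c) μ :=
  ⟨aestronglyMeasurable_const, fun _ => integrable_const _⟩

lemma const_mul (hX : AllMoments X μ) (c : ℝ) : AllMoments (fun ω => c * X ω) μ := by
  refine ⟨hX.1.const_mul c, fun k => ?_⟩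
  simpa only [abs_mul, mul_pow] using (hX.2 k).const_mul (|c| ^ k)

lemma neg (hX : AllMoments X μ) : AllMoments (fun ω => -X ω) μ := by
  simpa using hX.const_mul (-1)

lemma sub (hX : AllMoments X μ) (hY : AllMoments Y μ) : AllMoments (fun ω => X ω - Y ω) μ := by
  simpa only [sub_eq_add_neg] using hX.add hY.neg

lemma pow [IsFiniteMeasure μ] (hX : AllMoments X μ) (k : ℕ) :
    AllMoments (fun ω => X ω ^ k) μ := by
  induction k with
  | zero => simpa using const 1
  | succ k ih => simpa only [pow_succ] using ih.mul hX

lemma sum [IsFiniteMeasure μ] {ι : Type*} (s : Finset ι) {X : ι → Ω → ℝ}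
    (hX : ∀ i ∈ s, AllMoments (X i) μ) : AllMoments (fun ω => ∑ i ∈ s, X i ω) μ := by
  classical
  induction s using Finset.induction_on with
  | empty => simpa using const 0
  | insert a s ha ih =>
    simp only [Finset.sum_insert ha]
    exact (hX a (by simp)).add (ih fun i hi => hX i (by simp [hi]))

lemma abs (hX : AllMoments X μ) : AllMoments (fun ω => |X ω|) μ :=
  hX.of_le (continuous_abs.comp_aestronglyMeasurable hX.1) fun ω => by simp

lemma comp_of_map {f : Ω' → Ω} {ρ : Measure Ω'} (hX : AllMoments X (ρ.map f))
    (hf : AEMeasurable f ρ) : AllMoments (fun ω => X (f ω)) ρ :=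
  ⟨hX.1.comp_aemeasurable hf, fun k => (hX.2 k).comp_aemeasurable hf⟩

lemma comp_measurePreserving {f : Ω' → Ω} {ρ : Measure Ω'} (hX : AllMoments X μ)
    (hf : MeasurePreserving f ρ μ) : AllMoments (fun ω => X (f ω)) ρ :=
  comp_of_map (hf.map_eq.symm ▸ hX) hf.measurable.aemeasurable

lemma memLp_two (hX : AllMoments X μ) : MemLp X 2 μ :=
  (memLp_two_iff_integrable_sq hX.1).2 (hX.integrable_pow 2)

end AllMoments

/-! ### Linear combinations of independent centred Gaussian vectors -/

section Gaussian

variable {ι E : Type*} [Fintype ι] [NormedAddCommGroup E] [NormedSpace ℝ E] [MeasurableSpace E]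
  [BorelSpace E] [SecondCountableTopology E] (μ : Measure E) [IsGaussian μ]

lemma charFunDual_map_pi_sum_smul (u : ι → ℝ) (L : StrongDual ℝ E) :
    charFunDual ((Measure.pi fun _ : ι => μ).map fun γ => ∑ i, u i • γ i) L
      = ∏ i, charFunDual μ (u i • L) := by
  have hm : Measurable fun γ : ι → E => ∑ i, u i • γ i :=
    Finset.measurable_sum _ fun i _ => (measurable_pi_apply i).const_smul (u i)
  simp only [charFunDual_apply]
  rw [integral_map hm.aemeasurable (by fun_prop), ← integral_fintype_prod_eq_prod]
  refine integral_congr_ae (Eventually.of_forall fun γ => ?_)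
  simp only [map_sum, map_smul, smul_eq_mul, Complex.ofReal_sum, Complex.ofReal_mul,
    smul_apply, Finset.sum_mul, Complex.exp_sum]

lemma charFunDual_map_pi_sum_smul_prod (u z : ι → ℝ) (L : StrongDual ℝ (E × E)) :
    charFunDual ((Measure.pi fun _ : ι => μ).map
        fun γ => (∑ i, u i • γ i, ∑ i, z i • γ i)) L
      = ∏ i, charFunDual μ (u i • L.comp (.inl ℝ E E) + z i • L.comp (.inr ℝ E E)) := by
  have hm (u : ι → ℝ) : Measurable fun γ : ι → E => ∑ i, u i • γ i :=
    Finset.measurable_sum _ fun i _ => (measurable_pi_apply i).const_smul (u i)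
  simp only [charFunDual_apply]
  rw [integral_map ((hm u).prodMk (hm z)).aemeasurable (by fun_prop),
    ← integral_fintype_prod_eq_prod]
  refine integral_congr_ae (Eventually.of_forall fun γ => ?_)
  have h : L (∑ i, u i • γ i, ∑ i, z i • γ i)
      = ∑ i, (u i • L.comp (.inl ℝ E E) + z i • L.comp (.inr ℝ E E)) (γ i) := by
    have h1 : (∑ i, u i • γ i, ∑ i, z i • γ i)
        = ContinuousLinearMap.inl ℝ E E (∑ i, u i • γ i)
          + ContinuousLinearMap.inr ℝ E E (∑ i, z i • γ i) := by
      simp only [ContinuousLinearMap.inl_apply, ContinuousLinearMap.inr_apply, Prod.mk_add_mk,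
        add_zero, zero_add]
    rw [h1, map_add, map_sum, map_sum, map_sum, map_sum, ← Finset.sum_add_distrib]
    refine Finset.sum_congr rfl fun i _ => ?_
    simp only [map_smul, add_apply, smul_apply, ContinuousLinearMap.comp_apply]
  simp only [h, Complex.ofReal_sum, Finset.sum_mul, Complex.exp_sum]

variable {μ}

/-- A centred Gaussian law has the characteristic functional `exp (-Var[L]/2)`, and the variances of
the summands add up to `(∑ u i ^ 2) Var[L]`. Only variances of functionals occur, so degenerate laws
are covered. -/
lemma map_pi_sum_smul [CompleteSpace E] (hμ : ∀ L : StrongDual ℝ E, μ[L] = 0) (u : ι → ℝ) :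
    (Measure.pi fun _ : ι => μ).map (fun γ => ∑ i, u i • γ i)
      = μ.map fun x => √(∑ i, u i ^ 2) • x := by
  have hm : Measurable fun γ : ι → E => ∑ i, u i • γ i :=
    Finset.measurable_sum _ fun i _ => (measurable_pi_apply i).const_smul (u i)
  have := Measure.isProbabilityMeasure_map (μ := Measure.pi fun _ : ι => μ) hm.aemeasurable
  have := Measure.isProbabilityMeasure_map (μ := μ)
    (f := fun x => √(∑ i, u i ^ 2) • x) (by fun_prop)
  refine Measure.ext_of_charFunDual ?_
  ext L
  have h2 : charFunDual (μ.map fun x => √(∑ i, u i ^ 2) • x) L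
      = charFunDual μ (√(∑ i, u i ^ 2) • L) := by
    simp only [charFunDual_apply]
    rw [integral_map (by fun_prop) (by fun_prop)]
    simp
  rw [charFunDual_map_pi_sum_smul, h2]
  simp only [IsGaussian.charFunDual_eq_of_forall_strongDual_eq_zero hμ]
  have hv (a : ℝ) : Var[⇑(a • L); μ] = a ^ 2 * Var[L; μ] := by
    rw [show ⇑(a • L) = a • ⇑L from rfl, variance_smul]
  simp only [hv, ← Complex.exp_sum]
  rw [Real.sq_sqrt (Finset.sum_nonneg fun i _ => sq_nonneg _)]
  push_cast
  rw [Finset.sum_mul, ← Finset.sum_neg_distrib, Finset.sum_div]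

/-- The exponent of the joint characteristic functional differs from the sum of the two marginal
ones only by the cross term `(∑ u i * z i) * cov[L₁, L₂]`, which vanishes. -/
lemma indepFun_pi_sum_smul [CompleteSpace E] (hμ : ∀ L : StrongDual ℝ E, μ[L] = 0)
    {u z : ι → ℝ} (h : ∑ i, u i * z i = 0) :
    IndepFun (fun γ : ι → E => ∑ i, u i • γ i) (fun γ => ∑ i, z i • γ i)
      (Measure.pi fun _ : ι => μ) := by
  have hm (u : ι → ℝ) : Measurable fun γ : ι → E => ∑ i, u i • γ i :=
    Finset.measurable_sum _ fun i _ => (measurable_pi_apply i).const_smul (u i)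
  rw [indepFun_iff_charFunDual_prod (hm u).aemeasurable (hm z).aemeasurable]
  intro L
  rw [charFunDual_map_pi_sum_smul_prod, charFunDual_map_pi_sum_smul, charFunDual_map_pi_sum_smul]
  set L₁ := L.comp (.inl ℝ E E)
  set L₂ := L.comp (.inr ℝ E E)
  simp only [IsGaussian.charFunDual_eq_of_forall_strongDual_eq_zero hμ]
  have hv (a b : ℝ) : Var[⇑(a • L₁ + b • L₂); μ]
      = Var[⇑(a • L₁); μ] + Var[⇑(b • L₂); μ] + (a * b) * (2 * cov[L₁, L₂; μ]) := by
    have h1 : MemLp (⇑L₁) 2 μ := IsGaussian.memLp_dual μ L₁ 2 (by norm_num)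
    have h2 : MemLp (⇑L₂) 2 μ := IsGaussian.memLp_dual μ L₂ 2 (by norm_num)
    rw [show ⇑(a • L₁ + b • L₂) = (a • ⇑L₁) + (b • ⇑L₂) from rfl,
      variance_add (h1.const_smul a) (h2.const_smul b), show ⇑(a • L₁) = a • ⇑L₁ from rfl,
      show ⇑(b • L₂) = b • ⇑L₂ from rfl, covariance_smul_left, covariance_smul_right]
    ring
  simp only [hv, ← Complex.exp_sum, ← Complex.exp_add]
  congr 1
  push_cast
  rw [← Finset.sum_add_distrib]
  have h0 : ∑ i, (u i : ℂ) * z i = 0 := by exact_mod_cast h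
  have : ∑ i, ((u i : ℂ) * z i) * (2 * (cov[L₁, L₂; μ] : ℂ)) = 0 := by
    rw [← Finset.sum_mul, h0, zero_mul]
  rw [← sub_eq_zero, ← Finset.sum_sub_distrib]
  calc _ = ∑ i, (-(1 / 2 : ℂ)) * (((u i : ℂ) * z i) * (2 * (cov[L₁, L₂; μ] : ℂ))) :=
        Finset.sum_congr rfl fun i _ => by ring
    _ = 0 := by rw [← Finset.mul_sum, this, mul_zero]

end Gaussian

/-! ### Gaussian integration by parts -/

lemma hasDerivAt_gaussianPDFReal (x : ℝ) :
    HasDerivAt (gaussianPDFReal 0 1) (-x * gaussianPDFReal 0 1 x) x := by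
  have h : HasDerivAt (fun x : ℝ => (√(2 * Real.pi * (1 : NNReal)))⁻¹
      * Real.exp (-(x - 0) ^ 2 / (2 * (1 : NNReal)))) _ x :=
    (((((hasDerivAt_id x).sub_const 0).fun_pow 2).fun_neg.div_const _).exp).const_mul _
  refine h.congr_deriv ?_
  simp only [gaussianPDFReal, NNReal.coe_one, id]
  push_cast
  ring

/-- Stein's identity: the density satisfies `φ' = -x φ`, so this is integration by parts on the
line; integrability of the products takes care of the boundary terms. -/
lemma integral_mul_gaussianReal {F F' : ℝ → ℝ} (hF : ∀ x, HasDerivAt F (F' x) x)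
    (h0 : Integrable F (gaussianReal 0 1)) (h1 : Integrable (fun x => x * F x) (gaussianReal 0 1))
    (h2 : Integrable F' (gaussianReal 0 1)) :
    ∫ x, x * F x ∂(gaussianReal 0 1) = ∫ x, F' x ∂(gaussianReal 0 1) := by
  have key (G : ℝ → ℝ) (hG : Integrable G (gaussianReal 0 1)) :
      Integrable (fun x => G x * gaussianPDFReal 0 1 x) := by
    rw [gaussianReal_of_var_ne_zero _ one_ne_zero, integrable_withDensity_iff
      (measurable_gaussianPDF 0 1) (Eventually.of_forall fun _ => gaussianPDF_lt_top)] at hG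
    simpa [toReal_gaussianPDF] using hG
  rw [integral_gaussianReal_eq_integral_smul one_ne_zero,
    integral_gaussianReal_eq_integral_smul one_ne_zero]
  have h := integral_mul_deriv_eq_deriv_mul_of_integrable (u := F) (u' := F')
    (v := gaussianPDFReal 0 1) (v' := fun x => -x * gaussianPDFReal 0 1 x)
    (fun x _ => hF x) (fun x _ => hasDerivAt_gaussianPDFReal x)
    ((key _ h1).neg.congr (Eventually.of_forall fun x => by simp; ring)) (key _ h2) (key _ h0)
  simp only [smul_eq_mul]
  calc ∫ x, gaussianPDFReal 0 1 x * (x * F x)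
      = -∫ x, F x * (-x * gaussianPDFReal 0 1 x) := by
        rw [← integral_neg]; congr 1; ext x; ring
    _ = _ := by rw [h, neg_neg]; congr 1; ext x; ring

end

/-! ### Functions of polynomial growth of the pair of preactivations -/

section

/-- Continuous functions of two real variables with at most polynomial growth. -/
def PolyGrowth (F : (Fin 2 → ℝ) → ℝ) : Prop :=
  Continuous F ∧ ∃ (C : ℝ) (p : ℕ), 0 ≤ C ∧ ∀ θ, |F θ| ≤ C * (1 + ‖θ‖) ^ p

lemma PolyGrowth.const (a : ℝ) : PolyGrowth fun _ => a :=
  ⟨continuous_const, |a|, 0, abs_nonneg a, fun _ => by simp⟩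

lemma PolyGrowth.mul {F G : (Fin 2 → ℝ) → ℝ} (hF : PolyGrowth F) (hG : PolyGrowth G) :
    PolyGrowth fun θ => F θ * G θ := by
  obtain ⟨hFc, C, p, hC, hF⟩ := hF
  obtain ⟨hGc, D, r, hD, hG⟩ := hG
  refine ⟨hFc.mul hGc, C * D, p + r, mul_nonneg hC hD, fun θ => ?_⟩
  rw [abs_mul, pow_add]
  calc |F θ| * |G θ| ≤ (C * (1 + ‖θ‖) ^ p) * (D * (1 + ‖θ‖) ^ r) :=
        mul_le_mul (hF θ) (hG θ) (abs_nonneg _) (by positivity)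
    _ = _ := by ring

lemma PolyGrowth.add {F G : (Fin 2 → ℝ) → ℝ} (hF : PolyGrowth F) (hG : PolyGrowth G) :
    PolyGrowth fun θ => F θ + G θ := by
  obtain ⟨hFc, C, p, hC, hF⟩ := hF
  obtain ⟨hGc, D, r, hD, hG⟩ := hG
  refine ⟨hFc.add hGc, C + D, p + r, add_nonneg hC hD, fun θ => ?_⟩
  have h1 : (1 : ℝ) ≤ 1 + ‖θ‖ := by linarith [norm_nonneg θ]
  calc |F θ + G θ| ≤ C * (1 + ‖θ‖) ^ p + D * (1 + ‖θ‖) ^ r :=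
        (abs_add_le _ _).trans (add_le_add (hF θ) (hG θ))
    _ ≤ C * (1 + ‖θ‖) ^ (p + r) + D * (1 + ‖θ‖) ^ (p + r) := by
        gcongr <;> first | exact h1 | omega
    _ = _ := by ring

lemma PolyGrowth.allMoments {Ω : Type*} [MeasurableSpace Ω] {μ : Measure Ω} [IsFiniteMeasure μ]
    {F : (Fin 2 → ℝ) → ℝ} (hF : PolyGrowth F) {θ : Ω → Fin 2 → ℝ}
    (hθ : ∀ l, AllMoments (fun ω => θ ω l) μ) : AllMoments (fun ω => F (θ ω)) μ := by
  obtain ⟨hFc, C, p, hC, hF⟩ := hF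
  have hm : AEMeasurable θ μ := aemeasurable_pi_iff.2 fun l => (hθ l).1.aemeasurable
  have hdom : AllMoments (fun ω => C * (1 + (|θ ω 0| + |θ ω 1|)) ^ p) μ :=
    (((AllMoments.const 1).add ((hθ 0).abs.add (hθ 1).abs)).pow p).const_mul C
  refine hdom.of_le (hFc.measurable.comp_aemeasurable hm).aestronglyMeasurable fun ω => ?_
  rw [abs_of_nonneg (a := C * _) (by positivity)]
  refine (hF _).trans ?_
  gcongr
  rw [pi_norm_le_iff_of_nonneg (by positivity)]
  intro l
  fin_cases l <;> simp

/-- Functions of polynomial growth that have `k` derivatives of polynomial growth along the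
diagonal direction. -/
def DiagSmooth : ℕ → ((Fin 2 → ℝ) → ℝ) → Prop
  | 0, F => PolyGrowth F
  -- The diagonal suffices because `c` and `e` enter both preactivations through a common summand;
  -- its derivatives are the only ones needed.
  | k + 1, F => PolyGrowth F ∧ ∃ F' : (Fin 2 → ℝ) → ℝ,
      (∀ (θ : Fin 2 → ℝ) (x : ℝ), HasDerivAt (fun x : ℝ => F fun l => θ l + x) (F' fun l => θ l + x) x) ∧
        DiagSmooth k F'

namespace DiagSmooth

lemma polyGrowth {k : ℕ} {F : (Fin 2 → ℝ) → ℝ} (hF : DiagSmooth k F) : PolyGrowth F := by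
  cases k with
  | zero => exact hF
  | succ k => exact hF.1

lemma of_succ {k : ℕ} {F : (Fin 2 → ℝ) → ℝ} (hF : DiagSmooth (k + 1) F) : DiagSmooth k F := by
  induction k generalizing F with
  | zero => exact hF.1
  | succ k ih =>
    obtain ⟨h0, F', hd, h1⟩ := hF
    exact ⟨h0, F', hd, ih h1⟩

lemma const (k : ℕ) (a : ℝ) : DiagSmooth k fun _ => a := by
  induction k generalizing a with
  | zero => exact PolyGrowth.const a
  | succ k ih => exact ⟨PolyGrowth.const a, fun _ => 0, fun _ x => hasDerivAt_const x a, ih 0⟩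

lemma add {k : ℕ} {F G : (Fin 2 → ℝ) → ℝ} (hF : DiagSmooth k F) (hG : DiagSmooth k G) :
    DiagSmooth k fun θ => F θ + G θ := by
  induction k generalizing F G with
  | zero => exact PolyGrowth.add hF hG
  | succ k ih =>
    obtain ⟨h0, F', hd, h1⟩ := hF
    obtain ⟨h0', G', hd', h1'⟩ := hG
    exact ⟨h0.add h0', fun θ => F' θ + G' θ, fun θ x => (hd θ x).add (hd' θ x), ih h1 h1'⟩

lemma mul {k : ℕ} {F G : (Fin 2 → ℝ) → ℝ} (hF : DiagSmooth k F) (hG : DiagSmooth k G) :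
    DiagSmooth k fun θ => F θ * G θ := by
  induction k generalizing F G with
  | zero => exact PolyGrowth.mul hF hG
  | succ k ih =>
    -- The derivative `F' * G + F * G'` contains the factors themselves, which are needed at the
    -- lower order `k`.
    have hF0 := hF.of_succ
    have hG0 := hG.of_succ
    obtain ⟨h0, F', hd, h1⟩ := hF
    obtain ⟨h0', G', hd', h1'⟩ := hG
    exact ⟨h0.mul h0', fun θ => F' θ * G θ + F θ * G' θ,
      fun θ x => (hd θ x).mul (hd' θ x), (ih h1 hG0).add (ih hF0 h1')⟩

lemma iteratedDeriv_eval {σ : ℝ → ℝ} {r : ℕ} (hσ : ContDiff ℝ r σ)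
    (hσ_growth : ∃ (C : ℝ) (p : ℕ), ∀ j ≤ r, ∀ x : ℝ,
      |iteratedDeriv j σ x| ≤ C * (1 + |x|) ^ p) (l : Fin 2) {j k : ℕ} (hjk : j + k ≤ r) :
    DiagSmooth k fun θ => iteratedDeriv j σ (θ l) := by
  have hp : ∀ j ≤ r, PolyGrowth fun θ => iteratedDeriv j σ (θ l) := by
    intro j hj
    obtain ⟨C, p, hC⟩ := hσ_growth
    have hC0 : 0 ≤ C := by simpa using (abs_nonneg _).trans (hC j hj 0)
    refine ⟨(hσ.continuous_iteratedDeriv j (by exact_mod_cast hj)).comp (continuous_apply l),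
      C, p, hC0, fun θ => (hC j hj (θ l)).trans ?_⟩
    gcongr
    exact norm_le_pi_norm θ l
  induction k generalizing j with
  | zero => exact hp j hjk
  | succ k ih =>
    refine ⟨hp j (by omega), fun θ => iteratedDeriv (j + 1) σ (θ l), fun θ x => ?_,
      ih (by omega)⟩
    have h : HasDerivAt (iteratedDeriv j σ) (iteratedDeriv (j + 1) σ (θ l + x)) (θ l + x) := by
      rw [iteratedDeriv_succ]
      exact (hσ.differentiable_iteratedDeriv j (by exact_mod_cast (by omega : j < r))
        _).hasDerivAt
    simpa using h.comp_const_add (θ l) x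

end DiagSmooth

/-! ### Moments of the effective variables -/

variable {d : ℕ}

/-- The preactivations with an arbitrary coefficient `s` of the Gaussian variable. -/
def preact (q : EuclideanSpace ℝ (Fin d)) (s : ℝ) (v : EffVar d) (l : Fin 2) : ℝ :=
  ⟪v.1, q⟫ + s * v.2.1 + v.2.2 l

lemma Theta_eq_preact (q : EuclideanSpace ℝ (Fin d)) :
    Theta q = preact q (√(1 - ⟪q, q⟫)) := rfl

/-- A size function on the effective variables. -/
def effSize (v : EffVar d) : ℝ := 1 + ‖v.1‖ + |v.2.1| + ‖v.2.2‖

lemma one_le_effSize (v : EffVar d) : 1 ≤ effSize v := by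
  unfold effSize
  linarith [norm_nonneg v.1, abs_nonneg v.2.1, norm_nonneg v.2.2]

/-- The bound for `|s|` is `2` and not `1` because differentiation under the integral at a point
with `|s| ≤ 1` needs a dominating function on the unit ball about that point. -/
lemma norm_preact_le {q : EuclideanSpace ℝ (Fin d)} {s : ℝ} (hq : ‖q‖ ≤ 1) (hs : |s| ≤ 2)
    (v : EffVar d) : 1 + ‖preact q s v‖ ≤ 2 * effSize v := by
  have h : ‖preact q s v‖ ≤ ‖v.1‖ + 2 * |v.2.1| + ‖v.2.2‖ := by
    rw [pi_norm_le_iff_of_nonneg (by positivity)]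
    intro l
    have h1 : |⟪v.1, q⟫| ≤ ‖v.1‖ :=
      (abs_real_inner_le_norm _ _).trans (mul_le_of_le_one_right (norm_nonneg _) hq)
    have h2 : |s * v.2.1| ≤ 2 * |v.2.1| := by rw [abs_mul]; gcongr
    have h3 : |v.2.2 l| ≤ ‖v.2.2‖ := norm_le_pi_norm v.2.2 l
    exact (abs_add_three _ _ _).trans (by linarith)
  unfold effSize
  linarith [norm_nonneg v.1, norm_nonneg v.2.2]

/-- One dominating function for all `q` and `s`; it is the source of all constants that are uniform
over the unit ball. -/
lemma PolyGrowth.exists_le_effSize {F : (Fin 2 → ℝ) → ℝ} (hF : PolyGrowth F) :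
    ∃ (C : ℝ) (p : ℕ), 0 ≤ C ∧ ∀ (q : EuclideanSpace ℝ (Fin d)) (s : ℝ) (v : EffVar d),
      ‖q‖ ≤ 1 → |s| ≤ 2 → |F (preact q s v)| ≤ C * effSize v ^ p := by
  obtain ⟨-, C, p, hC, hF⟩ := hF
  refine ⟨C * 2 ^ p, p, by positivity, fun q s v hq hs => (hF _).trans ?_⟩
  rw [mul_assoc, ← mul_pow]
  gcongr
  exact norm_preact_le hq hs v

lemma continuous_preact (q : EuclideanSpace ℝ (Fin d)) (s : ℝ) :
    Continuous (preact q s) := by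
  unfold preact
  fun_prop

variable (Pc : Measure (EuclideanSpace ℝ (Fin d))) [IsProbabilityMeasure Pc]
  (ν : Measure (Fin 2 → ℝ)) [IsGaussian ν]

instance : IsProbabilityMeasure (effLaw Pc ν) := by unfold effLaw; infer_instance

lemma allMoments_norm_gaussian {E : Type*} [NormedAddCommGroup E] [NormedSpace ℝ E]
    [MeasurableSpace E] [BorelSpace E] [SecondCountableTopology E] [CompleteSpace E]
    (μ : Measure E) [IsGaussian μ] : AllMoments (fun x => ‖x‖) μ := by
  refine ⟨by fun_prop, fun k => ?_⟩
  simpa using (IsGaussian.memLp_id μ k (by simp)).integrable_norm_pow'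

lemma allMoments_id_gaussianReal : AllMoments (fun x => x) (gaussianReal 0 1) :=
  (allMoments_norm_gaussian (gaussianReal 0 1)).of_le (by fun_prop) fun x => by simp

variable {Pc} in
omit [IsProbabilityMeasure Pc] in
lemma allMoments_norm (hPc : ∀ p : ℕ, Integrable (fun c => ‖c‖ ^ p) Pc) :
    AllMoments (fun c => ‖c‖) Pc := ⟨by fun_prop, fun k => by simpa using hPc k⟩

variable {Pc} in
lemma allMoments_effSize (hPc : ∀ p : ℕ, Integrable (fun c => ‖c‖ ^ p) Pc) :
    AllMoments effSize (effLaw Pc ν) := by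
  have h1 : AllMoments (fun v : EffVar d => ‖v.1‖) (effLaw Pc ν) :=
    (allMoments_norm hPc).comp_measurePreserving measurePreserving_fst
  have h2 : AllMoments (fun v : EffVar d => |v.2.1|) (effLaw Pc ν) :=
    allMoments_id_gaussianReal.abs.comp_measurePreserving
      (measurePreserving_fst.comp measurePreserving_snd)
  have h3 : AllMoments (fun v : EffVar d => ‖v.2.2‖) (effLaw Pc ν) :=
    (allMoments_norm_gaussian ν).comp_measurePreserving
      (measurePreserving_snd.comp measurePreserving_snd)
  exact (((AllMoments.const 1).add h1).add h2).add h3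

/-- Weights in the hidden variable of at most linear growth. -/
def IsWeight (Φ : EuclideanSpace ℝ (Fin d) → ℝ) : Prop :=
  Continuous Φ ∧ ∀ c, |Φ c| ≤ 1 + ‖c‖

lemma isWeight_one : IsWeight fun _ : EuclideanSpace ℝ (Fin d) => 1 :=
  ⟨continuous_const, fun c => by simp⟩

lemma isWeight_apply (j : Fin d) : IsWeight fun c : EuclideanSpace ℝ (Fin d) => c j :=
  ⟨by fun_prop, fun c => (PiLp.norm_apply_le c j).trans (by linarith [norm_nonneg c])⟩

lemma IsWeight.abs_le {Φ : EuclideanSpace ℝ (Fin d) → ℝ} (hΦ : IsWeight Φ) (v : EffVar d) :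
    |Φ v.1| ≤ effSize v :=
  (hΦ.2 v.1).trans (by unfold effSize; linarith [abs_nonneg v.2.1, norm_nonneg v.2.2])

/-- `⟨Φ(c) F(θ)⟩`. -/
def bracket (Φ : EuclideanSpace ℝ (Fin d) → ℝ) (F : (Fin 2 → ℝ) → ℝ)
    (q : EuclideanSpace ℝ (Fin d)) (s : ℝ) : ℝ :=
  ∫ v, Φ v.1 * F (preact q s v) ∂(effLaw Pc ν)

variable {Pc} (hPc : ∀ p : ℕ, Integrable (fun c => ‖c‖ ^ p) Pc)
  {Φ : EuclideanSpace ℝ (Fin d) → ℝ} (hΦ : IsWeight Φ) {F : (Fin 2 → ℝ) → ℝ}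

include hPc in
lemma allMoments_preact (q : EuclideanSpace ℝ (Fin d)) (s : ℝ) (l : Fin 2) :
    AllMoments (fun v => preact q s v l) (effLaw Pc ν) := by
  refine ((allMoments_effSize ν hPc).const_mul (1 + ‖q‖ + |s|)).of_le
    ((continuous_apply l).comp (continuous_preact q s)).aestronglyMeasurable fun v => ?_
  have h0 : 0 ≤ effSize v := zero_le_one.trans (one_le_effSize v)
  rw [abs_of_nonneg (a := _ * effSize v) (by positivity)]
  have h1 : |⟪v.1, q⟫| ≤ ‖v.1‖ * ‖q‖ := abs_real_inner_le_norm _ _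
  have h2 : |s * v.2.1| = |s| * |v.2.1| := abs_mul _ _
  have h3 : |v.2.2 l| ≤ ‖v.2.2‖ := norm_le_pi_norm v.2.2 l
  refine (abs_add_three _ _ _).trans ?_
  unfold effSize
  nlinarith [norm_nonneg v.1, norm_nonneg v.2.2, norm_nonneg q, abs_nonneg s, abs_nonneg v.2.1,
    mul_nonneg (norm_nonneg q) (abs_nonneg v.2.1), mul_nonneg (norm_nonneg q) (norm_nonneg v.2.2),
    mul_nonneg (abs_nonneg s) (norm_nonneg v.1), mul_nonneg (abs_nonneg s) (norm_nonneg v.2.2)]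

include hPc in
lemma allMoments_comp_preact (hF : PolyGrowth F) (q : EuclideanSpace ℝ (Fin d)) (s : ℝ) :
    AllMoments (fun v => F (preact q s v)) (effLaw Pc ν) :=
  hF.allMoments (allMoments_preact ν hPc q s)

include hPc hΦ in
lemma allMoments_weight : AllMoments (fun v => Φ v.1) (effLaw Pc ν) :=
  (allMoments_effSize ν hPc).of_le (hΦ.1.comp continuous_fst).aestronglyMeasurable fun v =>
    (hΦ.abs_le v).trans (le_abs_self _)

include hPc hΦ in
lemma allMoments_bracket (hF : PolyGrowth F) (q : EuclideanSpace ℝ (Fin d)) (s : ℝ) :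
    AllMoments (fun v => Φ v.1 * F (preact q s v)) (effLaw Pc ν) :=
  (allMoments_weight ν hPc hΦ).mul (allMoments_comp_preact ν hPc hF q s)

include hPc in
lemma allMoments_gauss : AllMoments (fun v : EffVar d => v.2.1) (effLaw Pc ν) :=
  (allMoments_effSize ν hPc).of_le (by fun_prop) fun v => by
    rw [abs_of_nonneg (zero_le_one.trans (one_le_effSize v))]
    unfold effSize
    linarith [norm_nonneg v.1, norm_nonneg v.2.2]

lemma bracket_add {G : (Fin 2 → ℝ) → ℝ} (hPc : ∀ p : ℕ, Integrable (fun c => ‖c‖ ^ p) Pc)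
    (hΦ : IsWeight Φ) (hF : PolyGrowth F) (hG : PolyGrowth G) (a b : ℝ)
    (q : EuclideanSpace ℝ (Fin d)) (s : ℝ) :
    bracket Pc ν Φ (fun θ => a * F θ + b * G θ) q s
      = a * bracket Pc ν Φ F q s + b * bracket Pc ν Φ G q s := by
  unfold bracket
  rw [← integral_const_mul, ← integral_const_mul, ← integral_add]
  · congr 1; ext v; ring
  · exact ((allMoments_bracket ν hPc hΦ hF q s).const_mul a).integrable
  · exact ((allMoments_bracket ν hPc hΦ hG q s).const_mul b).integrable

lemma exists_bracket_le (hPc : ∀ p : ℕ, Integrable (fun c => ‖c‖ ^ p) Pc)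
    (hΦ : IsWeight Φ) (hF : PolyGrowth F) :
    ∃ K, ∀ q s, ‖q‖ ≤ 1 → |s| ≤ 2 → |bracket Pc ν Φ F q s| ≤ K := by
  obtain ⟨C, p, hC, h⟩ := hF.exists_le_effSize (d := d)
  refine ⟨∫ v, effSize v * (C * effSize v ^ p) ∂(effLaw Pc ν), fun q s hq hs => ?_⟩
  have hi := (allMoments_effSize ν hPc).mul (((allMoments_effSize ν hPc).pow p).const_mul C)
  rw [← Real.norm_eq_abs]
  refine norm_integral_le_of_norm_le hi.integrable (Eventually.of_forall fun v => ?_)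
  rw [norm_mul]
  exact mul_le_mul (hΦ.abs_le v) (h q s v hq hs) (abs_nonneg _)
    (zero_le_one.trans (one_le_effSize v))

/-- Gaussian integration by parts under the effective law. -/
lemma integral_gauss_mul (hPc : ∀ p : ℕ, Integrable (fun c => ‖c‖ ^ p) Pc) (hΦ : IsWeight Φ)
    {F' : (Fin 2 → ℝ) → ℝ} (hF : PolyGrowth F) (hF' : PolyGrowth F')
    (hd : ∀ (θ : Fin 2 → ℝ) (x : ℝ), HasDerivAt (fun x : ℝ => F fun l => θ l + x) (F' fun l => θ l + x) x)
    (q : EuclideanSpace ℝ (Fin d)) (s : ℝ) :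
    ∫ v, Φ v.1 * (v.2.1 * F (preact q s v)) ∂(effLaw Pc ν) = s * bracket Pc ν Φ F' q s := by
  have hint1 : Integrable (fun v : EffVar d => Φ v.1 * (v.2.1 * F (preact q s v)))
      (effLaw Pc ν) :=
    ((allMoments_weight ν hPc hΦ).mul ((allMoments_gauss ν hPc).mul
      (allMoments_comp_preact ν hPc hF q s))).integrable
  have hint2 : Integrable (fun v : EffVar d => Φ v.1 * F' (preact q s v)) (effLaw Pc ν) :=
    (allMoments_bracket ν hPc hΦ hF' q s).integrable
  unfold bracket
  rw [← integral_const_mul]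
  unfold effLaw at *
  rw [integral_prod _ hint1, integral_prod _ (hint2.const_mul s)]
  have h1 := hint1.prod_right_ae
  have h2 := (hint2.const_mul s).prod_right_ae
  refine integral_congr_ae ?_
  filter_upwards [h1, h2] with c hc1 hc2
  -- Fubini in the other order puts the Gaussian integral inside. With `c` and `γ` fixed the
  -- integrand is a function on the line with derivative `s * F'`, and Stein's identity applies.
  rw [integral_prod_symm _ hc1, integral_prod_symm _ hc2]
  congr 1
  ext γ
  have hpre (x : ℝ) : (fun l => ⟪c, q⟫ + γ l + s * x) = preact q s (c, x, γ) := by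
    ext l
    simp only [preact]
    ring
  have hder (x : ℝ) : HasDerivAt (fun x => F (preact q s (c, x, γ)))
      (s * F' (preact q s (c, x, γ))) x := by
    have h3 := (hd (fun l => ⟪c, q⟫ + γ l) (s * x)).scomp x ((hasDerivAt_id x).const_mul s)
    simp only [Function.comp_def, smul_eq_mul, mul_one, hpre] at h3
    exact h3
  have hmom (l : Fin 2) : AllMoments (fun x => preact q s (c, x, γ) l) (gaussianReal 0 1) :=
    ((AllMoments.const ⟪c, q⟫).add (allMoments_id_gaussianReal.const_mul s)).add
      (AllMoments.const (γ l))
  have hG := hF.allMoments hmom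
  have hG' := hF'.allMoments hmom
  have := integral_mul_gaussianReal hder hG.integrable
    (allMoments_id_gaussianReal.mul hG).integrable (hG'.const_mul s).integrable
  rw [integral_const_mul, this, ← integral_const_mul]
  congr 1
  ext x
  ring

end

/-! ### Lipschitz dependence of the brackets on the cosine similarity -/

section

variable {d : ℕ} {Pc : Measure (EuclideanSpace ℝ (Fin d))} [IsProbabilityMeasure Pc]
  (ν : Measure (Fin 2 → ℝ)) [IsGaussian ν]
  {Φ : EuclideanSpace ℝ (Fin d) → ℝ} {F F' : (Fin 2 → ℝ) → ℝ}

/-- For fixed `s`, `q` enters through the shift `⟪c, q⟫` common to both preactivations, so the mean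
value inequality along the diagonal applies. Points between the two shifts are preactivations of
convex combinations of `q` and `q'`, which stay in the unit ball, so the uniform bound on `F'`
remains available. -/
lemma exists_bracket_lipschitz_left (hPc : ∀ p : ℕ, Integrable (fun c => ‖c‖ ^ p) Pc)
    (hΦ : IsWeight Φ) (hF : PolyGrowth F) (hF' : PolyGrowth F')
    (hd : ∀ (θ : Fin 2 → ℝ) (x : ℝ),
      HasDerivAt (fun x : ℝ => F fun l => θ l + x) (F' fun l => θ l + x) x) :
    ∃ L, 0 ≤ L ∧ ∀ q q' s, ‖q‖ ≤ 1 → ‖q'‖ ≤ 1 → |s| ≤ 2 →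
      |bracket Pc ν Φ F q s - bracket Pc ν Φ F q' s| ≤ L * ‖q - q'‖ := by
  obtain ⟨C, p, hC, hF'b⟩ := hF'.exists_le_effSize (d := d)
  have hi := ((allMoments_effSize ν hPc).mul
    (((allMoments_effSize ν hPc).pow p).const_mul C)).mul (allMoments_effSize ν hPc)
  refine ⟨∫ v, effSize v * (C * effSize v ^ p) * effSize v ∂(effLaw Pc ν),
    integral_nonneg fun v => ?_, fun q q' s hq hq' hs => ?_⟩
  · have := zero_le_one.trans (one_le_effSize v)
    positivity
  unfold bracket
  rw [← integral_sub (allMoments_bracket ν hPc hΦ hF q s).integrable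
    (allMoments_bracket ν hPc hΦ hF q' s).integrable, ← integral_mul_const, ← Real.norm_eq_abs]
  refine norm_integral_le_of_norm_le (hi.integrable.mul_const _)
    (Eventually.of_forall fun v => ?_)
  have he := zero_le_one.trans (one_le_effSize v)
  rw [← mul_sub, norm_mul, mul_assoc, mul_assoc, mul_assoc]
  refine mul_le_mul (hΦ.abs_le v) ?_ (norm_nonneg _) he
  have hbase (q : EuclideanSpace ℝ (Fin d)) :
      preact q s v = fun l => (s * v.2.1 + v.2.2 l) + ⟪v.1, q⟫ := by
    ext l; simp only [preact]; ring
  have hseg := (convex_segment (𝕜 := ℝ) ⟪v.1, q'⟫ ⟪v.1, q⟫).norm_image_sub_le_of_norm_hasDerivWithin_le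
    (f := fun x => F fun l => (s * v.2.1 + v.2.2 l) + x)
    (f' := fun x => F' fun l => (s * v.2.1 + v.2.2 l) + x) (C := C * effSize v ^ p)
    (fun x _ => (hd _ x).hasDerivWithinAt) (fun x hx => ?_)
    (left_mem_segment ℝ _ _) (right_mem_segment ℝ _ _)
  · rw [hbase q, hbase q', ← mul_assoc]
    refine hseg.trans ?_
    gcongr
    rw [← inner_sub_right]
    refine (norm_inner_le_norm _ _).trans ?_
    gcongr
    unfold effSize
    linarith [abs_nonneg v.2.1, norm_nonneg v.2.2]
  · obtain ⟨a, b, ha, hb, hab, rfl⟩ := hx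
    have h1 : (fun l => s * v.2.1 + v.2.2 l + (a • ⟪v.1, q'⟫ + b • ⟪v.1, q⟫))
        = preact (a • q' + b • q) s v := by
      ext l
      simp only [preact, inner_add_right, inner_smul_right, smul_eq_mul]
      ring
    rw [h1]
    refine hF'b _ s v ?_ hs
    calc ‖a • q' + b • q‖ ≤ a * ‖q'‖ + b * ‖q‖ := by
          refine (norm_add_le _ _).trans ?_
          rw [norm_smul, norm_smul, Real.norm_of_nonneg ha, Real.norm_of_nonneg hb]
      _ ≤ a * 1 + b * 1 := by gcongr
      _ = 1 := by rw [mul_one, mul_one, hab]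

/-- Differentiation in `s` brings down the Gaussian variable; `integral_gauss_mul` then trades it
for a factor `s`. -/
lemma hasDerivAt_bracket_right (hPc : ∀ p : ℕ, Integrable (fun c => ‖c‖ ^ p) Pc)
    (hΦ : IsWeight Φ) (hF : PolyGrowth F) (hF' : PolyGrowth F')
    (hd : ∀ (θ : Fin 2 → ℝ) (x : ℝ),
      HasDerivAt (fun x : ℝ => F fun l => θ l + x) (F' fun l => θ l + x) x)
    {q : EuclideanSpace ℝ (Fin d)} (hq : ‖q‖ ≤ 1) {s : ℝ} (hs : |s| ≤ 1) :
    HasDerivAt (fun s => bracket Pc ν Φ F q s)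
      (∫ v, Φ v.1 * (v.2.1 * F' (preact q s v)) ∂(effLaw Pc ν)) s := by
  obtain ⟨C, p, hC, hF'b⟩ := hF'.exists_le_effSize (d := d)
  have hi := (allMoments_effSize ν hPc).mul ((allMoments_effSize ν hPc).mul
    (((allMoments_effSize ν hPc).pow p).const_mul C))
  refine (hasDerivAt_integral_of_dominated_loc_of_deriv_le (Metric.ball_mem_nhds s one_pos)
    (F := fun s v => Φ v.1 * F (preact q s v))
    (F' := fun s v => Φ v.1 * (v.2.1 * F' (preact q s v)))
    (bound := fun v => effSize v * (effSize v * (C * effSize v ^ p)))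
    (Eventually.of_forall fun s => (allMoments_bracket ν hPc hΦ hF q s).1)
    (allMoments_bracket ν hPc hΦ hF q s).integrable
    ((allMoments_weight ν hPc hΦ).mul ((allMoments_gauss ν hPc).mul
      (allMoments_comp_preact ν hPc hF' q s))).1
    (Eventually.of_forall fun v t ht => ?_) hi.integrable
    (Eventually.of_forall fun v t ht => ?_)).2
  · have he := zero_le_one.trans (one_le_effSize v)
    have ht' : |t| ≤ 2 := by
      have h1 : |t - s| < 1 := by simpa [Real.dist_eq] using ht
      calc |t| = |(t - s) + s| := by ring_nf
        _ ≤ |t - s| + |s| := abs_add_le _ _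
        _ ≤ 2 := by linarith
    have h2 : |v.2.1| ≤ effSize v := by
      unfold effSize
      linarith [norm_nonneg v.1, norm_nonneg v.2.2]
    rw [norm_mul, norm_mul]
    exact mul_le_mul (hΦ.abs_le v) (mul_le_mul h2 (hF'b q t v hq ht') (abs_nonneg _) he)
      (by positivity) he
  · have hpre (x : ℝ) : (fun l => ⟪v.1, q⟫ + v.2.2 l + x * v.2.1) = preact q x v := by
      ext l
      simp only [preact]
      ring
    have h3 := (hd (fun l => ⟪v.1, q⟫ + v.2.2 l) (t * v.2.1)).scomp t
      ((hasDerivAt_id t).mul_const v.2.1)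
    simp only [Function.comp_def, id, smul_eq_mul, one_mul, hpre] at h3
    exact h3.const_mul _

/-- A derivative of the form `s * k s` with bounded `k` makes `m` Lipschitz as a function of `s ^
2`: both `K * s ^ 2 + m s` and `K * s ^ 2 - m s` are monotone. -/
lemma abs_sub_le_of_deriv_eq_mul {m k : ℝ → ℝ} {K : ℝ}
    (hm : ∀ s, 0 ≤ s → s ≤ 1 → HasDerivAt m (s * k s) s)
    (hk : ∀ s, 0 ≤ s → s ≤ 1 → |k s| ≤ K) {s t : ℝ} (hs : 0 ≤ s) (hst : s ≤ t) (ht : t ≤ 1) :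
    |m t - m s| ≤ K * (t ^ 2 - s ^ 2) := by
  have hK : 0 ≤ K := (abs_nonneg _).trans (hk s hs (hst.trans ht))
  have key (ε : ℝ) (hε : |ε| = 1) : MonotoneOn (fun x => K * x ^ 2 + ε * m x) (Set.Icc 0 1) := by
    have hder : ∀ x ∈ Set.Icc (0 : ℝ) 1, HasDerivAt (fun x => K * x ^ 2 + ε * m x)
        (K * (2 * x) + ε * (x * k x)) x := fun x hx =>
      (((hasDerivAt_pow 2 x).const_mul K).congr_deriv (by norm_num)).add
        ((hm x hx.1 hx.2).const_mul ε)
    refine monotoneOn_of_deriv_nonneg (convex_Icc 0 1)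
      (fun x hx => (hder x hx).continuousAt.continuousWithinAt)
      (fun x hx => (hder x (interior_subset hx)).differentiableAt.differentiableWithinAt)
      fun x hx => ?_
    have hx' := interior_subset hx
    rw [(hder x hx').deriv]
    have h1 : |ε * k x| ≤ K := by rw [abs_mul, hε, one_mul]; exact hk x hx'.1 hx'.2
    nlinarith [neg_abs_le (ε * k x), hx'.1, mul_nonneg hK hx'.1]
  have h1 := key 1 (by simp) ⟨hs, hst.trans ht⟩ ⟨hs.trans hst, ht⟩ hst
  have h2 := key (-1) (by simp) ⟨hs, hst.trans ht⟩ ⟨hs.trans hst, ht⟩ hst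
  simp only at h1 h2
  rw [abs_le]
  constructor <;> linarith

/-- Bounded Lipschitz real functions on the closed unit ball. -/
def LipBdd (h : EuclideanSpace ℝ (Fin d) → ℝ) : Prop :=
  (∃ K, 0 ≤ K ∧ ∀ q, ‖q‖ ≤ 1 → |h q| ≤ K) ∧
    ∃ L, 0 ≤ L ∧ ∀ q q', ‖q‖ ≤ 1 → ‖q'‖ ≤ 1 → |h q - h q'| ≤ L * ‖q - q'‖

namespace LipBdd

variable {f g : EuclideanSpace ℝ (Fin d) → ℝ}

lemma const (a : ℝ) : LipBdd fun _ : EuclideanSpace ℝ (Fin d) => a :=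
  ⟨⟨|a|, abs_nonneg a, fun _ _ => le_rfl⟩, 0, le_rfl, fun _ _ _ _ => by simp⟩

lemma apply (j : Fin d) : LipBdd fun q : EuclideanSpace ℝ (Fin d) => q j :=
  ⟨⟨1, zero_le_one, fun q hq => (PiLp.norm_apply_le q j).trans hq⟩, 1, zero_le_one,
    fun q q' _ _ => by simpa using PiLp.norm_apply_le (q - q') j⟩

lemma add (hf : LipBdd f) (hg : LipBdd g) : LipBdd fun q => f q + g q := by
  obtain ⟨⟨K, hK, hfK⟩, L, hL, hfL⟩ := hf
  obtain ⟨⟨K', hK', hgK⟩, L', hL', hgL⟩ := hg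
  refine ⟨⟨K + K', by positivity, fun q hq =>
    (abs_add_le _ _).trans (add_le_add (hfK q hq) (hgK q hq))⟩, L + L', by positivity,
    fun q q' hq hq' => ?_⟩
  rw [add_sub_add_comm, add_mul]
  exact (abs_add_le _ _).trans (add_le_add (hfL q q' hq hq') (hgL q q' hq hq'))

lemma mul (hf : LipBdd f) (hg : LipBdd g) : LipBdd fun q => f q * g q := by
  obtain ⟨⟨K, hK, hfK⟩, L, hL, hfL⟩ := hf
  obtain ⟨⟨K', hK', hgK⟩, L', hL', hgL⟩ := hg
  refine ⟨⟨K * K', by positivity, fun q hq => ?_⟩, K * L' + K' * L, by positivity,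
    fun q q' hq hq' => ?_⟩
  · rw [abs_mul]
    exact mul_le_mul (hfK q hq) (hgK q hq) (abs_nonneg _) hK
  · have h1 : |f q * (g q - g q')| ≤ K * (L' * ‖q - q'‖) := by
      rw [abs_mul]
      exact mul_le_mul (hfK q hq) (hgL q q' hq hq') (abs_nonneg _) hK
    have h2 : |g q' * (f q - f q')| ≤ K' * (L * ‖q - q'‖) := by
      rw [abs_mul]
      exact mul_le_mul (hgK q' hq') (hfL q q' hq hq') (abs_nonneg _) hK'
    calc |f q * g q - f q' * g q'| = |f q * (g q - g q') + g q' * (f q - f q')| := by ring_nf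
      _ ≤ _ := (abs_add_le _ _).trans (add_le_add h1 h2)
      _ = _ := by ring

lemma const_mul (a : ℝ) (hf : LipBdd f) : LipBdd fun q => a * f q := (const a).mul hf

lemma sub (hf : LipBdd f) (hg : LipBdd g) : LipBdd fun q => f q - g q := by
  simpa [sub_eq_add_neg] using hf.add (hg.const_mul (-1))

lemma sum {ι : Type*} (s : Finset ι) {f : ι → EuclideanSpace ℝ (Fin d) → ℝ}
    (hf : ∀ i ∈ s, LipBdd (f i)) : LipBdd fun q => ∑ i ∈ s, f i q := by
  classical
  induction s using Finset.induction_on with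
  | empty => simpa using const 0
  | insert a s ha ih =>
    simp only [Finset.sum_insert ha]
    exact (hf a (by simp)).add (ih fun i hi => hf i (by simp [hi]))

lemma congr (hf : LipBdd f) (h : ∀ q, ‖q‖ ≤ 1 → g q = f q) : LipBdd g := by
  obtain ⟨⟨K, hK, hfK⟩, L, hL, hfL⟩ := hf
  exact ⟨⟨K, hK, fun q hq => by rw [h q hq]; exact hfK q hq⟩, L, hL, fun q q' hq hq' => by
    rw [h q hq, h q' hq']; exact hfL q q' hq hq'⟩

end LipBdd

lemma sqrt_one_sub_mem {q : EuclideanSpace ℝ (Fin d)} (hq : ‖q‖ ≤ 1) :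
    0 ≤ √(1 - ⟪q, q⟫) ∧ √(1 - ⟪q, q⟫) ≤ 1 ∧ √(1 - ⟪q, q⟫) ^ 2 = 1 - ‖q‖ ^ 2 := by
  rw [real_inner_self_eq_norm_sq]
  refine ⟨Real.sqrt_nonneg _, Real.sqrt_le_one.2 (by linarith [sq_nonneg ‖q‖]),
    Real.sq_sqrt ?_⟩
  nlinarith [norm_nonneg q]

/-- Brackets are Lipschitz up to the boundary of the unit ball: since `√(1 - qᵀq)` multiplies a
Gaussian variable, only its square matters. -/
lemma lipBdd_bracket (hPc : ∀ p : ℕ, Integrable (fun c => ‖c‖ ^ p) Pc)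
    (hΦ : IsWeight Φ) (hF : DiagSmooth 2 F) :
    LipBdd fun q => bracket Pc ν Φ F q (√(1 - ⟪q, q⟫)) := by
  obtain ⟨h0, F', hd, h1, F'', hd', h2⟩ := hF
  obtain ⟨K, hK⟩ := exists_bracket_le ν hPc hΦ h0
  obtain ⟨K'', hK''⟩ := exists_bracket_le ν hPc hΦ h2
  obtain ⟨L, hL, hFL⟩ := exists_bracket_lipschitz_left ν hPc hΦ h0 h1 hd
  have hs2 {q : EuclideanSpace ℝ (Fin d)} (hq : ‖q‖ ≤ 1) : |√(1 - ⟪q, q⟫)| ≤ 2 := by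
    obtain ⟨ha, hb, -⟩ := sqrt_one_sub_mem hq
    rw [abs_of_nonneg ha]
    linarith
  have hK''0 : 0 ≤ K'' := (abs_nonneg _).trans (hK'' 0 0 (by simp) (by simp))
  refine ⟨⟨K, (abs_nonneg _).trans (hK 0 0 (by simp) (by simp)),
    fun q hq => hK q _ hq (hs2 hq)⟩, L + K'' * 2, by positivity, fun q q' hq hq' => ?_⟩
  -- Gaussian integration by parts gives the derivative `s * ⟨Φ F''⟩`. This costs the second
  -- diagonal derivative of `F`.
  have hright {s t : ℝ} (hs : 0 ≤ s) (hst : s ≤ t) (ht : t ≤ 1) :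
      |bracket Pc ν Φ F q' t - bracket Pc ν Φ F q' s| ≤ K'' * (t ^ 2 - s ^ 2) := by
    refine abs_sub_le_of_deriv_eq_mul (k := fun s => bracket Pc ν Φ F'' q' s)
      (fun s hs0 hs1 => ?_) (fun s hs0 hs1 => ?_) hs hst ht
    · rw [← integral_gauss_mul ν hPc hΦ h1 h2 hd']
      exact hasDerivAt_bracket_right ν hPc hΦ h0 h1 hd hq' (by rwa [abs_of_nonneg hs0])
    · exact hK'' q' s hq' (by rw [abs_of_nonneg hs0]; linarith)
  set s := √(1 - ⟪q, q⟫)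
  set s' := √(1 - ⟪q', q'⟫)
  obtain ⟨ha, hb, hc⟩ : 0 ≤ s ∧ s ≤ 1 ∧ s ^ 2 = 1 - ‖q‖ ^ 2 := sqrt_one_sub_mem hq
  obtain ⟨ha', hb', hc'⟩ : 0 ≤ s' ∧ s' ≤ 1 ∧ s' ^ 2 = 1 - ‖q'‖ ^ 2 := sqrt_one_sub_mem hq'
  -- The square roots are not Lipschitz in `q` at the sphere, but their squares `1 - ‖q‖ ^ 2` are.
  have hsq : |s ^ 2 - s' ^ 2| ≤ 2 * ‖q - q'‖ := by
    rw [hc, hc', show 1 - ‖q‖ ^ 2 - (1 - ‖q'‖ ^ 2) = (‖q'‖ + ‖q‖) * (‖q'‖ - ‖q‖) by ring, abs_mul,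
      abs_of_nonneg (by positivity), norm_sub_rev]
    gcongr
    · linarith
    · exact abs_norm_sub_norm_le _ _
  have h4 : |bracket Pc ν Φ F q' s - bracket Pc ν Φ F q' s'| ≤ K'' * (2 * ‖q - q'‖) := by
    rcases le_total s s' with h | h
    · rw [abs_sub_comm]
      refine (hright ha h hb').trans ?_
      gcongr
      exact (le_abs_self _).trans (by rwa [abs_sub_comm])
    · refine (hright ha' h hb).trans ?_
      gcongr
      exact (le_abs_self _).trans hsq
  have h3 := hFL q q' s hq hq' (hs2 hq)
  calc |bracket Pc ν Φ F q s - bracket Pc ν Φ F q' s'|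
      = |(bracket Pc ν Φ F q s - bracket Pc ν Φ F q' s)
        + (bracket Pc ν Φ F q' s - bracket Pc ν Φ F q' s')| := by ring_nf
    _ ≤ _ := (abs_add_le _ _).trans (add_le_add h3 h4)
    _ = _ := by ring

end

/-! ### The limiting vector field -/

section

variable {d : ℕ} {Pc : Measure (EuclideanSpace ℝ (Fin d))} [IsProbabilityMeasure Pc]
  {ν : Measure (Fin 2 → ℝ)} [IsGaussian ν] {σ : ℝ → ℝ}

/-- Finite sums of products of a bounded Lipschitz function of `q` and a smooth function of the
preactivations. -/
inductive LipFamily : (EuclideanSpace ℝ (Fin d) → (Fin 2 → ℝ) → ℝ) → Prop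
  | base {a : EuclideanSpace ℝ (Fin d) → ℝ} {G : (Fin 2 → ℝ) → ℝ} (ha : LipBdd a)
      (hG : DiagSmooth 2 G) : LipFamily fun q θ => a q * G θ
  | add {F G : EuclideanSpace ℝ (Fin d) → (Fin 2 → ℝ) → ℝ} (hF : LipFamily F)
      (hG : LipFamily G) : LipFamily fun q θ => F q θ + G q θ

namespace LipFamily

variable {F G : EuclideanSpace ℝ (Fin d) → (Fin 2 → ℝ) → ℝ}

lemma of_diagSmooth {G : (Fin 2 → ℝ) → ℝ} (hG : DiagSmooth 2 G) :
    LipFamily fun _ : EuclideanSpace ℝ (Fin d) => G := by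
  simpa using base (LipBdd.const (d := d) 1) hG

lemma of_lipBdd {a : EuclideanSpace ℝ (Fin d) → ℝ} (ha : LipBdd a) :
    LipFamily fun q _ => a q := by
  simpa using base ha (DiagSmooth.const 2 1)

lemma mul (hF : LipFamily F) (hG : LipFamily G) : LipFamily fun q θ => F q θ * G q θ := by
  induction hF with
  | @base a F ha hF =>
    induction hG with
    | @base b G hb hG => simpa only [mul_mul_mul_comm] using base (ha.mul hb) (hF.mul hG)
    | add _ _ ih1 ih2 => simpa only [mul_add] using ih1.add ih2
  | add _ _ ih1 ih2 => simpa only [add_mul] using ih1.add ih2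

lemma polyGrowth (hF : LipFamily F) (q : EuclideanSpace ℝ (Fin d)) : PolyGrowth (F q) := by
  induction hF with
  | base ha hG => exact (PolyGrowth.const _).mul hG.polyGrowth
  | add _ _ ih1 ih2 => exact ih1.add ih2

lemma lipBdd_bracket (hF : LipFamily F) (hPc : ∀ p : ℕ, Integrable (fun c => ‖c‖ ^ p) Pc)
    {Φ : EuclideanSpace ℝ (Fin d) → ℝ} (hΦ : IsWeight Φ) :
    LipBdd fun q => bracket Pc ν Φ (F q) q (√(1 - ⟪q, q⟫)) := by
  induction hF with
  | @base a G ha hG =>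
    refine (ha.mul (ContrastiveDynamics.lipBdd_bracket ν hPc hΦ hG)).congr fun q _ => ?_
    simpa using bracket_add ν hPc hΦ hG.polyGrowth hG.polyGrowth (a q) 0 q (√(1 - ⟪q, q⟫))
  | add h1 h2 ih1 ih2 =>
    refine (ih1.add ih2).congr fun q _ => ?_
    simpa using bracket_add ν hPc hΦ (h1.polyGrowth q) (h2.polyGrowth q) 1 1 q (√(1 - ⟪q, q⟫))

end LipFamily

lemma fFun'_eq (hσ : ContDiff ℝ 4 σ) (y θ : Fin 2 → ℝ) {l l' : Fin 2} (hl : l ≠ l') :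
    fFun' σ y l l' θ = -2 * (deriv σ (θ l) * deriv σ (θ l'))
      + -2 * (σ (θ l) - y l) * deriv (deriv σ) (θ l') := by
  have h0 (x : ℝ) : HasDerivAt σ (deriv σ x) x :=
    (hσ.differentiable (by norm_num) x).hasDerivAt
  have h1 (x : ℝ) : HasDerivAt (deriv σ) (deriv (deriv σ) x) x := by
    have := hσ.differentiable_iteratedDeriv 1 (by norm_num)
    rw [iteratedDeriv_one] at this
    exact (this x).hasDerivAt
  have hA : deriv (fun x => fFun σ y l l' (Function.update θ l x)) (θ l)
      = -2 * (deriv σ (θ l) * deriv σ (θ l')) := by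
    have : (fun x => fFun σ y l l' (Function.update θ l x))
        = fun x => -2 * (σ x - y l) * deriv σ (θ l') := by
      ext x
      simp [fFun, hl.symm]
    rw [this, ((((h0 _).sub_const _).const_mul (-2)).mul_const _).deriv]
    ring
  have hB : deriv (fun x => fFun σ y l l' (Function.update θ l' x)) (θ l')
      = -2 * (σ (θ l) - y l) * deriv (deriv σ) (θ l') := by
    have : (fun x => fFun σ y l l' (Function.update θ l' x))
        = fun x => -2 * (σ (θ l) - y l) * deriv σ x := by
      ext x
      simp [fFun, hl]
    rw [this, ((h1 _).const_mul _).deriv]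
  unfold fFun'
  rw [Fin.sum_univ_two]
  rcases (by omega : l = 0 ∧ l' = 1 ∨ l = 1 ∧ l' = 0) with ⟨rfl, rfl⟩ | ⟨rfl, rfl⟩
  · rw [hA, hB]
  · rw [hA, hB, add_comm]

/-- Identifies the sum of partial derivatives in the limiting equation with the diagonal derivative
that Gaussian integration by parts produces. -/
lemma hasDerivAt_fFun_diag (hσ : ContDiff ℝ 4 σ) (y : Fin 2 → ℝ) {l l' : Fin 2} (hl : l ≠ l')
    (θ : Fin 2 → ℝ) (x : ℝ) :
    HasDerivAt (fun x : ℝ => fFun σ y l l' fun i => θ i + x)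
      (fFun' σ y l l' fun i => θ i + x) x := by
  have h0 (x : ℝ) : HasDerivAt σ (deriv σ x) x :=
    (hσ.differentiable (by norm_num) x).hasDerivAt
  have h1 (x : ℝ) : HasDerivAt (deriv σ) (deriv (deriv σ) x) x := by
    have := hσ.differentiable_iteratedDeriv 1 (by norm_num)
    rw [iteratedDeriv_one] at this
    exact (this x).hasDerivAt
  rw [fFun'_eq hσ y _ hl]
  unfold fFun
  refine (((((h0 _).comp_const_add (θ l) x).sub_const (y l)).const_mul (-2)).mul
    ((h1 _).comp_const_add (θ l') x)).congr_deriv ?_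
  ring

/-! ### Regularity of the limiting drift and its sign on the sphere -/

section Field

variable (hPc : ∀ p : ℕ, Integrable (fun c => ‖c‖ ^ p) Pc) (hσ : ContDiff ℝ 4 σ)
  (hσ_growth : ∃ (C : ℝ) (p : ℕ), ∀ j ≤ 4, ∀ x : ℝ, |iteratedDeriv j σ x| ≤ C * (1 + |x|) ^ p)

include hσ hσ_growth

lemma diagSmooth_activation (l : Fin 2) : DiagSmooth 4 fun θ => σ (θ l) := by
  simpa using DiagSmooth.iteratedDeriv_eval (r := 4) (by exact_mod_cast hσ) hσ_growth l
    (j := 0) (k := 4) le_rfl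

lemma diagSmooth_deriv (l : Fin 2) : DiagSmooth 3 fun θ => deriv σ (θ l) := by
  simpa using DiagSmooth.iteratedDeriv_eval (r := 4) (by exact_mod_cast hσ) hσ_growth l
    (j := 1) (k := 3) le_rfl

lemma diagSmooth_deriv2 (l : Fin 2) : DiagSmooth 2 fun θ => deriv (deriv σ) (θ l) := by
  simpa [iteratedDeriv_succ] using DiagSmooth.iteratedDeriv_eval (r := 4)
    (by exact_mod_cast hσ) hσ_growth l (j := 2) (k := 2) le_rfl

include hPc

lemma lipBdd_ybar (l : Fin 2) : LipBdd fun q => ybar σ Pc ν q l := by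
  refine (lipBdd_bracket ν hPc isWeight_one
    (diagSmooth_activation hσ hσ_growth l).of_succ.of_succ).congr fun q _ => ?_
  simp only [bracket, one_mul, ybar, Theta_eq_preact]

/-- Besides the preactivations, `q` enters through the centring `ybar`. It is itself a bracket,
hence Lipschitz, and it separates from the preactivations as a coefficient. -/
lemma lipFamily_fFun (l l' : Fin 2) : LipFamily fun q => fFun σ (ybar σ Pc ν q) l l' := by
  have h1 := LipFamily.of_diagSmooth (d := d) (diagSmooth_activation hσ hσ_growth l).of_succ.of_succ
  have h2 := LipFamily.of_diagSmooth (d := d) (diagSmooth_deriv hσ hσ_growth l').of_succ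
  have h3 := LipFamily.of_lipBdd ((lipBdd_ybar (ν := ν) hPc hσ hσ_growth l).const_mul (-1))
  have h4 := LipFamily.of_lipBdd (LipBdd.const (d := d) (-2))
  convert (h4.mul (h1.add h3)).mul h2 using 3
  simp only [fFun]
  ring

/-- All four derivatives of `σ` are used here: `f'` contains `σ''`, and Lipschitz dependence of its
bracket costs two more. -/
lemma lipFamily_fFun' {l l' : Fin 2} (hl : l ≠ l') :
    LipFamily fun q => fFun' σ (ybar σ Pc ν q) l l' := by
  have h1 := LipFamily.of_diagSmooth (d := d) (diagSmooth_activation hσ hσ_growth l).of_succ.of_succ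
  have h2 (l) := LipFamily.of_diagSmooth (d := d) (diagSmooth_deriv hσ hσ_growth l).of_succ
  have h2' := LipFamily.of_diagSmooth (d := d) (diagSmooth_deriv2 hσ hσ_growth l')
  have h3 := LipFamily.of_lipBdd ((lipBdd_ybar (ν := ν) hPc hσ hσ_growth l).const_mul (-1))
  have h4 := LipFamily.of_lipBdd (LipBdd.const (d := d) (-2))
  have := (h4.mul ((h2 l).mul (h2 l'))).add ((h4.mul (h1.add h3)).mul h2')
  convert this using 3
  rw [fFun'_eq hσ _ _ hl]
  ring

lemma integrable_fFun_smul (q : EuclideanSpace ℝ (Fin d)) (l l' : Fin 2) :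
    Integrable (fun v : EffVar d => fFun σ (ybar σ Pc ν q) l l' (Theta q v) • v.1)
      (effLaw Pc ν) := by
  have hF := (lipFamily_fFun (ν := ν) hPc hσ hσ_growth l l').polyGrowth q
  have h2 := ((allMoments_comp_preact ν hPc hF q (√(1 - ⟪q, q⟫))).abs.mul
    (allMoments_effSize ν hPc)).integrable
  refine h2.mono' ?_ (Eventually.of_forall fun v => ?_)
  · exact ((hF.1.comp (continuous_preact q _)).smul continuous_fst).aestronglyMeasurable
  · rw [norm_smul]
    gcongr
    · exact le_rfl
    · unfold effSize
      linarith [abs_nonneg v.2.1, norm_nonneg v.2.2]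

lemma gVec_apply (τ : ℝ) (q : EuclideanSpace ℝ (Fin d)) (j : Fin d) :
    gVec σ τ Pc ν q j = τ / 2 *
      (bracket Pc ν (fun c => c j) (fFun σ (ybar σ Pc ν q) 0 1) q (√(1 - ⟪q, q⟫))
        + bracket Pc ν (fun c => c j) (fFun σ (ybar σ Pc ν q) 1 0) q (√(1 - ⟪q, q⟫)))
      - τ / 2 * (bracket Pc ν (fun _ => 1) (fFun' σ (ybar σ Pc ν q) 0 1) q (√(1 - ⟪q, q⟫))
        + bracket Pc ν (fun _ => 1) (fFun' σ (ybar σ Pc ν q) 1 0) q (√(1 - ⟪q, q⟫))) * q j := by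
  have h (l l' : Fin 2) : (∫ v, fFun σ (ybar σ Pc ν q) l l' (Theta q v) • v.1 ∂(effLaw Pc ν)) j
      = bracket Pc ν (fun c => c j) (fFun σ (ybar σ Pc ν q) l l') q (√(1 - ⟪q, q⟫)) := by
    have := (EuclideanSpace.proj (𝕜 := ℝ) j).integral_comp_comm
      (integrable_fFun_smul (ν := ν) hPc hσ hσ_growth q l l')
    refine this.symm.trans ?_
    unfold bracket
    congr 1
    ext v
    simp [Theta_eq_preact, mul_comm]
  unfold gVec
  rw [integral_add (integrable_fFun_smul hPc hσ hσ_growth q 0 1)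
    (integrable_fFun_smul hPc hσ hσ_growth q 1 0)]
  simp only [PiLp.sub_apply, PiLp.smul_apply, PiLp.add_apply, h, smul_eq_mul]
  simp [bracket, Theta_eq_preact]

lemma lipBdd_gVec (τ : ℝ) (j : Fin d) : LipBdd fun q => gVec σ τ Pc ν q j := by
  have hb := (lipFamily_fFun (ν := ν) hPc hσ hσ_growth 0 1).lipBdd_bracket (ν := ν) hPc
    (isWeight_apply j)
  have hb' := (lipFamily_fFun (ν := ν) hPc hσ hσ_growth 1 0).lipBdd_bracket (ν := ν) hPc
    (isWeight_apply j)
  have hc := (lipFamily_fFun' (ν := ν) hPc hσ hσ_growth (l := 0) (l' := 1)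
    (by decide)).lipBdd_bracket (ν := ν) hPc isWeight_one
  have hc' := (lipFamily_fFun' (ν := ν) hPc hσ hσ_growth (l := 1) (l' := 0)
    (by decide)).lipBdd_bracket (ν := ν) hPc isWeight_one
  exact (((hb.add hb').const_mul (τ / 2)).sub
    (((hc.add hc').const_mul (τ / 2)).mul (LipBdd.apply j))).congr
    fun q _ => gVec_apply hPc hσ hσ_growth τ q j

lemma lipBdd_LambdaCoef (τ : ℝ) (m : ℕ) : LipBdd fun q => LambdaCoef σ τ m Pc ν q := by
  have h1 := lipFamily_fFun (ν := ν) hPc hσ hσ_growth 0 1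
  have h2 := lipFamily_fFun (ν := ν) hPc hσ hσ_growth 1 0
  have ha := (h1.mul h1).lipBdd_bracket (ν := ν) hPc isWeight_one
  have hb := (h2.mul h2).lipBdd_bracket (ν := ν) hPc isWeight_one
  have hc := (h1.mul h2).lipBdd_bracket (ν := ν) hPc isWeight_one
  refine ((((ha.const_mul (1 + ∫ γ, γ 1 ^ 2 ∂ν)).add
    (hb.const_mul (1 + ∫ γ, γ 0 ^ 2 ∂ν))).add
    (hc.const_mul (2 * (1 + ∫ γ, γ 0 * γ 1 ∂ν)))).const_mul (τ ^ 2 / (4 * m))).congr fun q _ => ?_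
  simp [LambdaCoef, bracket, Theta_eq_preact, sq]

/-- A quadratic form built from two positive semidefinite `2 × 2` moment matrices. -/
lemma LambdaCoef_nonneg (τ : ℝ) (m : ℕ) (q : EuclideanSpace ℝ (Fin d)) :
    0 ≤ LambdaCoef σ τ m Pc ν q := by
  have hγ (l : Fin 2) : AllMoments (fun γ : Fin 2 → ℝ => γ l) ν :=
    (allMoments_norm_gaussian ν).of_le (measurable_pi_apply l).aestronglyMeasurable fun γ => by
      simpa using norm_le_pi_norm γ l
  have hf (l l' : Fin 2) : AllMoments
      (fun v => fFun σ (ybar σ Pc ν q) l l' (Theta q v)) (effLaw Pc ν) :=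
    allMoments_comp_preact ν hPc ((lipFamily_fFun (ν := ν) hPc hσ hσ_growth l l').polyGrowth q) q _
  have quad {Ω : Type _} [MeasurableSpace Ω] {μ : Measure Ω} {X Y : Ω → ℝ}
      (hX : AllMoments X μ) (hY : AllMoments Y μ) (s t : ℝ) :
      0 ≤ s ^ 2 * ∫ ω, X ω ^ 2 ∂μ + 2 * (s * t) * ∫ ω, X ω * Y ω ∂μ + t ^ 2 * ∫ ω, Y ω ^ 2 ∂μ := by
    have : ∫ ω, (s * X ω + t * Y ω) ^ 2 ∂μ = s ^ 2 * ∫ ω, X ω ^ 2 ∂μ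
        + 2 * (s * t) * ∫ ω, X ω * Y ω ∂μ + t ^ 2 * ∫ ω, Y ω ^ 2 ∂μ := by
      rw [← integral_const_mul, ← integral_const_mul, ← integral_const_mul, ← integral_add,
        ← integral_add]
      · congr 1; ext ω; ring
      · exact ((hX.integrable_pow 2).const_mul _).add ((hX.mul hY).integrable.const_mul _)
      · exact (hY.integrable_pow 2).const_mul _
      · exact (hX.integrable_pow 2).const_mul _
      · exact (hX.mul hY).integrable.const_mul _
    rw [← this]
    exact integral_nonneg fun ω => sq_nonneg _
  unfold LambdaCoef
  refine mul_nonneg (by positivity) ?_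
  -- This is the part of `Λ` coming from the three summands `1`; the rest, with the noise moments,
  -- is `key`.
  have h1 := quad (hf 0 1) (hf 1 0) 1 1
  have h2 := quad (hf 0 1) (hf 1 0)
  have h3 := quad (hγ 1) (hγ 0)
  have ha : 0 ≤ ∫ γ, γ 1 ^ 2 ∂ν := integral_nonneg fun γ => sq_nonneg _
  have hb : 0 ≤ ∫ γ, γ 0 ^ 2 ∂ν := integral_nonneg fun γ => sq_nonneg _
  have hY : 0 ≤ ∫ v, fFun σ (ybar σ Pc ν q) 1 0 (Theta q v) ^ 2 ∂(effLaw Pc ν) :=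
    integral_nonneg fun γ => sq_nonneg _
  have hcomm : ∫ γ : Fin 2 → ℝ, γ 1 * γ 0 ∂ν = ∫ γ, γ 0 * γ 1 ∂ν := by
    congr 1; ext γ; ring
  simp only [hcomm] at h3
  set a := ∫ γ, γ 1 ^ 2 ∂ν
  set b := ∫ γ, γ 0 ^ 2 ∂ν
  set c := ∫ γ, γ 0 * γ 1 ∂ν
  set X := ∫ v, fFun σ (ybar σ Pc ν q) 0 1 (Theta q v) ^ 2 ∂(effLaw Pc ν)
  set Y := ∫ v, fFun σ (ybar σ Pc ν q) 1 0 (Theta q v) ^ 2 ∂(effLaw Pc ν)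
  set Z := ∫ v, fFun σ (ybar σ Pc ν q) 0 1 (Theta q v)
    * fFun σ (ybar σ Pc ν q) 1 0 (Theta q v) ∂(effLaw Pc ν)
  -- The trace of the product of the Gram matrices of `(γ 1, γ 0)` and `(f₁₂, f₂₁)`.
  have key : 0 ≤ a * X + b * Y + 2 * c * Z := by
    rcases ha.eq_or_lt with h0 | h0
    -- If `a = 0` and `c ≠ 0`, the form `h3` takes the value `-1` at `(-(b + 1) / (2 * c), 1)`.
    · have hc : c = 0 := by
        by_contra hc
        have := h3 (-(b + 1) / (2 * c)) 1
        rw [← h0] at this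
        have h4 : 2 * (-(b + 1) / (2 * c) * 1) * c = -(b + 1) := by field_simp
        rw [h4] at this
        linarith
      rw [← h0, hc]
      nlinarith
    -- At `(-c, a)` the noise form equals `a * (a * b - c ^ 2)`, which gives `c ^ 2 ≤ a * b`. The
    -- other form at `(a, c)` is then at most `a` times the claimed quantity.
    · have h4 := h3 (-c) a
      have h5 : c ^ 2 ≤ a * b := by
        have : 0 ≤ a * (a * b - c ^ 2) := by nlinarith
        linarith [(mul_nonneg_iff_of_pos_left h0).1 this]
      have h6 := h2 a c
      have h7 : 0 ≤ a * (a * X + b * Y + 2 * c * Z) := by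
        nlinarith [mul_le_mul_of_nonneg_right h5 hY]
      exact (mul_nonneg_iff_of_pos_left h0).1 h7
  linarith

omit hPc hσ hσ_growth in
/-- The right-hand side of the limiting equation. -/
def driftField (σ : ℝ → ℝ) (τ : ℝ) (m : ℕ) (Pc : Measure (EuclideanSpace ℝ (Fin d)))
    (ν : Measure (Fin 2 → ℝ)) (q : EuclideanSpace ℝ (Fin d)) : EuclideanSpace ℝ (Fin d) :=
  (⟪q, gVec σ τ Pc ν q⟫ - LambdaCoef σ τ m Pc ν q / 2) • q - gVec σ τ Pc ν q

omit hPc hσ hσ_growth in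
lemma norm_le_sum_abs (x : EuclideanSpace ℝ (Fin d)) : ‖x‖ ≤ ∑ j, |x j| := by
  rw [EuclideanSpace.norm_eq]
  refine Real.sqrt_le_iff.2 ⟨Finset.sum_nonneg fun j _ => abs_nonneg _, ?_⟩
  exact Finset.sum_sq_le_sq_sum_of_nonneg fun j _ => norm_nonneg _

omit hPc hσ hσ_growth in
lemma exists_bound_lipschitz_of_coords
    {R : EuclideanSpace ℝ (Fin d) → EuclideanSpace ℝ (Fin d)}
    (hR : ∀ j, LipBdd fun q => R q j) :
    ∃ K L : ℝ, 0 ≤ K ∧ 0 ≤ L ∧ (∀ q, ‖q‖ ≤ 1 → ‖R q‖ ≤ K) ∧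
      ∀ q q', ‖q‖ ≤ 1 → ‖q'‖ ≤ 1 → ‖R q - R q'‖ ≤ L * ‖q - q'‖ := by
  choose hB hL using hR
  choose K hK hK' using hB
  choose L hL hL' using hL
  refine ⟨∑ j, K j, ∑ j, L j, Finset.sum_nonneg fun j _ => hK j,
    Finset.sum_nonneg fun j _ => hL j, fun q hq => ?_, fun q q' hq hq' => ?_⟩
  · exact (norm_le_sum_abs _).trans (Finset.sum_le_sum fun j _ => hK' j q hq)
  · rw [Finset.sum_mul]
    exact (norm_le_sum_abs _).trans (Finset.sum_le_sum fun j _ => hL' j q q' hq hq')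

lemma exists_driftField_bound_lipschitz (τ : ℝ) (m : ℕ) :
    ∃ K L : ℝ, 0 ≤ K ∧ 0 ≤ L ∧ (∀ q, ‖q‖ ≤ 1 → ‖driftField σ τ m Pc ν q‖ ≤ K) ∧
      ∀ q q', ‖q‖ ≤ 1 → ‖q'‖ ≤ 1 →
        ‖driftField σ τ m Pc ν q - driftField σ τ m Pc ν q'‖ ≤ L * ‖q - q'‖ := by
  refine exists_bound_lipschitz_of_coords fun j => ?_
  have hg := lipBdd_gVec (ν := ν) hPc hσ hσ_growth τ
  have hΛ := lipBdd_LambdaCoef (ν := ν) hPc hσ hσ_growth τ m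
  refine ((((LipBdd.sum Finset.univ fun i _ => (LipBdd.apply i).mul (hg i)).sub
    (hΛ.const_mul (1 / 2))).mul (LipBdd.apply j)).sub (hg j)).congr fun q _ => ?_
  simp only [driftField, PiLp.sub_apply, PiLp.smul_apply, smul_eq_mul, PiLp.inner_apply]
  simp only [RCLike.inner_apply, conj_trivial, mul_comm (gVec σ τ Pc ν q _)]
  ring

/-- On the sphere the two terms with `g` cancel in the radial direction and leave `-Λ/2`. -/
lemma inner_driftField_le {τ : ℝ} {m : ℕ} {q : EuclideanSpace ℝ (Fin d)} (hq : ‖q‖ = 1) :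
    ⟪q, driftField σ τ m Pc ν q⟫ ≤ 0 := by
  have := LambdaCoef_nonneg (ν := ν) hPc hσ hσ_growth τ m q
  rw [driftField, inner_sub_right, inner_smul_right, real_inner_self_eq_norm_sq, hq]
  linarith

end Field

end

/-! ### Global solutions of inward-pointing equations on the unit ball -/

section

section ODE

variable {E : Type*} [NormedAddCommGroup E] [InnerProductSpace ℝ E]

/-- Radial retraction onto the closed unit ball. -/
def ballRetract (x : E) : E := (max 1 ‖x‖)⁻¹ • x

lemma norm_ballRetract_le (x : E) : ‖ballRetract x‖ ≤ 1 := by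
  have h : 0 < max 1 ‖x‖ := lt_max_of_lt_left one_pos
  rw [ballRetract, norm_smul, norm_inv, Real.norm_of_nonneg h.le, inv_mul_le_iff₀ h, mul_one]
  exact le_max_right _ _

lemma ballRetract_of_norm_le {x : E} (hx : ‖x‖ ≤ 1) : ballRetract x = x := by
  simp [ballRetract, max_eq_left hx]

/-- The constant comes from changing the point and the scale in turn. The sharp constant is `1`, but
any constant suffices here. -/
lemma norm_ballRetract_sub_le (x y : E) : ‖ballRetract x - ballRetract y‖ ≤ 2 * ‖x - y‖ := by
  have ha : 1 ≤ max 1 ‖x‖ := le_max_left _ _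
  have hb : 1 ≤ max 1 ‖y‖ := le_max_left _ _
  have hy : ‖y‖ ≤ max 1 ‖y‖ := le_max_right _ _
  have hab : |max 1 ‖y‖ - max 1 ‖x‖| ≤ ‖x - y‖ := by
    rw [max_comm 1, max_comm 1]
    refine (abs_max_sub_max_le_abs _ _ _).trans ?_
    rw [norm_sub_rev]
    exact abs_norm_sub_norm_le _ _
  unfold ballRetract
  set a := max 1 ‖x‖
  set b := max 1 ‖y‖
  have ha0 : 0 < a := by linarith
  have hb0 : 0 < b := by linarith
  have h : a⁻¹ • x - b⁻¹ • y = a⁻¹ • (x - y) + ((b - a) * (a⁻¹ * b⁻¹)) • y := by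
    have : (b - a) * (a⁻¹ * b⁻¹) = a⁻¹ - b⁻¹ := by field_simp
    rw [this]
    module
  rw [h]
  refine (norm_add_le _ _).trans ?_
  rw [norm_smul, norm_smul, two_mul]
  have h1 : ‖a⁻¹‖ ≤ 1 := by
    rw [norm_inv, Real.norm_of_nonneg ha0.le]
    exact inv_le_one_of_one_le₀ ha
  refine add_le_add (mul_le_of_le_one_left (norm_nonneg _) h1) ?_
  rw [norm_mul, norm_mul, mul_assoc]
  have h2 : ‖a⁻¹‖ * ‖b⁻¹‖ * ‖y‖ ≤ 1 := by
    rw [mul_assoc]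
    refine mul_le_one₀ h1 (by positivity) ?_
    rw [norm_inv, Real.norm_of_nonneg hb0.le, inv_mul_le_iff₀ hb0, mul_one]
    exact hy
  exact (mul_le_of_le_one_right (norm_nonneg _) h2).trans hab

variable {R : E → E}

/-- `q` solves `dq/dt = R(q)` on `[0, ∞)`, staying in the closed unit ball. -/
def IsBallSolution (R : E → E) (q₀ : E) (q : ℝ → E) : Prop :=
  q 0 = q₀ ∧ ∀ t, 0 ≤ t → ‖q t‖ ≤ 1 ∧ HasDerivWithinAt q (R (q t)) (Set.Ici 0) t

lemma IsBallSolution.eq {L : ℝ} (hL : 0 ≤ L)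
    (hR : ∀ q q', ‖q‖ ≤ 1 → ‖q'‖ ≤ 1 → ‖R q - R q'‖ ≤ L * ‖q - q'‖)
    {q₀ : E} {q q' : ℝ → E} (hq : IsBallSolution R q₀ q) (hq' : IsBallSolution R q₀ q')
    {t : ℝ} (ht : 0 ≤ t) : q' t = q t := by
  refine ODE_solution_unique_of_mem_Icc_right (v := fun _ => R) (s := fun _ => Metric.closedBall 0 1)
    (K := L.toNNReal) (a := 0) (b := t) (fun _ _ => ?_)
    (fun s hs => (hq'.2 s hs.1).2.continuousWithinAt.mono Set.Icc_subset_Ici_self)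
    (fun s hs => (hq'.2 s hs.1).2.mono (Set.Ici_subset_Ici.2 hs.1))
    (fun s hs => by simpa using (hq'.2 s hs.1).1)
    (fun s hs => (hq.2 s hs.1).2.continuousWithinAt.mono Set.Icc_subset_Ici_self)
    (fun s hs => (hq.2 s hs.1).2.mono (Set.Ici_subset_Ici.2 hs.1))
    (fun s hs => by simpa using (hq.2 s hs.1).1) (by rw [hq.1, hq'.1]) ⟨ht, le_rfl⟩
  refine LipschitzOnWith.of_dist_le_mul fun x hx y hy => ?_
  rw [dist_eq_norm, dist_eq_norm, Real.coe_toNNReal _ hL]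
  exact hR x y (by simpa using hx) (by simpa using hy)

/-- With speed at most `K` a solution stays within distance `K * n` of `q₀` on `[0, n]`, so
Picard–Lindelöf applies on the whole interval at once. By uniqueness these solutions agree, and they
are glued by using at time `t` the one on `[0, ⌈t⌉₊]`. -/
lemma exists_global_solution [CompleteSpace E] {v : E → E} {K L : ℝ} (hK : 0 ≤ K) (hL : 0 ≤ L)
    (hvK : ∀ x, ‖v x‖ ≤ K) (hvL : ∀ x y, ‖v x - v y‖ ≤ L * ‖x - y‖) (q₀ : E) :
    ∃ q : ℝ → E, q 0 = q₀ ∧ ∀ t, 0 ≤ t → HasDerivWithinAt q (v (q t)) (Set.Ici 0) t := by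
  have hlip : LipschitzWith L.toNNReal v := LipschitzWith.of_dist_le_mul fun x y => by
    rw [dist_eq_norm, dist_eq_norm, Real.coe_toNNReal _ hL]
    exact hvL x y
  have hloc (n : ℕ) : ∃ α : ℝ → E, α 0 = q₀ ∧
      ∀ t ∈ Set.Icc (0 : ℝ) n, HasDerivWithinAt α (v (α t)) (Set.Icc 0 n) t := by
    have h : IsPicardLindelof (fun _ => v) (tmin := 0) (tmax := n)
        ⟨0, Set.left_mem_Icc.2 n.cast_nonneg⟩ q₀ (K.toNNReal * n) 0 K.toNNReal L.toNNReal :=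
      { lipschitzOnWith := fun _ _ => hlip.lipschitzOnWith
        continuousOn := fun _ _ => continuousOn_const
        norm_le := fun _ _ x _ => by rw [Real.coe_toNNReal _ hK]; exact hvK x
        mul_max_le := by simp }
    exact h.exists_eq_forall_mem_Icc_hasDerivWithinAt₀
  choose α hα0 hα using hloc
  have huniq {n m : ℕ} {t : ℝ} (ht0 : 0 ≤ t) (htn : t ≤ n) (htm : t ≤ m) : α n t = α m t := by
    have hmem {n : ℕ} (htn : t ≤ n) {s : ℝ} (hs : s ∈ Set.Icc 0 t) : s ∈ Set.Icc (0 : ℝ) n :=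
      ⟨hs.1, hs.2.trans htn⟩
    have hright {n : ℕ} (htn : t ≤ n) (s : ℝ) (hs : s ∈ Set.Ico 0 t) :
        HasDerivWithinAt (α n) (v (α n s)) (Set.Ici s) s := by
      refine (hα n s (hmem htn ⟨hs.1, hs.2.le⟩)).mono_of_mem_nhdsWithin ?_
      exact mem_of_superset (Icc_mem_nhdsGE (hs.2.trans_le htn)) (Set.Icc_subset_Icc_left hs.1)
    exact ODE_solution_unique_of_mem_Icc_right (v := fun _ => v) (s := fun _ => Set.univ)
      (K := L.toNNReal) (a := 0) (b := t) (fun _ _ => hlip.lipschitzOnWith)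
      (fun s hs => (hα n s (hmem htn hs)).continuousWithinAt.mono fun r hr => hmem htn hr)
      (hright htn) (fun _ _ => trivial)
      (fun s hs => (hα m s (hmem htm hs)).continuousWithinAt.mono fun r hr => hmem htm hr)
      (hright htm) (fun _ _ => trivial) (by rw [hα0, hα0]) ⟨ht0, le_rfl⟩
  refine ⟨fun t => α (⌈t⌉₊) t, by simp [hα0], fun t ht => ?_⟩
  have hM : t < ((⌈t⌉₊ + 1 : ℕ) : ℝ) := (Nat.le_ceil t).trans_lt (by push_cast; linarith)
  -- One unit beyond `⌈t⌉₊`: if `t` is an integer, `[0, ⌈t⌉₊]` is not a neighbourhood of `t` in `[0,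
  -- ∞)`.
  have h1 := (hα (⌈t⌉₊ + 1) t ⟨ht, hM.le⟩)
  have hnhds : Set.Icc (0 : ℝ) ((⌈t⌉₊ + 1 : ℕ) : ℝ) ∈ 𝓝[Set.Ici 0] t := by
    rw [← Set.Ici_inter_Iic]
    exact inter_mem_nhdsWithin _ (Iic_mem_nhds hM)
  have h2 := h1.mono_of_mem_nhdsWithin hnhds
  have heq : α (⌈t⌉₊) t = α (⌈t⌉₊ + 1) t := huniq ht (Nat.le_ceil t) hM.le
  simp only [heq]
  refine h2.congr_of_eventuallyEq ?_ heq
  filter_upwards [hnhds] with s hs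
  exact huniq hs.1 (Nat.le_ceil s) hs.2

/-- Composition with the radial retraction extends `R` to a bounded Lipschitz field on the whole
space. Its solution never leaves the ball, because outside the ball the radial velocity has the sign
that `R` has on the sphere; so it solves the original equation. -/
lemma exists_isBallSolution [CompleteSpace E] {K L : ℝ} (hK : 0 ≤ K) (hL : 0 ≤ L)
    (hRK : ∀ q, ‖q‖ ≤ 1 → ‖R q‖ ≤ K)
    (hRL : ∀ q q', ‖q‖ ≤ 1 → ‖q'‖ ≤ 1 → ‖R q - R q'‖ ≤ L * ‖q - q'‖)
    (hin : ∀ q, ‖q‖ = 1 → ⟪q, R q⟫ ≤ 0) {q₀ : E} (hq₀ : ‖q₀‖ ≤ 1) :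
    ∃ q : ℝ → E, IsBallSolution R q₀ q := by
  obtain ⟨q, hq0, hq⟩ := exists_global_solution (v := fun x => R (ballRetract x)) hK
    (L := L * 2) (by positivity) (fun x => hRK _ (norm_ballRetract_le x)) (fun x y => by
      refine (hRL _ _ (norm_ballRetract_le x) (norm_ballRetract_le y)).trans ?_
      rw [mul_assoc]
      gcongr
      exact norm_ballRetract_sub_le x y) q₀
  have hder (t : ℝ) (ht : 0 ≤ t) : HasDerivWithinAt (fun t => ‖q t‖ ^ 2)
      (2 * ⟪q t, R (ballRetract (q t))⟫) (Set.Ici 0) t := (hq t ht).norm_sq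
  have hball (t : ℝ) (ht : 0 ≤ t) : ‖q t‖ ≤ 1 := by
    -- The barrier `1 + ε * (1 + t)` has the strictly positive slope `ε`. Where `‖q‖ ^ 2` touches
    -- it, `‖q‖ > 1`, so `‖q‖ ^ 2` has nonpositive derivative and cannot cross.
    have hε (ε : ℝ) (hε : 0 < ε) : ‖q t‖ ^ 2 ≤ 1 + ε * (1 + t) := by
      refine image_le_of_deriv_right_lt_deriv_boundary' (f := fun t => ‖q t‖ ^ 2)
        (f' := fun t => 2 * ⟪q t, R (ballRetract (q t))⟫) (B := fun t => 1 + ε * (1 + t))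
        (B' := fun _ => ε) (a := 0) (b := t)
        (fun s hs => (hder s hs.1).continuousWithinAt.mono Set.Icc_subset_Ici_self)
        (fun s hs => (hder s hs.1).mono (Set.Ici_subset_Ici.2 hs.1)) ?_ (by fun_prop)
        (fun s _ => ?_) (fun s hs hsB => ?_) ⟨ht, le_rfl⟩
      · simp only [hq0]
        nlinarith [norm_nonneg q₀]
      · have := (((hasDerivAt_id s).const_add 1).const_mul ε).const_add 1
        exact (this.congr_deriv (mul_one ε)).hasDerivWithinAt
      · have hs1 : 1 < ‖q s‖ := by
          have : 1 < ‖q s‖ ^ 2 := by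
            rw [hsB]
            nlinarith [hs.1, mul_pos hε (by linarith [hs.1] : (0 : ℝ) < 1 + s)]
          by_contra! h
          nlinarith [norm_nonneg (q s)]
        have hpos : 0 < ‖q s‖ := one_pos.trans hs1
        have hret : ballRetract (q s) = ‖q s‖⁻¹ • q s := by
          rw [ballRetract, max_eq_right hs1.le]
        have hn : ‖ballRetract (q s)‖ = 1 := by
          rw [hret, norm_smul, norm_inv, norm_norm, inv_mul_cancel₀ hpos.ne']
        have h1 := hin _ hn
        have h2 : q s = ‖q s‖ • ballRetract (q s) := by
          rw [hret, smul_smul, mul_inv_cancel₀ hpos.ne', one_smul]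
        have h3 : ⟪q s, R (ballRetract (q s))⟫
            = ‖q s‖ * ⟪ballRetract (q s), R (ballRetract (q s))⟫ := by
          conv_lhs => rw [h2]
          rw [inner_smul_left, ← h2]
          rfl
        rw [h3]
        nlinarith [mul_nonneg hpos.le (neg_nonneg.2 h1)]
    have hsq : ‖q t‖ ^ 2 ≤ 1 := by
      refine le_of_forall_pos_le_add fun δ hδ => ?_
      have := hε (δ / (1 + t)) (by positivity)
      rwa [div_mul_cancel₀ _ (by positivity)] at this
    nlinarith [norm_nonneg (q t)]
  refine ⟨q, hq0, fun t ht => ⟨hball t ht, ?_⟩⟩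
  have := hq t ht
  rwa [ballRetract_of_norm_le (hball t ht)] at this

/-- One Euler step along a solution. -/
lemma IsBallSolution.norm_euler_le {K L : ℝ} (hL : 0 ≤ L)
    (hRK : ∀ q, ‖q‖ ≤ 1 → ‖R q‖ ≤ K)
    (hRL : ∀ q q', ‖q‖ ≤ 1 → ‖q'‖ ≤ 1 → ‖R q - R q'‖ ≤ L * ‖q - q'‖)
    {q₀ : E} {q : ℝ → E} (hq : IsBallSolution R q₀ q) {s t : ℝ} (hs : 0 ≤ s) (hst : s ≤ t) :
    ‖q t - q s‖ ≤ K * (t - s) ∧ ‖q t - q s - (t - s) • R (q s)‖ ≤ L * K * (t - s) ^ 2 := by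
  have hder {r : ℝ} (hr : r ∈ Set.Icc s t) : HasDerivWithinAt q (R (q r)) (Set.Icc s t) r :=
    (hq.2 r (hs.trans hr.1)).2.mono fun x hx => hs.trans hx.1
  have h1 {r : ℝ} (hr : r ∈ Set.Icc s t) : ‖q r - q s‖ ≤ K * (r - s) := by
    have := (convex_Icc s t).norm_image_sub_le_of_norm_hasDerivWithin_le (f := q)
      (f' := fun r => R (q r)) (C := K) (fun x hx => hder hx)
      (fun x hx => hRK _ (hq.2 x (hs.trans hx.1)).1) (Set.left_mem_Icc.2 hst) hr
    rwa [Real.norm_of_nonneg (sub_nonneg.2 hr.1)] at this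
  have hK : 0 ≤ K := (norm_nonneg _).trans (hRK _ (hq.2 s hs).1)
  refine ⟨h1 (Set.right_mem_Icc.2 hst), ?_⟩
  have := (convex_Icc s t).norm_image_sub_le_of_norm_hasDerivWithin_le
    (f := fun r => q r - r • R (q s)) (f' := fun r => R (q r) - R (q s)) (C := L * (K * (t - s)))
    (fun x hx => (hder hx).sub (by
      simpa using (hasDerivWithinAt_id x (Set.Icc s t)).smul_const (R (q s))))
    (fun x hx => (hRL _ _ (hq.2 x (hs.trans hx.1)).1 (hq.2 s hs).1).trans (by
      gcongr
      refine (h1 hx).trans ?_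
      gcongr
      exact hx.2))
    (Set.left_mem_Icc.2 hst) (Set.right_mem_Icc.2 hst)
  rw [Real.norm_of_nonneg (sub_nonneg.2 hst)] at this
  calc _ = ‖q t - t • R (q s) - (q s - s • R (q s))‖ := by congr 1; module
    _ ≤ _ := this
    _ = _ := by ring

end ODE

end

/-! ### Expansion of a normalized step -/

section

section Expansion

variable {E F : Type*} [NormedAddCommGroup E] [InnerProductSpace ℝ E]
  [NormedAddCommGroup F] [NormedSpace ℝ F]

/-- Collects every second order quantity of a normalized step under one common bound. In the
application `S`, `T`, `B` are `⟪u, G⟫`, `‖G‖ ^ 2 / N`, `‖Q G‖`, and `x` is the squared length before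
normalization minus one. -/
lemma step_scalar_bounds {β N S T B x : ℝ} (hN : 1 ≤ N) (hT0 : 0 ≤ T)
    (hxe : x = -2 * (β / N) + (β / N) ^ 2 - 2 * (1 - β / N) * S / N + T / N) :
    x ^ 2 ≤ 12 * ((1 + |β|) ^ 4 * (1 + S ^ 2 + T ^ 2 + B ^ 2) / N ^ 2) ∧
      (β / N) ^ 2 ≤ 2 * ((1 + |β|) ^ 4 * (1 + S ^ 2 + T ^ 2 + B ^ 2) / N ^ 2) ∧
      |β / N| * (|S| / N) ≤ 2 * ((1 + |β|) ^ 4 * (1 + S ^ 2 + T ^ 2 + B ^ 2) / N ^ 2) ∧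
      (B / N) ^ 2 ≤ 2 * ((1 + |β|) ^ 4 * (1 + S ^ 2 + T ^ 2 + B ^ 2) / N ^ 2) := by
  have hN0 : 0 < N := by linarith
  set a := β / N with ha
  set c := 1 + |β| with hc
  have hc1 : 1 ≤ c := by linarith [abs_nonneg β]
  set M := 1 + S ^ 2 + T ^ 2 + B ^ 2 with hM
  have hM1 : 1 ≤ M := by linarith [sq_nonneg S, sq_nonneg T, sq_nonneg B]
  have hc2 : c ^ 2 ≤ c ^ 4 := pow_le_pow_right₀ hc1 (by norm_num)
  have hc4 : 1 ≤ c ^ 4 := one_le_pow₀ hc1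
  set k := c ^ 4 * M / N ^ 2 with hk
  have habs : |a| = |β| / N := by rw [ha, abs_div, abs_of_pos hN0]
  have hβc : |β| ≤ c := by linarith
  have hβ2 : |β| ^ 2 ≤ c ^ 4 := (pow_le_pow_left₀ (abs_nonneg _) hβc 2).trans hc2
  have ha1 : |a| ≤ |β| := by rw [habs]; exact div_le_self (abs_nonneg _) hN
  have hxabs : |x| ≤ (c ^ 2 + 2 * c * |S| + T) / N := by
    have e1 : |-2 * a| = 2 * |β| / N := by rw [abs_mul, habs]; norm_num; ring
    have e2 : |a ^ 2| ≤ |β| ^ 2 / N := by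
      rw [abs_pow, sq, sq, habs, mul_div_assoc, ← habs, mul_comm]
      exact mul_le_mul_of_nonneg_right ha1 (abs_nonneg _)
    have e3 : |2 * (1 - a) * S / N| ≤ 2 * c * |S| / N := by
      rw [abs_div, abs_of_pos hN0, abs_mul, abs_mul, abs_two]
      have : |1 - a| ≤ c := (abs_sub _ _).trans (by rw [abs_one]; linarith)
      gcongr
    have e4 : |T / N| = T / N := abs_of_nonneg (by positivity)
    rw [hxe]
    calc _ ≤ |-2 * a| + |a ^ 2| + |2 * (1 - a) * S / N| + |T / N| := by
          refine (abs_add_le _ _).trans (add_le_add ?_ le_rfl)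
          refine (abs_sub _ _).trans (add_le_add ?_ le_rfl)
          exact abs_add_le _ _
      _ ≤ 2 * |β| / N + |β| ^ 2 / N + 2 * c * |S| / N + T / N := by
          rw [e1, e4]; gcongr
      _ ≤ (1 + 2 * |β| + |β| ^ 2) / N + 2 * c * |S| / N + T / N := by
          rw [add_div, add_div]
          have : 0 ≤ 1 / N := by positivity
          linarith
      _ = _ := by rw [hc]; ring
  have hx2 : x ^ 2 ≤ 12 * k := by
    have h1 : x ^ 2 ≤ ((c ^ 2 + 2 * c * |S| + T) / N) ^ 2 := by
      rw [← sq_abs x]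
      exact pow_le_pow_left₀ (abs_nonneg _) hxabs 2
    have h2 : (c ^ 2 + 2 * c * |S| + T) ^ 2 ≤ 12 * (c ^ 4 * M) := by
      have h3 : (c ^ 2 + 2 * c * |S| + T) ^ 2 ≤ 3 * (c ^ 4 + 4 * (c ^ 2 * S ^ 2) + T ^ 2) := by
        have := sq_abs S
        have h9 : c ^ 2 * S ^ 2 = (c * |S|) ^ 2 := by rw [mul_pow, sq_abs]
        rw [h9]
        nlinarith [sq_nonneg (c ^ 2 - 2 * (c * |S|)), sq_nonneg (c ^ 2 - T),
          sq_nonneg (2 * (c * |S|) - T)]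
      have h4 : c ^ 2 * S ^ 2 ≤ c ^ 4 * S ^ 2 := by gcongr
      have h5 : T ^ 2 ≤ c ^ 4 * T ^ 2 := le_mul_of_one_le_left (sq_nonneg _) hc4
      have h6 : 0 ≤ c ^ 4 * B ^ 2 := by positivity
      have h7 : 0 ≤ c ^ 4 * T ^ 2 := by positivity
      have h8 : c ^ 4 * M = c ^ 4 + c ^ 4 * S ^ 2 + c ^ 4 * T ^ 2 + c ^ 4 * B ^ 2 := by
        rw [hM]; ring
      linarith
    calc _ ≤ _ := h1
      _ = (c ^ 2 + 2 * c * |S| + T) ^ 2 / N ^ 2 := by rw [div_pow]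
      _ ≤ 12 * (c ^ 4 * M) / N ^ 2 := by gcongr
      _ = _ := by rw [hk]; ring
  have hMS : S ^ 2 ≤ M := by nlinarith [sq_nonneg T, sq_nonneg B]
  have hMB : B ^ 2 ≤ M := by nlinarith [sq_nonneg T, sq_nonneg S]
  have hdiv {z : ℝ} (hz : z ≤ 2 * (c ^ 4 * M)) : z / N ^ 2 ≤ 2 * k := by
    calc z / N ^ 2 ≤ 2 * (c ^ 4 * M) / N ^ 2 := by gcongr
      _ = _ := by rw [hk]; ring
  have hβM : |β| ^ 2 ≤ c ^ 4 * M := hβ2.trans (le_mul_of_one_le_right (by positivity) hM1)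
  have hMM : M ≤ c ^ 4 * M := le_mul_of_one_le_left (by linarith) hc4
  have ha2 : a ^ 2 ≤ 2 * k := by
    rw [← sq_abs, habs, div_pow]
    exact hdiv (by linarith [sq_nonneg |β|])
  have haS : |a| * (|S| / N) ≤ 2 * k := by
    have : |a| * (|S| / N) = |β| * |S| / N ^ 2 := by rw [habs]; field_simp
    rw [this]
    refine hdiv ?_
    nlinarith [sq_nonneg (|β| - |S|), sq_abs S]
  have hBN : (B / N) ^ 2 ≤ 2 * k := by
    rw [div_pow]
    exact hdiv (by linarith)
  exact ⟨hx2, ha2, haS, hBN⟩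

/-- Let `r = ‖ũ‖` and `x = r ^ 2 - 1`; then `r⁻¹ = 1 - x / 2 + O(x ^ 2)`. To first order the
shrinkage lowers `ũ` by `(β / N) u` and `x / 2` by `β / N`, and these contributions cancel. If `r`
is far from `1`, then `x ^ 2` is of order one and the right-hand side dominates trivially; this
includes `ũ = 0`, where the normalization degenerates. -/
lemma norm_normalized_step_sub_le (Q : E →ₗ[ℝ] F) (hQ : ∀ x, ‖Q x‖ ≤ ‖x‖) {u : E} (hu : ‖u‖ = 1)
    (G : E) (β : ℝ) {N : ℝ} (hN : 1 ≤ N) {ũ : E}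
    (hũ : ũ = (1 - β / N) • u - (1 / N) • G) :
    ‖‖ũ‖⁻¹ • Q ũ - Q u - (1 / N) • (-Q G + (⟪u, G⟫ - ‖G‖ ^ 2 / N / 2) • Q u)‖
        ≤ 200 * (1 + |β|) ^ 4 * (1 + ⟪u, G⟫ ^ 2 + (‖G‖ ^ 2 / N) ^ 2 + ‖Q G‖ ^ 2) / N ^ 2 ∧
      (ũ = 0 →
        1 ≤ 200 * (1 + |β|) ^ 4 * (1 + ⟪u, G⟫ ^ 2 + (‖G‖ ^ 2 / N) ^ 2 + ‖Q G‖ ^ 2) / N ^ 2) := by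
  have hN0 : 0 < N := by linarith
  have hQũ : Q ũ = (1 - β / N) • Q u - (1 / N) • Q G := by rw [hũ, map_sub, map_smul, map_smul]
  have hq : ‖Q u‖ ≤ 1 := hu ▸ hQ u
  have hr2 : ‖ũ‖ ^ 2 = (1 - β / N) ^ 2 - 2 * (1 - β / N) * ⟪u, G⟫ / N + ‖G‖ ^ 2 / N / N := by
    rw [hũ, norm_sub_sq_real, norm_smul, norm_smul, hu, inner_smul_left, inner_smul_right,
      mul_pow, mul_pow, Real.norm_eq_abs, Real.norm_eq_abs, sq_abs, sq_abs]
    simp only [conj_trivial]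
    field_simp
  have hQr : ‖Q ũ‖ ≤ ‖ũ‖ := hQ ũ
  have hr0 : 0 ≤ ‖ũ‖ := norm_nonneg _
  have hT0 : 0 ≤ ‖G‖ ^ 2 / N := by positivity
  have hB0 : 0 ≤ ‖Q G‖ := norm_nonneg _
  have hũ0 : ũ = 0 → ‖ũ‖ = 0 := fun h => by rw [h, norm_zero]
  set r := ‖ũ‖
  set S := ⟪u, G⟫
  set T := ‖G‖ ^ 2 / N
  set B := ‖Q G‖ with hBdef
  set a := β / N with ha
  set x := r ^ 2 - 1 with hx
  have hxe : x = -2 * a + a ^ 2 - 2 * (1 - a) * S / N + T / N := by rw [hx, hr2]; ring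
  obtain ⟨hx2, ha2, haS, hBN⟩ := step_scalar_bounds (B := B) hN hT0 hxe
  set k := (1 + |β|) ^ 4 * (1 + S ^ 2 + T ^ 2 + B ^ 2) / N ^ 2 with hk
  have hk0 : 0 ≤ k := by positivity
  have hgoal : 200 * (1 + |β|) ^ 4 * (1 + S ^ 2 + T ^ 2 + B ^ 2) / N ^ 2 = 200 * k := by
    rw [hk]; ring
  rw [hgoal]
  set b := B / N with hb
  have hb0 : 0 ≤ b := by positivity
  set V := (1 / N) • (-Q G + (S - T / 2) • Q u) with hV
  -- The first order term is written through the exact quantity `x`; what is left over is quadratic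
  -- in `1 / N`.
  have hVe : V = -(1 / N) • Q G - (a + x / 2 - a ^ 2 / 2 - a * (S / N)) • Q u := by
    have : a + x / 2 - a ^ 2 / 2 - a * (S / N) = -(1 / N) * (S - T / 2) := by
      rw [hxe]; field_simp; ring
    rw [this, hV]
    module
  have hQGN : ‖(1 / N) • Q G‖ = b := by
    rw [norm_smul, Real.norm_of_nonneg (by positivity), hb, hBdef]
    ring
  have hQu (t : ℝ) : ‖t • Q u‖ ≤ |t| := by
    rw [norm_smul]
    exact mul_le_of_le_one_right (norm_nonneg _) hq
  have haSN : |a * (S / N)| = |a| * (|S| / N) := by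
    rw [abs_mul, abs_div S, abs_of_pos hN0]
  rw [← ha] at ha2 haS
  have p1 : |x| * |a| ≤ (x ^ 2 + a ^ 2) / 2 := by
    rw [← sq_abs x, ← sq_abs a]
    linarith [two_mul_le_add_sq |x| |a|]
  have p2 : |x| * b ≤ (x ^ 2 + b ^ 2) / 2 := by
    rw [← sq_abs x]
    linarith [two_mul_le_add_sq |x| b]
  have p3 : |a| ≤ (1 + a ^ 2) / 2 := by
    rw [← sq_abs a]
    linarith [two_mul_le_add_sq 1 |a|]
  have p4 : b ≤ (1 + b ^ 2) / 2 := by linarith [two_mul_le_add_sq 1 b]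
  refine ⟨?_, fun h => ?_⟩
  · rcases le_or_gt (1 / 2) (r ^ 2) with hcase | hcase
    · have hr : 7 / 10 ≤ r := by nlinarith only [hcase, hr0]
      have hrpos : 0 < r := by linarith
      set e := r⁻¹ - 1 + x / 2 with he
      -- Multiplying by `r` is harmless as `‖Q ũ‖ ≤ r`, and `e * r` has the double zero at `r = 1`
      -- that also occurs in `x ^ 2 = (r - 1) ^ 2 * (r + 1) ^ 2`.
      have her : |e * r| ≤ x ^ 2 := by
        have h1 : e * r = (r - 1) ^ 2 * ((r + 2) / 2) := by
          rw [he, hx]; field_simp; ring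
        rw [h1, abs_of_nonneg (by positivity), hx,
          show (r ^ 2 - 1) ^ 2 = (r - 1) ^ 2 * (r + 1) ^ 2 by ring]
        gcongr
        nlinarith only [hr]
      have hdecomp : r⁻¹ • Q ũ - Q u - V = e • Q ũ + ((x / 2) • (a • Q u + (1 / N) • Q G)
          - (a ^ 2 / 2 + a * (S / N)) • Q u) := by
        rw [hVe, show r⁻¹ = e + 1 - x / 2 by rw [he]; ring, add_sub_assoc, add_smul e, hQũ]
        module
      rw [hdecomp]
      have t1 : ‖e • Q ũ‖ ≤ x ^ 2 := by
        rw [norm_smul]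
        refine le_trans ?_ her
        rw [abs_mul, abs_of_pos hrpos]
        exact mul_le_mul_of_nonneg_left hQr (norm_nonneg _)
      have t2 : ‖(x / 2) • (a • Q u + (1 / N) • Q G)‖ ≤ |x| / 2 * (|a| + b) := by
        rw [norm_smul, Real.norm_eq_abs, abs_div, abs_two]
        gcongr
        exact (norm_add_le _ _).trans (add_le_add (hQu a) hQGN.le)
      have t3 : ‖(a ^ 2 / 2 + a * (S / N)) • Q u‖ ≤ a ^ 2 / 2 + |a| * (|S| / N) := by
        refine (hQu _).trans ((abs_add_le _ _).trans ?_)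
        rw [haSN, abs_of_nonneg (by positivity)]
      refine (norm_add_le _ _).trans ((add_le_add t1 ((norm_sub_le _ _).trans
        (add_le_add t2 t3))).trans ?_)
      rw [show |x| / 2 * (|a| + b) = (|x| * |a| + |x| * b) / 2 by ring]
      linarith
    -- Here the expansion is useless, but `x < -1/2` makes the error bound at least a constant, and
    -- each term is estimated separately.
    · have hx4 : 1 ≤ 4 * x ^ 2 := by
        have : x < -(1 / 2) := by rw [hx]; linarith
        nlinarith only [this]
      have hxh : |x| ≤ 1 := by
        rw [abs_le]
        constructor <;> linarith [sq_nonneg r]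
      have t1 : ‖r⁻¹ • Q ũ‖ ≤ 1 := by
        rw [norm_smul, norm_inv, Real.norm_of_nonneg hr0]
        exact inv_mul_le_of_le_mul₀ hr0 zero_le_one (by simpa using hQr)
      have t2 : ‖V‖ ≤ b + (|a| + |x| / 2 + a ^ 2 / 2 + |a| * (|S| / N)) := by
        rw [hVe]
        refine (norm_sub_le _ _).trans (add_le_add ?_ ((hQu _).trans ?_))
        · rw [neg_smul, norm_neg, hQGN]
        · refine (abs_sub _ _).trans ?_
          rw [haSN]
          gcongr
          refine (abs_sub _ _).trans ?_
          rw [abs_of_nonneg (a := a ^ 2 / 2) (by positivity)]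
          gcongr
          refine (abs_add_le _ _).trans ?_
          rw [abs_div x, abs_two]
      have t3 : ‖r⁻¹ • Q ũ - Q u - V‖ ≤ 1 + 1 + ‖V‖ :=
        (norm_sub_le _ _).trans (add_le_add_left ((norm_sub_le _ _).trans (add_le_add t1 hq)) _)
      linarith
  · have hr0' : r = 0 := hũ0 h
    have : x = -1 := by rw [hx, hr0']; norm_num
    rw [this] at hx2
    linarith

end Expansion

end

/-! ### The training step in normalized variables -/

section

variable {d n m : ℕ}

/-- The columns of a square matrix as Euclidean vectors. -/
def matCol {N : ℕ} (A : Matrix (Fin N) (Fin N) ℝ) (j : Fin N) : EuclideanSpace ℝ (Fin N) :=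
  WithLp.toLp 2 fun i => A i j

lemma inner_matCol {N : ℕ} (A : Matrix (Fin N) (Fin N) ℝ) (j : Fin N)
    (x : EuclideanSpace ℝ (Fin N)) : ⟪matCol A j, x⟫ = ∑ i, A i j * x i := by
  simp [matCol, PiLp.inner_apply, mul_comm]

lemma orthonormal_matCol {N : ℕ} {A : Matrix (Fin N) (Fin N) ℝ}
    (hA : A ∈ Matrix.orthogonalGroup (Fin N) ℝ) : Orthonormal ℝ (matCol A) := by
  rw [orthonormal_iff_ite]
  intro i j
  have h := congrFun (congrFun ((Matrix.mem_orthogonalGroup_iff' (Fin N) ℝ).1 hA) i) j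
  rw [Matrix.mul_apply, Matrix.one_apply] at h
  rw [inner_matCol, ← h]
  simp [matCol]

lemma sum_inner_matCol_sq {N : ℕ} {A : Matrix (Fin N) (Fin N) ℝ}
    (hA : A ∈ Matrix.orthogonalGroup (Fin N) ℝ) (x : EuclideanSpace ℝ (Fin N)) :
    ∑ j, ⟪matCol A j, x⟫ ^ 2 = ‖x‖ ^ 2 := by
  have hon := orthonormal_matCol hA
  have hcard : Fintype.card (Fin N) = Module.finrank ℝ (EuclideanSpace ℝ (Fin N)) := by simp
  let b := OrthonormalBasis.mk hon (by
    rw [hon.linearIndependent.span_eq_top_of_card_eq_finrank' hcard])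
  have := b.sum_sq_norm_inner_right x
  simpa [b] using this

/-- The coordinates of a vector along the feature directions. -/
def hiddenProj (A : Matrix (Fin (d + n)) (Fin (d + n)) ℝ) :
    EuclideanSpace ℝ (Fin (d + n)) →ₗ[ℝ] EuclideanSpace ℝ (Fin d) where
  toFun x := WithLp.toLp 2 fun j => ⟪matCol A (Fin.castAdd n j), x⟫
  map_add' x y := by ext j; simp [inner_add_right]
  map_smul' a x := by ext j; simp [inner_smul_right]

lemma hiddenProj_apply (A : Matrix (Fin (d + n)) (Fin (d + n)) ℝ)
    (x : EuclideanSpace ℝ (Fin (d + n))) (j : Fin d) :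
    hiddenProj A x j = ⟪matCol A (Fin.castAdd n j), x⟫ := rfl

lemma norm_sq_hiddenProj_add {A : Matrix (Fin (d + n)) (Fin (d + n)) ℝ}
    (hA : A ∈ Matrix.orthogonalGroup (Fin (d + n)) ℝ) (x : EuclideanSpace ℝ (Fin (d + n))) :
    ‖hiddenProj A x‖ ^ 2 + ∑ k, ⟪matCol A (Fin.natAdd d k), x⟫ ^ 2 = ‖x‖ ^ 2 := by
  rw [← sum_inner_matCol_sq hA x, Fin.sum_univ_add, EuclideanSpace.norm_sq_eq]
  simp [hiddenProj_apply]

lemma norm_hiddenProj_le {A : Matrix (Fin (d + n)) (Fin (d + n)) ℝ}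
    (hA : A ∈ Matrix.orthogonalGroup (Fin (d + n)) ℝ) (x : EuclideanSpace ℝ (Fin (d + n))) :
    ‖hiddenProj A x‖ ≤ ‖x‖ := by
  refine (sq_le_sq₀ (norm_nonneg _) (norm_nonneg _)).1 ?_
  rw [← norm_sq_hiddenProj_add hA x]
  exact le_add_of_nonneg_right (Finset.sum_nonneg fun _ _ => sq_nonneg _)

lemma cosSim_eq_hiddenProj (A : Matrix (Fin (d + n)) (Fin (d + n)) ℝ)
    (w : EuclideanSpace ℝ (Fin (d + n))) :
    cosSim A w = hiddenProj A ((√((d + n : ℕ) : ℝ))⁻¹ • w) := by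
  ext j
  rw [hiddenProj_apply, inner_smul_right, inner_matCol]
  simp only [cosSim, PiLp.smul_apply, smul_eq_mul, Matrix.mulVec, dotProduct, featureMatrix,
    Matrix.transpose_apply, mul_assoc, ← Finset.mul_sum]
  rw [← mul_assoc]
  congr 1
  rcases eq_or_ne ((d + n : ℕ) : ℝ) 0 with h | h
  · simp [h]
  · have hpos : 0 < ((d + n : ℕ) : ℝ) := lt_of_le_of_ne (Nat.cast_nonneg _) h.symm
    have := Real.sqrt_pos.2 hpos
    field_simp
    rw [Real.sq_sqrt hpos.le]

/-- Minus the gradient direction contributed by one sample, up to normalization. -/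
def sampleDir (σ : ℝ → ℝ) (y : Fin 2 → ℝ) (A : Matrix (Fin (d + n)) (Fin (d + n)) ℝ)
    (u : EuclideanSpace ℝ (Fin (d + n))) (s : Sample d n) : EuclideanSpace ℝ (Fin (d + n)) :=
  fFun σ y 1 0 (fun l => ⟪u, view A s l⟫) • view A s 0
    + fFun σ y 0 1 (fun l => ⟪u, view A s l⟫) • view A s 1

/-- The batch average of the gradient directions. -/
def batchDir (σ : ℝ → ℝ) (τ : ℝ) (y : Fin 2 → ℝ) (A : Matrix (Fin (d + n)) (Fin (d + n)) ℝ)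
    (u : EuclideanSpace ℝ (Fin (d + n))) (batch : Fin m → Sample d n) :
    EuclideanSpace ℝ (Fin (d + n)) :=
  (τ / (2 * m)) • ∑ b, sampleDir σ y A u (batch b)

/-- The factor `-2` in `fFun` carries the sign of the loss and is offset by the `2` in the
prefactor. So `sampleDir` points along the gradient of the loss, and a step subtracts it. -/
lemma hasGradientAt_loss {σ : ℝ → ℝ} (hσ : Differentiable ℝ σ)
    (A : Matrix (Fin (d + n)) (Fin (d + n)) ℝ) (y : Fin 2 → ℝ) (batch : Fin m → Sample d n)
    (w : EuclideanSpace ℝ (Fin (d + n))) :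
    HasGradientAt (loss σ A y batch)
      ((1 / (2 * m * √((d + n : ℕ) : ℝ))) •
        ∑ b, sampleDir σ y A ((√((d + n : ℕ) : ℝ))⁻¹ • w) (batch b)) w := by
  set ρ := √((d + n : ℕ) : ℝ)
  have hout (s : Sample d n) (l : Fin 2) : HasFDerivAt (output σ A s l)
      ((deriv σ ⟪ρ⁻¹ • w, view A s l⟫) • (ρ⁻¹ • innerSL ℝ (view A s l))) w := by
    have h1 : HasFDerivAt (fun w => ρ⁻¹ * ⟪view A s l, w⟫) (ρ⁻¹ • innerSL ℝ (view A s l)) w :=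
      (innerSL ℝ (view A s l)).hasFDerivAt.const_mul _
    have h2 : ⟪ρ⁻¹ • w, view A s l⟫ = ρ⁻¹ * ⟪view A s l, w⟫ := by
      rw [inner_smul_left, real_inner_comm]; rfl
    have h3 : output σ A s l = fun w => σ (ρ⁻¹ * ⟪view A s l, w⟫) := by
      ext w
      rw [output, real_inner_comm, div_eq_inv_mul]
    rw [h3, h2]
    exact (hσ _).hasDerivAt.comp_hasFDerivAt w h1
  have hprod (s : Sample d n) := ((hout s 0).sub_const (y 0)).mul ((hout s 1).sub_const (y 1))
  have hsum := ((HasFDerivAt.fun_sum fun b (_ : b ∈ Finset.univ) =>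
    hprod (batch b)).const_mul (1 / (m : ℝ))).neg
  rw [hasGradientAt_iff_hasFDerivAt]
  refine hsum.congr_fderiv ?_
  ext v
  have ho (s : Sample d n) (l : Fin 2) : output σ A s l w = σ ⟪ρ⁻¹ • w, view A s l⟫ := by
    rw [output, inner_smul_left, div_eq_inv_mul]; rfl
  simp only [neg_apply, smul_apply, sum_apply, add_apply, innerSL_apply_apply, smul_eq_mul,
    InnerProductSpace.toDual_apply_apply, inner_smul_left, sum_inner, conj_trivial, ho, sampleDir,
    inner_add_left, fFun]
  rw [← mul_neg, ← Finset.sum_neg_distrib, Finset.mul_sum, Finset.mul_sum]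
  refine Finset.sum_congr rfl fun b _ => ?_
  have : (1 : ℝ) / (2 * m * ρ) = 1 / m * ρ⁻¹ * (1 / 2) := by
    simp only [one_div, mul_inv]; ring
  rw [this]
  ring

/-- In the variable `w / √N` both the gradient and the regularization are of size `1 / N`; the outer
factor `√N` disappears under `rescale`. -/
lemma gradStep_eq {σ : ℝ → ℝ} (hσ : Differentiable ℝ σ) (τ α : ℝ)
    (Pc : Measure (EuclideanSpace ℝ (Fin d))) (ν : Measure (Fin 2 → ℝ))
    (A : Matrix (Fin (d + n)) (Fin (d + n)) ℝ) (batch : Fin m → Sample d n)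
    (w : EuclideanSpace ℝ (Fin (d + n))) (hN : 0 < d + n) :
    gradStep σ (fun x => α * x) τ Pc ν A batch w = √((d + n : ℕ) : ℝ) •
      ((1 - τ * α / ((d + n : ℕ) : ℝ)) • ((√((d + n : ℕ) : ℝ))⁻¹ • w)
        - (1 / ((d + n : ℕ) : ℝ)) • batchDir σ τ (popMean σ Pc ν A w) A
          ((√((d + n : ℕ) : ℝ))⁻¹ • w) batch) := by
  have hpos : 0 < ((d + n : ℕ) : ℝ) := by exact_mod_cast hN
  have hρ : 0 < √((d + n : ℕ) : ℝ) := Real.sqrt_pos.2 hpos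
  have hsq : √((d + n : ℕ) : ℝ) ^ 2 = ((d + n : ℕ) : ℝ) := Real.sq_sqrt hpos.le
  rw [gradStep, (hasGradientAt_loss hσ A _ batch w).gradient, batchDir]
  set ρ := √((d + n : ℕ) : ℝ)
  set X := ∑ b, sampleDir σ (popMean σ Pc ν A w) A (ρ⁻¹ • w) (batch b)
  have hφ : WithLp.toLp 2 (fun i => α * w i) = α • w := by ext i; simp
  rw [hφ, ← hsq, smul_sub]
  simp only [smul_smul]
  have e1 : ρ * ((1 - τ * α / ρ ^ 2) * ρ⁻¹) = 1 - τ / ρ ^ 2 * α := by field_simp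
  have e2 : ρ * (1 / ρ ^ 2 * (τ / (2 * m))) = τ * (1 / (2 * m * ρ)) := by
    rw [div_eq_mul_inv, div_eq_mul_inv, div_eq_mul_inv, mul_inv, mul_inv, mul_inv]
    field_simp
  rw [e1, e2, sub_smul, one_smul]
  abel

lemma rescale_smul {N : ℕ} {c : ℝ} (hc : 0 < c) (x : EuclideanSpace ℝ (Fin N)) :
    rescale (c • x) = rescale x := by
  rw [rescale, rescale, norm_smul, smul_smul, Real.norm_of_nonneg hc.le]
  congr 1
  field_simp

lemma inv_sqrt_smul_rescale {N : ℕ} (hN : 0 < N) (x : EuclideanSpace ℝ (Fin N)) :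
    (√(N : ℝ))⁻¹ • rescale x = ‖x‖⁻¹ • x := by
  have : 0 < √(N : ℝ) := Real.sqrt_pos.2 (by exact_mod_cast hN)
  rw [rescale, smul_smul]
  congr 1
  field_simp

lemma norm_rescale {N : ℕ} {x : EuclideanSpace ℝ (Fin N)} (hx : x ≠ 0) :
    ‖rescale x‖ = √(N : ℝ) := by
  have := norm_pos_iff.2 hx
  rw [rescale, norm_smul, norm_div, norm_norm, Real.norm_of_nonneg (Real.sqrt_nonneg _)]
  field_simp

end

/-! ### The law of the preactivations -/

section

variable {d n : ℕ}

/-- The effective variables of a sample seen along the direction `u`; the Gaussian variable is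
not normalized. -/
def sampleProj (A : Matrix (Fin (d + n)) (Fin (d + n)) ℝ) (u : EuclideanSpace ℝ (Fin (d + n)))
    (s : Sample d n) : EffVar d :=
  (s.hidden, ∑ k, ⟪matCol A (Fin.natAdd d k), u⟫ * s.background k,
    ∑ i, u i • s.noise i)

lemma dataVec_eq (A : Matrix (Fin (d + n)) (Fin (d + n)) ℝ) (s : Sample d n) :
    dataVec A s = ∑ j, s.hidden j • matCol A (Fin.castAdd n j)
      + ∑ k, s.background k • matCol A (Fin.natAdd d k) := by
  ext i
  simp [dataVec, Matrix.mulVec, dotProduct, Fin.sum_univ_add, matCol, mul_comm]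

lemma inner_dataVec (A : Matrix (Fin (d + n)) (Fin (d + n)) ℝ)
    (u : EuclideanSpace ℝ (Fin (d + n))) (s : Sample d n) :
    ⟪u, dataVec A s⟫ = ⟪s.hidden, hiddenProj A u⟫ + (sampleProj A u s).2.1 := by
  rw [dataVec_eq, inner_add_right, inner_sum, inner_sum]
  simp only [inner_smul_right, sampleProj, PiLp.inner_apply (𝕜 := ℝ) s.hidden, hiddenProj_apply,
    real_inner_comm u]
  simp [mul_comm]

lemma inner_view (A : Matrix (Fin (d + n)) (Fin (d + n)) ℝ)
    (u : EuclideanSpace ℝ (Fin (d + n))) (s : Sample d n) (l : Fin 2) :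
    ⟪u, view A s l⟫ = preact (hiddenProj A u) 1 (sampleProj A u s) l := by
  rw [view, inner_add_right, inner_dataVec, preact, one_mul]
  congr 1
  simp [PiLp.inner_apply, sampleProj, mul_comm]

variable {Pc : Measure (EuclideanSpace ℝ (Fin d))} [IsProbabilityMeasure Pc]
  {ν : Measure (Fin 2 → ℝ)} [IsGaussian ν]

instance : IsProbabilityMeasure (sampleLaw n Pc ν) := by unfold sampleLaw; infer_instance

lemma integral_dual_eq_zero (hν : ∀ l, ∫ γ, γ l ∂ν = 0) (L : StrongDual ℝ (Fin 2 → ℝ)) :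
    ν[L] = 0 := by
  rw [IsGaussian.integral_dual]
  have : ∫ x, x ∂ν = 0 := by
    ext l
    have := (ContinuousLinearMap.proj (R := ℝ) (φ := fun _ : Fin 2 => ℝ) l).integral_comp_comm
      (IsGaussian.integrable_id (μ := ν))
    exact this.symm.trans (hν l)
  rw [this, map_zero]

lemma integral_dual_gaussianReal (L : StrongDual ℝ ℝ) : (gaussianReal 0 1)[L] = 0 := by
  simp [integral_continuousLinearMap_gaussianReal]

lemma measurable_sampleProj (A : Matrix (Fin (d + n)) (Fin (d + n)) ℝ)
    (u : EuclideanSpace ℝ (Fin (d + n))) : Measurable (sampleProj A u) := by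
  unfold sampleProj Sample.hidden Sample.background Sample.noise
  fun_prop

/-- For a unit vector `u` the effective variables have exactly the effective law. -/
lemma map_sampleProj (hν : ∀ l, ∫ γ, γ l ∂ν = 0) {A : Matrix (Fin (d + n)) (Fin (d + n)) ℝ}
    (hA : A ∈ Matrix.orthogonalGroup (Fin (d + n)) ℝ) {u : EuclideanSpace ℝ (Fin (d + n))}
    (hu : ‖u‖ = 1) :
    (sampleLaw n Pc ν).map (sampleProj A u) = (effLaw Pc ν).map fun v =>
      (v.1, √(1 - ⟪hiddenProj A u, hiddenProj A u⟫) * v.2.1, v.2.2) := by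
  have h1 := map_pi_sum_smul (μ := gaussianReal 0 1) integral_dual_gaussianReal
    fun k => ⟪matCol A (Fin.natAdd d k), u⟫
  have h2 := map_pi_sum_smul (μ := ν) (integral_dual_eq_zero hν) fun i => u i
  -- The background directions carry what the feature columns leave of `‖u‖ ^ 2 = 1`.
  have e1 : ∑ k, ⟪matCol A (Fin.natAdd d k), u⟫ ^ 2
      = 1 - ⟪hiddenProj A u, hiddenProj A u⟫ := by
    have := norm_sq_hiddenProj_add hA u
    rw [real_inner_self_eq_norm_sq, ← one_pow (M := ℝ) 2, ← hu]
    linarith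
  -- Thus the combination of the additive noises with weights `u i` has the law `ν` of a single
  -- coordinate.
  have e2 : ∑ i, u i ^ 2 = 1 := by
    rw [← one_pow (M := ℝ) 2, ← hu, EuclideanSpace.norm_sq_eq]
    simp
  rw [e1] at h1
  rw [e2, Real.sqrt_one] at h2
  simp only [one_smul, Measure.map_id', smul_eq_mul] at h1 h2
  have hm1 : Measurable fun a : Fin n → ℝ => ∑ k, ⟪matCol A (Fin.natAdd d k), u⟫ * a k := by
    fun_prop
  have hm2 : Measurable fun γ : Fin (d + n) → Fin 2 → ℝ => ∑ i, u i • γ i := by fun_prop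
  have hm3 : Measurable fun x : ℝ => √(1 - ⟪hiddenProj A u, hiddenProj A u⟫) * x := by fun_prop
  have p1 : sampleProj A u = Prod.map id (Prod.map
      (fun a : Fin n → ℝ => ∑ k, ⟪matCol A (Fin.natAdd d k), u⟫ * a k)
      (fun γ : Fin (d + n) → Fin 2 → ℝ => ∑ i, u i • γ i)) := rfl
  have p2 : (fun v : EffVar d =>
      (v.1, √(1 - ⟪hiddenProj A u, hiddenProj A u⟫) * v.2.1, v.2.2)) = Prod.map id (Prod.map
      (fun x : ℝ => √(1 - ⟪hiddenProj A u, hiddenProj A u⟫) * x) id) := rfl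
  rw [p1, p2, sampleLaw, effLaw, ← Measure.map_prod_map _ _ measurable_id (hm1.prodMap hm2),
    ← Measure.map_prod_map _ _ hm1 hm2, ← Measure.map_prod_map _ _ measurable_id
      (hm3.prodMap measurable_id), ← Measure.map_prod_map _ _ hm3 measurable_id, h1, h2]
  simp

lemma preact_one_eq (q : EuclideanSpace ℝ (Fin d)) (s : ℝ) (v : EffVar d) :
    preact q 1 (v.1, s * v.2.1, v.2.2) = preact q s v := by
  ext l
  simp [preact]

section

variable (hν : ∀ l, ∫ γ, γ l ∂ν = 0) {A : Matrix (Fin (d + n)) (Fin (d + n)) ℝ}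
  (hA : A ∈ Matrix.orthogonalGroup (Fin (d + n)) ℝ) {u : EuclideanSpace ℝ (Fin (d + n))}
  (hu : ‖u‖ = 1)

include hν hA hu

lemma integral_sampleProj {Ψ : EffVar d → ℝ} (hΨ : Continuous Ψ) :
    ∫ s, Ψ (sampleProj A u s) ∂(sampleLaw n Pc ν)
      = ∫ v, Ψ (v.1, √(1 - ⟪hiddenProj A u, hiddenProj A u⟫) * v.2.1, v.2.2) ∂(effLaw Pc ν) := by
  rw [← integral_map (measurable_sampleProj A u).aemeasurable hΨ.aestronglyMeasurable,
    map_sampleProj hν hA hu, integral_map (by fun_prop) hΨ.aestronglyMeasurable]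

lemma allMoments_sampleProj {Ψ : EffVar d → ℝ} (hΨ : Continuous Ψ)
    (h : AllMoments (fun v => Ψ (v.1, √(1 - ⟪hiddenProj A u, hiddenProj A u⟫) * v.2.1, v.2.2))
      (effLaw Pc ν)) :
    AllMoments (fun s => Ψ (sampleProj A u s)) (sampleLaw n Pc ν) := by
  refine AllMoments.comp_of_map ?_ (measurable_sampleProj A u).aemeasurable
  rw [map_sampleProj hν hA hu]
  have hm : AEMeasurable (fun v : EffVar d =>
      (v.1, √(1 - ⟪hiddenProj A u, hiddenProj A u⟫) * v.2.1, v.2.2)) (effLaw Pc ν) := by fun_prop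
  refine ⟨hΨ.aestronglyMeasurable, fun k => ?_⟩
  rw [integrable_map_measure (by fun_prop) hm]
  exact h.2 k

/-- Expectations of functions of the hidden variable and the preactivations. -/
lemma integral_hidden_preact {Φ : EuclideanSpace ℝ (Fin d) → ℝ} (hΦ : Continuous Φ)
    {F : (Fin 2 → ℝ) → ℝ} (hF : Continuous F) :
    ∫ s, Φ s.hidden * F (fun l => ⟪u, view A s l⟫) ∂(sampleLaw n Pc ν)
      = bracket Pc ν Φ F (hiddenProj A u) (√(1 - ⟪hiddenProj A u, hiddenProj A u⟫)) := by
  have h := integral_sampleProj (Pc := Pc) hν hA hu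
    (Ψ := fun v => Φ v.1 * F (preact (hiddenProj A u) 1 v))
    ((hΦ.comp continuous_fst).mul (hF.comp (continuous_preact _ _)))
  simp only [preact_one_eq] at h
  rw [bracket, ← h]
  congr 1
  ext s
  congr 2
  ext l
  exact inner_view A u s l

variable (hPc : ∀ p : ℕ, Integrable (fun c => ‖c‖ ^ p) Pc)
include hPc

lemma allMoments_inner_view_of_unit (l : Fin 2) :
    AllMoments (fun s => ⟪u, view A s l⟫) (sampleLaw n Pc ν) := by
  simp only [inner_view]
  refine allMoments_sampleProj hν hA hu (Ψ := fun v => preact (hiddenProj A u) 1 v l)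
    ((continuous_apply l).comp (continuous_preact _ _)) ?_
  simp only [preact_one_eq]
  exact allMoments_preact ν hPc _ _ l

omit hu in
lemma allMoments_inner_view (u : EuclideanSpace ℝ (Fin (d + n))) (l : Fin 2) :
    AllMoments (fun s => ⟪u, view A s l⟫) (sampleLaw n Pc ν) := by
  rcases eq_or_ne u 0 with rfl | hu
  · simpa using AllMoments.const 0
  · have h := (allMoments_inner_view_of_unit (Pc := Pc) (u := ‖u‖⁻¹ • u) hν hA
      (by rw [norm_smul, norm_inv, norm_norm, inv_mul_cancel₀ (norm_ne_zero_iff.2 hu)])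
      hPc l).const_mul ‖u‖
    convert h using 2 with s
    rw [inner_smul_left, ← mul_assoc]
    simp [norm_ne_zero_iff.2 hu]

omit hν hA hu [IsProbabilityMeasure Pc] in
lemma allMoments_hidden (j : Fin d) :
    AllMoments (fun s => s.hidden j) (sampleLaw n Pc ν) := by
  have h1 : AllMoments (fun c : EuclideanSpace ℝ (Fin d) => c j) Pc :=
    (allMoments_norm hPc).of_le (by fun_prop) fun c => by
      simpa using PiLp.norm_apply_le c j
  exact h1.comp_measurePreserving measurePreserving_fst

omit hν hA hu hPc in
lemma allMoments_background (k : Fin n) :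
    AllMoments (fun s => s.background k) (sampleLaw n Pc ν) :=
  allMoments_id_gaussianReal.comp_measurePreserving
    ((measurePreserving_eval (fun _ : Fin n => gaussianReal 0 1) k).comp
      (measurePreserving_fst.comp (measurePreserving_snd (μ := Pc))))

omit hν hA hu hPc in
lemma allMoments_apply_noise (l : Fin 2) : AllMoments (fun γ : Fin 2 → ℝ => γ l) ν :=
  (allMoments_norm_gaussian ν).of_le (measurable_pi_apply l).aestronglyMeasurable fun γ => by
    simpa using norm_le_pi_norm γ l

omit hν hA hu hPc in
lemma allMoments_noise_apply (i : Fin (d + n)) (l : Fin 2) :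
    AllMoments (fun s => s.noise i l) (sampleLaw n Pc ν) :=
  (allMoments_apply_noise (ν := ν) l).comp_measurePreserving
    ((measurePreserving_eval (fun _ : Fin (d + n) => ν) i).comp
      (measurePreserving_snd.comp (measurePreserving_snd (μ := Pc))))

end

/-- The population mean is the mean under the effective law. -/
lemma popMean_eq_ybar (hν : ∀ l, ∫ γ, γ l ∂ν = 0) {σ : ℝ → ℝ} (hσ : Continuous σ)
    {A : Matrix (Fin (d + n)) (Fin (d + n)) ℝ}
    (hA : A ∈ Matrix.orthogonalGroup (Fin (d + n)) ℝ) {w : EuclideanSpace ℝ (Fin (d + n))}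
    (hw : ‖(√((d + n : ℕ) : ℝ))⁻¹ • w‖ = 1) :
    popMean σ Pc ν A w = ybar σ Pc ν (cosSim A w) := by
  ext l
  have h := integral_hidden_preact (Pc := Pc) (ν := ν) (Φ := fun _ => 1) hν hA hw
    continuous_const (F := fun θ => σ (θ l)) (hσ.comp (continuous_apply l))
  rw [cosSim_eq_hiddenProj, ybar, popMean]
  simp only [bracket, one_mul] at h
  rw [Theta_eq_preact, ← h]
  congr 1
  ext s
  rw [output, inner_smul_left, div_eq_inv_mul]
  rfl

end

/-! ### Concentration of the inner products of the views -/

section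

variable {d n : ℕ} {Pc : Measure (EuclideanSpace ℝ (Fin d))} [IsProbabilityMeasure Pc]
  {ν : Measure (Fin 2 → ℝ)} [IsGaussian ν]

lemma integral_sum_sq_pi {ι E : Type*} [Fintype ι] [MeasurableSpace E] {μ : Measure E}
    [IsProbabilityMeasure μ] {F : ι → E → ℝ} (hF : ∀ i, MemLp (F i) 2 μ)
    (h0 : ∀ i, ∫ x, F i x ∂μ = 0) :
    ∫ x, (∑ i, F i (x i)) ^ 2 ∂(Measure.pi fun _ : ι => μ) = ∑ i, ∫ x, F i x ^ 2 ∂μ := by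
  have hv := variance_sum_pi (μ := fun _ : ι => μ) hF
  have hm (i : ι) : MemLp (fun x : ι → E => F i (x i)) 2 (Measure.pi fun _ : ι => μ) :=
    (hF i).comp_measurePreserving (measurePreserving_eval (fun _ : ι => μ) i)
  have hmean : ∫ x, (∑ i, fun x : ι → E => F i (x i)) x ∂(Measure.pi fun _ : ι => μ) = 0 := by
    simp only [Finset.sum_apply]
    rw [integral_finsetSum _ fun i _ => (hm i).integrable (by norm_num)]
    refine Finset.sum_eq_zero fun i _ => ?_
    rw [integral_comp_eval (μ := fun _ : ι => μ) (hF i).1]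
    exact h0 i
  rw [variance_of_integral_eq_zero (memLp_finsetSum' _ fun i _ => hm i).aemeasurable hmean] at hv
  simp only [Finset.sum_apply] at hv
  rw [hv]
  exact Finset.sum_congr rfl fun i _ => variance_of_integral_eq_zero (hF i).aemeasurable (h0 i)

lemma integral_sampleLaw {f : Sample d n → ℝ} (hf : Integrable f (sampleLaw n Pc ν)) :
    ∫ s, f s ∂(sampleLaw n Pc ν) = ∫ c, ∫ a, ∫ γ, f (c, a, γ) ∂(Measure.pi fun _ => ν)
      ∂(Measure.pi fun _ => gaussianReal 0 1) ∂Pc := by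
  unfold sampleLaw at hf ⊢
  rw [integral_prod _ hf]
  refine integral_congr_ae ?_
  filter_upwards [hf.prod_right_ae] with c hc
  exact integral_prod _ hc

lemma inner_matCol_dataVec {A : Matrix (Fin (d + n)) (Fin (d + n)) ℝ}
    (hA : A ∈ Matrix.orthogonalGroup (Fin (d + n)) ℝ) (s : Sample d n) (j : Fin (d + n)) :
    ⟪matCol A j, dataVec A s⟫ = Fin.append (WithLp.ofLp s.hidden) s.background j := by
  rw [inner_matCol]
  have h : A.transpose.mulVec (A.mulVec (Fin.append (WithLp.ofLp s.hidden) s.background))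
      = Fin.append (WithLp.ofLp s.hidden) s.background := by
    rw [Matrix.mulVec_mulVec, (Matrix.mem_orthogonalGroup_iff' (Fin (d + n)) ℝ).1 hA,
      Matrix.one_mulVec]
  exact congrFun h j

lemma norm_dataVec_sq {A : Matrix (Fin (d + n)) (Fin (d + n)) ℝ}
    (hA : A ∈ Matrix.orthogonalGroup (Fin (d + n)) ℝ) (s : Sample d n) :
    ‖dataVec A s‖ ^ 2 = ‖s.hidden‖ ^ 2 + ∑ k, s.background k ^ 2 := by
  rw [← sum_inner_matCol_sq hA, Fin.sum_univ_add, EuclideanSpace.norm_sq_eq]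
  simp [inner_matCol_dataVec hA]

/-- The noise vector of one branch. -/
def noiseVec (s : Sample d n) (l : Fin 2) : EuclideanSpace ℝ (Fin (d + n)) :=
  WithLp.toLp 2 fun i => s.noise i l

lemma inner_noiseVec (z : EuclideanSpace ℝ (Fin (d + n))) (s : Sample d n) (l : Fin 2) :
    ⟪z, noiseVec s l⟫ = ∑ i, z i * s.noise i l := by
  simp [noiseVec, PiLp.inner_apply, mul_comm]

lemma allMoments_inner_noiseVec (z : EuclideanSpace ℝ (Fin (d + n))) (l : Fin 2) :
    AllMoments (fun s => ⟪z, noiseVec s l⟫) (sampleLaw n Pc ν) := by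
  simp only [inner_noiseVec]
  exact AllMoments.sum _ fun i _ => (allMoments_noise_apply i l).const_mul (z i)

lemma allMoments_dataVec_apply (hPc : ∀ p : ℕ, Integrable (fun c => ‖c‖ ^ p) Pc)
    (A : Matrix (Fin (d + n)) (Fin (d + n)) ℝ) (i : Fin (d + n)) :
    AllMoments (fun s => dataVec A s i) (sampleLaw n Pc ν) := by
  have h : (fun s => dataVec A s i) = fun s : Sample d n =>
      ∑ j, A i (Fin.castAdd n j) * s.hidden j + ∑ k, A i (Fin.natAdd d k) * s.background k := by
    ext s
    simp [dataVec, Matrix.mulVec, dotProduct, Fin.sum_univ_add]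
  rw [h]
  exact (AllMoments.sum _ fun j _ => (allMoments_hidden hPc j).const_mul _).add
    (AllMoments.sum _ fun k _ => (allMoments_background k).const_mul _)

lemma allMoments_inner_dataVec_noiseVec (hPc : ∀ p : ℕ, Integrable (fun c => ‖c‖ ^ p) Pc)
    (A : Matrix (Fin (d + n)) (Fin (d + n)) ℝ) (l : Fin 2) :
    AllMoments (fun s => ⟪dataVec A s, noiseVec s l⟫) (sampleLaw n Pc ν) := by
  simp only [inner_noiseVec]
  exact AllMoments.sum _ fun i _ =>
    (allMoments_dataVec_apply hPc A i).mul (allMoments_noise_apply i l)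

lemma integral_apply_sq_background (k : Fin n) :
    ∫ s, s.background k ^ 2 ∂(sampleLaw n Pc ν) = 1 := by
  have hmp : MeasurePreserving (fun s : Sample d n => s.background k) (sampleLaw n Pc ν)
      (gaussianReal 0 1) := (measurePreserving_eval (fun _ : Fin n => gaussianReal 0 1) k).comp
      (measurePreserving_fst.comp (measurePreserving_snd (μ := Pc)))
  have h2 : ∫ x, x ^ 2 ∂(gaussianReal 0 1) = 1 := by
    have := variance_of_integral_eq_zero (X := fun x : ℝ => x) (μ := gaussianReal 0 1)
      (by fun_prop) (by simp)
    rw [← this, variance_fun_id_gaussianReal]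
    simp
  rw [← h2, ← hmp.map_eq, integral_map hmp.measurable.aemeasurable (by fun_prop)]

/-- For fixed `c` and `a` the data vector is a constant, and the noises at distinct coordinates are
independent and centred, so only squares survive; `‖x‖ ^ 2` then has mean `E‖c‖ ^ 2 + n`. In
particular the second moment is `O(N)`. -/
lemma integral_inner_dataVec_noiseVec_sq (hPc : ∀ p : ℕ, Integrable (fun c => ‖c‖ ^ p) Pc)
    (hν : ∀ l, ∫ γ, γ l ∂ν = 0) {A : Matrix (Fin (d + n)) (Fin (d + n)) ℝ}
    (hA : A ∈ Matrix.orthogonalGroup (Fin (d + n)) ℝ) (l : Fin 2) :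
    ∫ s, ⟪dataVec A s, noiseVec s l⟫ ^ 2 ∂(sampleLaw n Pc ν)
      = (∫ γ, γ l ^ 2 ∂ν) * (∫ c, ‖c‖ ^ 2 ∂Pc + n) := by
  have hnorm : AllMoments (fun s : Sample d n => ‖s.hidden‖) (sampleLaw n Pc ν) :=
    (allMoments_norm hPc).comp_measurePreserving measurePreserving_fst
  have hS : AllMoments (fun s : Sample d n => ‖s.hidden‖ ^ 2 + ∑ k, s.background k ^ 2)
      (sampleLaw n Pc ν) :=
    (hnorm.pow 2).add (AllMoments.sum _ fun k _ => (allMoments_background k).pow 2)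
  have hκ : AllMoments (fun γ : Fin 2 → ℝ => γ l) ν := allMoments_apply_noise l
  rw [integral_sampleLaw ((allMoments_inner_dataVec_noiseVec hPc A l).integrable_pow 2)]
  have hinner (c : EuclideanSpace ℝ (Fin d)) (a : Fin n → ℝ) :
      ∫ γ, ⟪dataVec A ((c, a, γ) : Sample d n), noiseVec ((c, a, γ) : Sample d n) l⟫ ^ 2
        ∂(Measure.pi fun _ => ν) = (∫ γ, γ l ^ 2 ∂ν) * (‖c‖ ^ 2 + ∑ k, a k ^ 2) := by
    have h1 := integral_sum_sq_pi (ι := Fin (d + n)) (μ := ν)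
      (F := fun i γ => dataVec A ((c, a, 0) : Sample d n) i * γ l)
      (fun i => (hκ.const_mul _).memLp_two) (fun i => by rw [integral_const_mul, hν l, mul_zero])
    have h2 : ∑ i, dataVec A ((c, a, 0) : Sample d n) i ^ 2 = ‖c‖ ^ 2 + ∑ k, a k ^ 2 := by
      have := norm_dataVec_sq hA ((c, a, 0) : Sample d n)
      rw [EuclideanSpace.norm_sq_eq] at this
      simp only [Real.norm_eq_abs, sq_abs] at this
      exact this
    simp only [inner_noiseVec]
    refine h1.trans ?_
    simp only [mul_pow, integral_const_mul]
    rw [← Finset.sum_mul, h2, mul_comm]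
  simp only [hinner]
  have h3 : ∫ s : Sample d n, (∫ γ, γ l ^ 2 ∂ν) * (‖s.hidden‖ ^ 2 + ∑ k, s.background k ^ 2)
      ∂(sampleLaw n Pc ν) = (∫ γ, γ l ^ 2 ∂ν) * (∫ c, ‖c‖ ^ 2 ∂Pc + n) := by
    rw [integral_const_mul, integral_add (hnorm.integrable_pow 2) (AllMoments.integrable
      (AllMoments.sum _ fun k _ => (allMoments_background k).pow 2)),
      integral_finsetSum _ fun k _ => (allMoments_background k).integrable_pow 2]
    simp only [integral_apply_sq_background]
    congr 2
    · have hmp : MeasurePreserving (fun s : Sample d n => s.hidden) (sampleLaw n Pc ν) Pc :=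
        measurePreserving_fst
      conv_rhs => rw [← hmp.map_eq]
      rw [integral_map hmp.measurable.aemeasurable (by fun_prop)]
    · simp
  rw [← h3, integral_sampleLaw (hS.const_mul _).integrable]
  congr 1; ext c; congr 1; ext a
  refine Eq.trans ?_ (integral_const (μ := Measure.pi fun _ : Fin (d + n) => ν)
    ((∫ γ, γ l ^ 2 ∂ν) * (‖c‖ ^ 2 + ∑ k, a k ^ 2))).symm
  simp

lemma inner_view_view {A : Matrix (Fin (d + n)) (Fin (d + n)) ℝ}
    (hA : A ∈ Matrix.orthogonalGroup (Fin (d + n)) ℝ) (s : Sample d n) (l l' : Fin 2) :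
    ⟪view A s l, view A s l'⟫ = ‖s.hidden‖ ^ 2 + ∑ k, s.background k ^ 2
      + ⟪dataVec A s, noiseVec s l⟫ + ⟪dataVec A s, noiseVec s l'⟫
      + ∑ i, s.noise i l * s.noise i l' := by
  have h : ⟪noiseVec s l, noiseVec s l'⟫ = ∑ i, s.noise i l * s.noise i l' := inner_noiseVec _ _ _
  rw [← norm_dataVec_sq hA, ← h, ← real_inner_self_eq_norm_sq]
  change ⟪dataVec A s + noiseVec s l, dataVec A s + noiseVec s l'⟫ = _
  rw [inner_add_left, inner_add_right, inner_add_right, real_inner_comm (dataVec A s) (noiseVec s l)]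
  ring

lemma sum_five_sq_le (a b c e f : ℝ) :
    (a + b + c + e + f) ^ 2 ≤ 5 * (a ^ 2 + b ^ 2 + c ^ 2 + e ^ 2 + f ^ 2) := by
  nlinarith [sq_nonneg (a - b), sq_nonneg (a - c), sq_nonneg (a - e), sq_nonneg (a - f),
    sq_nonneg (b - c), sq_nonneg (b - e), sq_nonneg (b - f), sq_nonneg (c - e),
    sq_nonneg (c - f), sq_nonneg (e - f)]

/-- The deviation of `⟨view l, view l'⟩ / N` from its limit. -/
def viewDev (ν : Measure (Fin 2 → ℝ)) (A : Matrix (Fin (d + n)) (Fin (d + n)) ℝ) (l l' : Fin 2)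
    (s : Sample d n) : ℝ :=
  ⟪view A s l, view A s l'⟫ / ((d + n : ℕ) : ℝ) - (1 + ∫ γ, γ l * γ l' ∂ν)

lemma allMoments_viewDev (hPc : ∀ p : ℕ, Integrable (fun c => ‖c‖ ^ p) Pc)
    {A : Matrix (Fin (d + n)) (Fin (d + n)) ℝ}
    (hA : A ∈ Matrix.orthogonalGroup (Fin (d + n)) ℝ) (l l' : Fin 2) :
    AllMoments (viewDev ν A l l') (sampleLaw n Pc ν) := by
  have h : viewDev ν A l l' = fun s => (((d + n : ℕ) : ℝ))⁻¹ *
      (‖s.hidden‖ ^ 2 + ∑ k, s.background k ^ 2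
      + ⟪dataVec A s, noiseVec s l⟫ + ⟪dataVec A s, noiseVec s l'⟫
      + ∑ i, s.noise i l * s.noise i l') - (1 + ∫ γ, γ l * γ l' ∂ν) := by
    ext s
    rw [viewDev, inner_view_view hA, div_eq_inv_mul]
  rw [h]
  have hnorm : AllMoments (fun s : Sample d n => ‖s.hidden‖) (sampleLaw n Pc ν) :=
    (allMoments_norm hPc).comp_measurePreserving measurePreserving_fst
  exact (((((((hnorm.pow 2).add (AllMoments.sum _ fun k _ => (allMoments_background k).pow 2)).add
    (allMoments_inner_dataVec_noiseVec hPc A l)).add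
    (allMoments_inner_dataVec_noiseVec hPc A l')).add
    (AllMoments.sum _ fun i _ => (allMoments_noise_apply i l).mul
      (allMoments_noise_apply i l')))).const_mul _).sub (AllMoments.const _)

/-- A law of large numbers: `N` times the deviation is a sum of five terms with second moment
`O(N)`. Since `N = d + n`, centring the `n` squares of the background leaves `d` to be subtracted
from `‖c‖ ^ 2`. -/
lemma exists_integral_viewDev_sq_le (hPc : ∀ p : ℕ, Integrable (fun c => ‖c‖ ^ p) Pc)
    (hν : ∀ l, ∫ γ, γ l ∂ν = 0) (l l' : Fin 2) :
    ∃ K, 0 ≤ K ∧ ∀ (n : ℕ) (A : Matrix (Fin (d + n)) (Fin (d + n)) ℝ),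
      A ∈ Matrix.orthogonalGroup (Fin (d + n)) ℝ → 0 < d + n →
      ∫ s, viewDev ν A l l' s ^ 2 ∂(sampleLaw n Pc ν) ≤ K / ((d + n : ℕ) : ℝ) := by
  have hg : AllMoments (fun x : ℝ => x ^ 2 - 1) (gaussianReal 0 1) :=
    (allMoments_id_gaussianReal.pow 2).sub (AllMoments.const 1)
  have hγ : AllMoments (fun γ : Fin 2 → ℝ => γ l * γ l' - ∫ γ, γ l * γ l' ∂ν) ν :=
    ((allMoments_apply_noise l).mul (allMoments_apply_noise l')).sub (AllMoments.const _)
  set κ := ∫ γ, γ l * γ l' ∂ν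
  set k₁ := ∫ c, (‖c‖ ^ 2 - d) ^ 2 ∂Pc with hk₁
  set k₂ := ∫ x, (x ^ 2 - 1) ^ 2 ∂(gaussianReal 0 1) with hk₂
  set k₃ := ∫ γ, (γ l * γ l' - κ) ^ 2 ∂ν with hk₃
  set k₄ := ∫ c, ‖c‖ ^ 2 ∂Pc with hk₄
  have p₁ : 0 ≤ k₁ := integral_nonneg fun _ => sq_nonneg _
  have p₂ : 0 ≤ k₂ := integral_nonneg fun _ => sq_nonneg _
  have p₃ : 0 ≤ k₃ := integral_nonneg fun _ => sq_nonneg _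
  have p₄ : 0 ≤ k₄ := integral_nonneg fun _ => sq_nonneg _
  have pκ (l : Fin 2) : 0 ≤ ∫ γ, γ l ^ 2 ∂ν := integral_nonneg fun _ => sq_nonneg _
  set K := 5 * (k₁ + k₂ + (∫ γ, γ l ^ 2 ∂ν) * (k₄ + 1) + (∫ γ, γ l' ^ 2 ∂ν) * (k₄ + 1) + k₃)
  refine ⟨K, by have := pκ l; have := pκ l'; positivity, fun n A hA hN => ?_⟩
  have hN1 : (1 : ℝ) ≤ ((d + n : ℕ) : ℝ) := by exact_mod_cast hN
  have hN0 : (0 : ℝ) < ((d + n : ℕ) : ℝ) := by linarith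
  have hn : (n : ℝ) ≤ ((d + n : ℕ) : ℝ) := by push_cast; linarith [(Nat.cast_nonneg d : (0 : ℝ) ≤ d)]
  have hnorm : AllMoments (fun s : Sample d n => ‖s.hidden‖) (sampleLaw n Pc ν) :=
    (allMoments_norm hPc).comp_measurePreserving measurePreserving_fst
  have m₁ : AllMoments (fun s : Sample d n => ‖s.hidden‖ ^ 2 - d) (sampleLaw n Pc ν) :=
    (hnorm.pow 2).sub (AllMoments.const _)
  have m₂ : AllMoments (fun s : Sample d n => ∑ k, (s.background k ^ 2 - 1)) (sampleLaw n Pc ν) :=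
    AllMoments.sum _ fun k _ => ((allMoments_background k).pow 2).sub (AllMoments.const _)
  have m₃ : AllMoments (fun s : Sample d n => ∑ i, (s.noise i l * s.noise i l' - κ))
      (sampleLaw n Pc ν) := AllMoments.sum _ fun i _ => ((allMoments_noise_apply i l).mul
        (allMoments_noise_apply i l')).sub (AllMoments.const _)
  have m₄ (l : Fin 2) := allMoments_inner_dataVec_noiseVec (n := n) (ν := ν) hPc A l
  have i₁ : ∫ s : Sample d n, (‖s.hidden‖ ^ 2 - d) ^ 2 ∂(sampleLaw n Pc ν) = k₁ := by
    have hmp : MeasurePreserving (fun s : Sample d n => s.hidden) (sampleLaw n Pc ν) Pc :=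
      measurePreserving_fst
    rw [hk₁]
    conv_rhs => rw [← hmp.map_eq]
    rw [integral_map hmp.measurable.aemeasurable (by fun_prop)]
  have i₂ : ∫ s : Sample d n, (∑ k, (s.background k ^ 2 - 1)) ^ 2 ∂(sampleLaw n Pc ν)
      = n * k₂ := by
    have hmp : MeasurePreserving (fun s : Sample d n => s.background) (sampleLaw n Pc ν)
        (Measure.pi fun _ : Fin n => gaussianReal 0 1) :=
      measurePreserving_fst.comp (measurePreserving_snd (μ := Pc))
    have h := integral_sum_sq_pi (ι := Fin n) (F := fun _ x => x ^ 2 - 1)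
      (fun _ => hg.memLp_two) (fun _ => by
        have h2 := variance_of_integral_eq_zero (X := fun x : ℝ => x) (μ := gaussianReal 0 1)
          (by fun_prop) (by simp)
        rw [variance_fun_id_gaussianReal] at h2
        rw [integral_sub (allMoments_id_gaussianReal.integrable_pow 2) (integrable_const _), ← h2]
        simp)
    rw [← hmp.map_eq, integral_map hmp.measurable.aemeasurable
      (Measurable.aestronglyMeasurable (by fun_prop))] at h
    rw [h]
    simp [hk₂]
  have i₃ : ∫ s : Sample d n, (∑ i, (s.noise i l * s.noise i l' - κ)) ^ 2 ∂(sampleLaw n Pc ν)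
      = ((d + n : ℕ) : ℝ) * k₃ := by
    have hmp : MeasurePreserving (fun s : Sample d n => s.noise) (sampleLaw n Pc ν)
        (Measure.pi fun _ : Fin (d + n) => ν) :=
      measurePreserving_snd.comp (measurePreserving_snd (μ := Pc))
    have h := integral_sum_sq_pi (ι := Fin (d + n)) (F := fun _ (γ : Fin 2 → ℝ) => γ l * γ l' - κ)
      (fun _ => hγ.memLp_two) (fun _ => by
        rw [integral_sub ((allMoments_apply_noise l).mul (allMoments_apply_noise l')).integrable
          (integrable_const _)]
        simp [κ])
    rw [← hmp.map_eq, integral_map hmp.measurable.aemeasurable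
      (Measurable.aestronglyMeasurable (by fun_prop))] at h
    rw [h]
    simp [hk₃]
  have i₄ (l : Fin 2) := integral_inner_dataVec_noiseVec_sq (n := n) hPc hν hA l
  have hdecomp (s : Sample d n) : viewDev ν A l l' s ^ 2 ≤ 5 / ((d + n : ℕ) : ℝ) ^ 2 *
      ((‖s.hidden‖ ^ 2 - d) ^ 2 + (∑ k, (s.background k ^ 2 - 1)) ^ 2
        + ⟪dataVec A s, noiseVec s l⟫ ^ 2 + ⟪dataVec A s, noiseVec s l'⟫ ^ 2
        + (∑ i, (s.noise i l * s.noise i l' - κ)) ^ 2) := by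
    have h : viewDev ν A l l' s = ((‖s.hidden‖ ^ 2 - d) + ∑ k, (s.background k ^ 2 - 1)
        + ⟪dataVec A s, noiseVec s l⟫ + ⟪dataVec A s, noiseVec s l'⟫
        + ∑ i, (s.noise i l * s.noise i l' - κ)) / ((d + n : ℕ) : ℝ) := by
      rw [viewDev, inner_view_view hA, Finset.sum_sub_distrib, Finset.sum_sub_distrib]
      simp only [Finset.sum_const, Finset.card_univ, Fintype.card_fin, nsmul_eq_mul, mul_one]
      rw [eq_div_iff hN0.ne', sub_mul, div_mul_cancel₀ _ hN0.ne']
      push_cast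
      ring
    rw [h, div_pow, div_mul_eq_mul_div]
    exact div_le_div_of_nonneg_right (sum_five_sq_le _ _ _ _ _) (by positivity)
  calc ∫ s, viewDev ν A l l' s ^ 2 ∂(sampleLaw n Pc ν)
      ≤ ∫ s, 5 / ((d + n : ℕ) : ℝ) ^ 2 *
        ((‖s.hidden‖ ^ 2 - d) ^ 2 + (∑ k, (s.background k ^ 2 - 1)) ^ 2
          + ⟪dataVec A s, noiseVec s l⟫ ^ 2 + ⟪dataVec A s, noiseVec s l'⟫ ^ 2
          + (∑ i, (s.noise i l * s.noise i l' - κ)) ^ 2) ∂(sampleLaw n Pc ν) :=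
        integral_mono ((allMoments_viewDev hPc hA l l').integrable_pow 2)
          ((((((m₁.pow 2).add (m₂.pow 2)).add ((m₄ l).pow 2)).add ((m₄ l').pow 2)).add
            (m₃.pow 2)).const_mul _).integrable hdecomp
    _ = 5 / ((d + n : ℕ) : ℝ) ^ 2 * (k₁ + n * k₂ + (∫ γ, γ l ^ 2 ∂ν) * (k₄ + n)
          + (∫ γ, γ l' ^ 2 ∂ν) * (k₄ + n) + ((d + n : ℕ) : ℝ) * k₃) := by
        rw [integral_const_mul, integral_add, integral_add, integral_add, integral_add, i₁, i₂, i₃,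
          i₄ l, i₄ l']
        · exact m₁.integrable_pow 2
        · exact m₂.integrable_pow 2
        · exact ((m₁.pow 2).add (m₂.pow 2)).integrable
        · exact (m₄ l).integrable_pow 2
        · exact (((m₁.pow 2).add (m₂.pow 2)).add ((m₄ l).pow 2)).integrable
        · exact (m₄ l').integrable_pow 2
        · exact ((((m₁.pow 2).add (m₂.pow 2)).add ((m₄ l).pow 2)).add ((m₄ l').pow 2)).integrable
        · exact m₃.integrable_pow 2
    _ ≤ 5 / ((d + n : ℕ) : ℝ) ^ 2 * (((d + n : ℕ) : ℝ) * (k₁ + k₂ + (∫ γ, γ l ^ 2 ∂ν) * (k₄ + 1)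
          + (∫ γ, γ l' ^ 2 ∂ν) * (k₄ + 1) + k₃)) := by
        have q1 : k₁ ≤ ((d + n : ℕ) : ℝ) * k₁ := le_mul_of_one_le_left p₁ hN1
        have q2 : n * k₂ ≤ ((d + n : ℕ) : ℝ) * k₂ := mul_le_mul_of_nonneg_right hn p₂
        have q3 : k₄ + n ≤ ((d + n : ℕ) : ℝ) * (k₄ + 1) := by
          have := le_mul_of_one_le_left p₄ hN1
          linarith
        have q4 := mul_le_mul_of_nonneg_left q3 (pκ l)
        have q5 := mul_le_mul_of_nonneg_left q3 (pκ l')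
        refine mul_le_mul_of_nonneg_left ?_ (by positivity)
        linarith
    _ = K / ((d + n : ℕ) : ℝ) := by
        simp only [K]
        field_simp

end

/-! ### Moments of the contribution of one sample -/

section

variable {d n : ℕ} {Pc : Measure (EuclideanSpace ℝ (Fin d))} [IsProbabilityMeasure Pc]
  {ν : Measure (Fin 2 → ℝ)} [IsGaussian ν]

lemma LipFamily.exists_le_effSize {F : EuclideanSpace ℝ (Fin d) → (Fin 2 → ℝ) → ℝ}
    (hF : LipFamily F) :
    ∃ (C : ℝ) (p : ℕ), 0 ≤ C ∧ ∀ (q : EuclideanSpace ℝ (Fin d)) (s : ℝ) (v : EffVar d),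
      ‖q‖ ≤ 1 → |s| ≤ 2 → |F q (preact q s v)| ≤ C * effSize v ^ p := by
  induction hF with
  | base ha hG =>
    obtain ⟨⟨K, hK, haK⟩, -⟩ := ha
    obtain ⟨C, p, hC, hGC⟩ := hG.polyGrowth.exists_le_effSize (d := d)
    refine ⟨K * C, p, by positivity, fun q s v hq hs => ?_⟩
    rw [abs_mul, mul_assoc]
    exact mul_le_mul (haK q hq) (hGC q s v hq hs) (abs_nonneg _) hK
  | add _ _ ih1 ih2 =>
    obtain ⟨C, p, hC, h1⟩ := ih1
    obtain ⟨D, r, hD, h2⟩ := ih2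
    refine ⟨C + D, p + r, by positivity, fun q s v hq hs => ?_⟩
    have he := one_le_effSize v
    refine (abs_add_le _ _).trans ((add_le_add (h1 q s v hq hs) (h2 q s v hq hs)).trans ?_)
    rw [add_mul]
    gcongr <;> first | exact he | omega

lemma norm_hiddenProj_le_one {A : Matrix (Fin (d + n)) (Fin (d + n)) ℝ}
    (hA : A ∈ Matrix.orthogonalGroup (Fin (d + n)) ℝ) {u : EuclideanSpace ℝ (Fin (d + n))}
    (hu : ‖u‖ = 1) : ‖hiddenProj A u‖ ≤ 1 := hu ▸ norm_hiddenProj_le hA u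

variable (hPc : ∀ p : ℕ, Integrable (fun c => ‖c‖ ^ p) Pc) (hν : ∀ l, ∫ γ, γ l ∂ν = 0)

include hPc hν

/-- The preactivations have the effective law, which lives in a fixed dimension; hence the constant
does not depend on `n`, `A` or `u`. -/
lemma LipFamily.exists_integral_sample_le {F : EuclideanSpace ℝ (Fin d) → (Fin 2 → ℝ) → ℝ}
    (hF : LipFamily F) (k : ℕ) :
    ∃ K, 0 ≤ K ∧ ∀ (n : ℕ) (A : Matrix (Fin (d + n)) (Fin (d + n)) ℝ),
      A ∈ Matrix.orthogonalGroup (Fin (d + n)) ℝ → ∀ u : EuclideanSpace ℝ (Fin (d + n)), ‖u‖ = 1 →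
        ∫ s, |F (hiddenProj A u) fun l => ⟪u, view A s l⟫| ^ k ∂(sampleLaw n Pc ν) ≤ K := by
  obtain ⟨C, p, hC, hb⟩ := hF.exists_le_effSize
  have hi : Integrable (fun v => (C * effSize v ^ p) ^ k) (effLaw Pc ν) :=
    (((allMoments_effSize ν hPc).pow p).const_mul C).integrable_pow k
  have he (v : EffVar d) : 0 ≤ effSize v := zero_le_one.trans (one_le_effSize v)
  refine ⟨∫ v, (C * effSize v ^ p) ^ k ∂(effLaw Pc ν), integral_nonneg fun v => ?_,
    fun n A hA u hu => ?_⟩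
  · have := he v
    positivity
  · have hq := norm_hiddenProj_le_one hA hu
    have h := integral_hidden_preact (Pc := Pc) (ν := ν) (Φ := fun _ => 1) hν hA hu
      continuous_const (F := fun θ => |F (hiddenProj A u) θ| ^ k)
      ((continuous_abs.comp (hF.polyGrowth _).1).pow k)
    simp only [bracket, one_mul] at h
    rw [h]
    refine integral_mono_of_nonneg (Eventually.of_forall fun v => by positivity) hi
      (Eventually.of_forall fun v => ?_)
    obtain ⟨h0, h1, -⟩ := sqrt_one_sub_mem hq
    exact pow_le_pow_left₀ (abs_nonneg _) (hb _ _ v hq (by rw [abs_of_nonneg h0]; linarith)) k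

omit hPc hν in
lemma diagSmooth_apply (l : Fin 2) : DiagSmooth 2 fun θ => θ l := by
  have h0 : PolyGrowth fun θ => θ l :=
    ⟨continuous_apply l, 1, 1, zero_le_one, fun θ => by
      have : |θ l| ≤ ‖θ‖ := norm_le_pi_norm θ l
      linarith⟩
  exact ⟨h0, fun _ => 1, fun θ x => (hasDerivAt_id x).const_add (θ l), DiagSmooth.const 1 1⟩

lemma exists_integral_inner_view_le (l : Fin 2) (k : ℕ) :
    ∃ K, 0 ≤ K ∧ ∀ (n : ℕ) (A : Matrix (Fin (d + n)) (Fin (d + n)) ℝ),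
      A ∈ Matrix.orthogonalGroup (Fin (d + n)) ℝ → ∀ u : EuclideanSpace ℝ (Fin (d + n)), ‖u‖ = 1 →
        ∫ s, |⟪u, view A s l⟫| ^ k ∂(sampleLaw n Pc ν) ≤ K :=
  (LipFamily.of_diagSmooth (d := d) (diagSmooth_apply l)).exists_integral_sample_le hPc hν k

lemma LipFamily.allMoments_sample {F : EuclideanSpace ℝ (Fin d) → (Fin 2 → ℝ) → ℝ}
    (hF : LipFamily F) {A : Matrix (Fin (d + n)) (Fin (d + n)) ℝ}
    (hA : A ∈ Matrix.orthogonalGroup (Fin (d + n)) ℝ) (u : EuclideanSpace ℝ (Fin (d + n)))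
    (q : EuclideanSpace ℝ (Fin d)) :
    AllMoments (fun s => F q fun l => ⟪u, view A s l⟫) (sampleLaw n Pc ν) :=
  (hF.polyGrowth q).allMoments fun l => allMoments_inner_view hν hA hPc u l

variable {σ : ℝ → ℝ} (hσ : ContDiff ℝ 4 σ)
  (hσ_growth : ∃ (C : ℝ) (p : ℕ), ∀ j ≤ 4, ∀ x : ℝ, |iteratedDeriv j σ x| ≤ C * (1 + |x|) ^ p)

omit hPc hν in
lemma mul_add_mul_pow_four_le (a b c e : ℝ) :
    (a * b + c * e) ^ 4 ≤ 4 * (a ^ 8 + b ^ 8 + c ^ 8 + e ^ 8) := by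
  have h1 (x y : ℝ) : (x + y) ^ 4 ≤ 8 * (x ^ 4 + y ^ 4) := by
    have : (x + y) ^ 2 ≤ 2 * (x ^ 2 + y ^ 2) := by nlinarith [sq_nonneg (x - y)]
    calc (x + y) ^ 4 = ((x + y) ^ 2) ^ 2 := by ring
      _ ≤ (2 * (x ^ 2 + y ^ 2)) ^ 2 := pow_le_pow_left₀ (sq_nonneg _) this 2
      _ ≤ 8 * (x ^ 4 + y ^ 4) := by nlinarith [sq_nonneg (x ^ 2 - y ^ 2)]
  have h2 (x y : ℝ) : (x * y) ^ 4 ≤ (x ^ 8 + y ^ 8) / 2 := by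
    nlinarith [sq_nonneg (x ^ 4 - y ^ 4)]
  linarith [h1 (a * b) (c * e), h2 a b, h2 c e]

include hσ hσ_growth

lemma allMoments_inner_sampleDir {A : Matrix (Fin (d + n)) (Fin (d + n)) ℝ}
    (hA : A ∈ Matrix.orthogonalGroup (Fin (d + n)) ℝ) (u z : EuclideanSpace ℝ (Fin (d + n)))
    (q : EuclideanSpace ℝ (Fin d)) :
    AllMoments (fun s => ⟪z, sampleDir σ (ybar σ Pc ν q) A u s⟫) (sampleLaw n Pc ν) := by
  have hf (l l' : Fin 2) := (lipFamily_fFun (ν := ν) hPc hσ hσ_growth l l').allMoments_sample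
    hPc hν hA u q
  have hz (l : Fin 2) := allMoments_inner_view (Pc := Pc) hν hA hPc z l
  simp only [sampleDir, inner_add_right, inner_smul_right]
  exact ((hf 1 0).mul (hz 0)).add ((hf 0 1).mul (hz 1))

/-- Fourth moments are required because the error of a step contains `(‖G‖ ^ 2 / N) ^ 2`. The unit
direction `z` is arbitrary, which allows coordinate directions, feature columns, `u` itself and the
direction of the mean of `G`. -/
lemma exists_integral_inner_sampleDir_pow_le :
    ∃ K, 0 ≤ K ∧ ∀ (n : ℕ) (A : Matrix (Fin (d + n)) (Fin (d + n)) ℝ),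
      A ∈ Matrix.orthogonalGroup (Fin (d + n)) ℝ →
      ∀ u z : EuclideanSpace ℝ (Fin (d + n)), ‖u‖ = 1 → ‖z‖ = 1 →
        ∫ s, ⟪z, sampleDir σ (ybar σ Pc ν (hiddenProj A u)) A u s⟫ ^ 4 ∂(sampleLaw n Pc ν)
          ≤ K := by
  obtain ⟨K₁, hK₁, h₁⟩ := (lipFamily_fFun (ν := ν) hPc hσ hσ_growth 1
    0).exists_integral_sample_le (ν := ν) hPc hν 8
  obtain ⟨K₂, hK₂, h₂⟩ := (lipFamily_fFun (ν := ν) hPc hσ hσ_growth 0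
    1).exists_integral_sample_le (ν := ν) hPc hν 8
  obtain ⟨K₃, hK₃, h₃⟩ := exists_integral_inner_view_le hPc hν 0 8
  obtain ⟨K₄, hK₄, h₄⟩ := exists_integral_inner_view_le hPc hν 1 8
  refine ⟨4 * (K₁ + K₃ + K₂ + K₄), by positivity, fun n A hA u z hu hz => ?_⟩
  have hf (l l' : Fin 2) := (lipFamily_fFun (ν := ν) hPc hσ hσ_growth l l').allMoments_sample
    hPc hν hA u (hiddenProj A u)
  have hv (l : Fin 2) := allMoments_inner_view (Pc := Pc) hν hA hPc z l
  have e (x : ℝ) : |x| ^ 8 = x ^ 8 := Even.pow_abs (by decide) x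
  replace h₁ := h₁ n A hA u hu
  replace h₂ := h₂ n A hA u hu
  replace h₃ := h₃ n A hA z hz
  replace h₄ := h₄ n A hA z hz
  simp only [e] at h₁ h₂ h₃ h₄
  simp only [sampleDir, inner_add_right, inner_smul_right]
  refine (integral_mono ((((hf 1 0).mul (hv 0)).add ((hf 0 1).mul (hv 1))).integrable_pow 4)
    ((((((hf 1 0).pow 8).add ((hv 0).pow 8)).add ((hf 0 1).pow 8)).add
      ((hv 1).pow 8)).const_mul 4).integrable fun s => mul_add_mul_pow_four_le _ _ _ _).trans ?_
  rw [integral_const_mul, integral_add, integral_add, integral_add]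
  · linarith
  · exact (hf 1 0).integrable_pow 8
  · exact (hv 0).integrable_pow 8
  · exact (((hf 1 0).pow 8).add ((hv 0).pow 8)).integrable
  · exact (hf 0 1).integrable_pow 8
  · exact ((((hf 1 0).pow 8).add ((hv 0).pow 8)).add ((hf 0 1).pow 8)).integrable
  · exact (hv 1).integrable_pow 8

omit hσ hσ_growth in
/-- Functions of the preactivations are uncorrelated with the noise in orthogonal directions. -/
lemma integral_mul_inner_noiseVec {F : (Fin 2 → ℝ) → ℝ} (hF : PolyGrowth F)
    {A : Matrix (Fin (d + n)) (Fin (d + n)) ℝ}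
    (hA : A ∈ Matrix.orthogonalGroup (Fin (d + n)) ℝ) {u z : EuclideanSpace ℝ (Fin (d + n))}
    (huz : ⟪u, z⟫ = 0) (l : Fin 2) :
    ∫ s, F (fun l => ⟪u, view A s l⟫) * ⟪z, noiseVec s l⟫ ∂(sampleLaw n Pc ν) = 0 := by
  have hint := ((hF.allMoments fun l => allMoments_inner_view (Pc := Pc) hν hA hPc u l).mul
    (allMoments_inner_noiseVec (Pc := Pc) z l)).integrable
  rw [integral_sampleLaw hint]
  have hinner (c : EuclideanSpace ℝ (Fin d)) (a : Fin n → ℝ) :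
      ∫ γ, F (fun l => ⟪u, view A ((c, a, γ) : Sample d n) l⟫)
        * ⟪z, noiseVec ((c, a, γ) : Sample d n) l⟫ ∂(Measure.pi fun _ => ν) = 0 := by
    set t := ⟪u, dataVec A ((c, a, 0) : Sample d n)⟫
    have h1 (γ : Fin (d + n) → Fin 2 → ℝ) : (fun l => ⟪u, view A ((c, a, γ) : Sample d n) l⟫)
        = fun l => t + (∑ i, u i • γ i) l := by
      ext l
      have : ⟪u, noiseVec ((c, a, γ) : Sample d n) l⟫ = (∑ i, u i • γ i) l := by
        rw [inner_noiseVec]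
        simp [Sample.noise]
      rw [← this]
      exact inner_add_right _ _ _
    have h2 (γ : Fin (d + n) → Fin 2 → ℝ) : ⟪z, noiseVec ((c, a, γ) : Sample d n) l⟫
        = (∑ i, z i • γ i) l := by
      rw [inner_noiseVec]
      simp [Sample.noise]
    have huz' : ∑ i, u i * z i = 0 := by
      rw [← huz]
      simp [PiLp.inner_apply, mul_comm]
    -- With `c` and `a` fixed, `F` sees the noise only through `∑ i, u i • γ i`. This pair is
    -- independent of `∑ i, z i • γ i` by orthogonality, even if the two branches are correlated.
    have hind := (indepFun_pi_sum_smul (integral_dual_eq_zero hν) huz').comp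
      (φ := fun x => F fun l => t + x l) (ψ := fun x => x l)
      (hF.1.measurable.comp (by fun_prop)) (show Measurable fun x : Fin 2 → ℝ => x l from measurable_pi_apply l)
    simp only [h1, h2]
    have hmeas : Continuous fun γ : Fin (d + n) → Fin 2 → ℝ => F fun l => t + (∑ i, u i • γ i) l :=
      hF.1.comp (by fun_prop)
    have := hind.integral_mul_eq_mul_integral hmeas.aestronglyMeasurable
      (Continuous.aestronglyMeasurable (by fun_prop))
    simp only [Pi.mul_apply, Function.comp_apply] at this
    rw [this]
    have h0 : ∫ γ : Fin (d + n) → Fin 2 → ℝ, (∑ i, z i • γ i) l ∂(Measure.pi fun _ => ν) = 0 := by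
      simp only [Finset.sum_apply, Pi.smul_apply, smul_eq_mul]
      have hm (i : Fin (d + n)) : Integrable (fun γ : Fin (d + n) → Fin 2 → ℝ => z i * γ i l)
          (Measure.pi fun _ => ν) :=
        (((allMoments_apply_noise (ν := ν) l).comp_measurePreserving
          (measurePreserving_eval (fun _ : Fin (d + n) => ν) i)).const_mul _).integrable
      rw [integral_finsetSum _ fun i _ => hm i]
      refine Finset.sum_eq_zero fun i _ => ?_
      rw [integral_const_mul, integral_comp_eval (μ := fun _ : Fin (d + n) => ν)
        (f := fun γ : Fin 2 → ℝ => γ l)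
        (Measurable.aestronglyMeasurable (measurable_pi_apply l)), hν l, mul_zero]
    rw [h0, mul_zero]
  simp only [hinner, integral_zero]

/-- The projected drift of one term of the gradient. -/
lemma integral_fFun_mul_inner_view {A : Matrix (Fin (d + n)) (Fin (d + n)) ℝ}
    (hA : A ∈ Matrix.orthogonalGroup (Fin (d + n)) ℝ) {u : EuclideanSpace ℝ (Fin (d + n))}
    (hu : ‖u‖ = 1) (j : Fin d) {l l' : Fin 2} (hl : l ≠ l') (i : Fin 2)
    {q : EuclideanSpace ℝ (Fin d)} (hq : hiddenProj A u = q) :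
    ∫ s, fFun σ (ybar σ Pc ν q) l l' (fun l => ⟪u, view A s l⟫)
        * ⟪matCol A (Fin.castAdd n j) - q j • u, view A s i⟫ ∂(sampleLaw n Pc ν)
      = bracket Pc ν (fun c => c j) (fFun σ (ybar σ Pc ν q) l l') q (√(1 - ⟪q, q⟫))
        - q j * (∑ k, q k * bracket Pc ν (fun c => c k) (fFun σ (ybar σ Pc ν q) l l') q
            (√(1 - ⟪q, q⟫))
          + (1 - ‖q‖ ^ 2) * bracket Pc ν (fun _ => 1) (fFun' σ (ybar σ Pc ν q) l l') q
            (√(1 - ⟪q, q⟫))) := by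
  set f := fFun σ (ybar σ Pc ν q) l l' with hfdef
  have hF : PolyGrowth f := (lipFamily_fFun (ν := ν) hPc hσ hσ_growth l l').polyGrowth q
  have hF' : PolyGrowth (fFun' σ (ybar σ Pc ν q) l l') :=
    (lipFamily_fFun' (ν := ν) hPc hσ hσ_growth hl).polyGrowth q
  set z := matCol A (Fin.castAdd n j) - q j • u with hz
  have hq1 : ‖q‖ ≤ 1 := hq ▸ norm_hiddenProj_le_one hA hu
  -- `z` is the feature column projected to the tangent space of the sphere at `u`.
  have huz : ⟪u, z⟫ = 0 := by
    rw [hz, inner_sub_right, inner_smul_right, real_inner_self_eq_norm_sq, hu, real_inner_comm,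
      ← hiddenProj_apply, hq]
    ring
  have mf : AllMoments (fun s => f fun l => ⟪u, view A s l⟫) (sampleLaw n Pc ν) :=
    hF.allMoments fun l => allMoments_inner_view hν hA hPc u l
  have mproj : AllMoments (fun s => (sampleProj A u s).2.1) (sampleLaw n Pc ν) := by
    show AllMoments (fun s : Sample d n => ∑ k, ⟪matCol A (Fin.natAdd d k), u⟫ * s.background k) _
    exact AllMoments.sum _ fun k _ => (allMoments_background k).const_mul _
  have hdec (s : Sample d n) : f (fun l => ⟪u, view A s l⟫) * ⟪z, view A s i⟫
      = s.hidden j * f (fun l => ⟪u, view A s l⟫)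
        - q j * (∑ k, q k * (s.hidden k * f fun l => ⟪u, view A s l⟫)
          + (sampleProj A u s).2.1 * f fun l => ⟪u, view A s l⟫)
        + f (fun l => ⟪u, view A s l⟫) * ⟪z, noiseVec s i⟫ := by
    have h1 : ⟪z, view A s i⟫ = ⟪z, dataVec A s⟫ + ⟪z, noiseVec s i⟫ := inner_add_right _ _ _
    have h2 : ⟪z, dataVec A s⟫ = s.hidden j
        - q j * (∑ k, q k * s.hidden k + (sampleProj A u s).2.1) := by
      rw [hz, inner_sub_left, inner_smul_left, inner_matCol_dataVec hA, inner_dataVec, hq]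
      simp [PiLp.inner_apply]
    have h3 (t : ℝ) : ∑ k, q k * (s.hidden k * t) = (∑ k, q k * s.hidden k) * t := by
      rw [Finset.sum_mul]
      exact Finset.sum_congr rfl fun k _ => by ring
    rw [h1, h2, h3]
    ring
  have hb (k : Fin d) : ∫ s, s.hidden k * f (fun l => ⟪u, view A s l⟫) ∂(sampleLaw n Pc ν)
      = bracket Pc ν (fun c => c k) f q (√(1 - ⟪q, q⟫)) := by
    have := integral_hidden_preact (Pc := Pc) (ν := ν) (Φ := fun c => c k) hν hA hu
      (by fun_prop) hF.1
    rwa [hq] at this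
  -- The background coordinate is `s * e` with `s ^ 2 = 1 - ‖q‖ ^ 2`; integration by parts supplies
  -- the second factor `s`.
  have hg : ∫ s, (sampleProj A u s).2.1 * f (fun l => ⟪u, view A s l⟫) ∂(sampleLaw n Pc ν)
      = (1 - ‖q‖ ^ 2) * bracket Pc ν (fun _ => 1) (fFun' σ (ybar σ Pc ν q) l l') q
        (√(1 - ⟪q, q⟫)) := by
    have h1 := integral_sampleProj (Pc := Pc) hν hA hu
      (Ψ := fun v => v.2.1 * f (preact (hiddenProj A u) 1 v))
      ((continuous_fst.comp continuous_snd).mul (hF.1.comp (continuous_preact _ _)))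
    simp only [preact_one_eq, hq] at h1
    have h2 := integral_gauss_mul ν hPc isWeight_one hF hF'
      (fun θ x => hasDerivAt_fFun_diag hσ _ hl θ x) q (√(1 - ⟪q, q⟫))
    have h3 := (sqrt_one_sub_mem hq1).2.2
    have h4 (s : Sample d n) : (fun l => ⟪u, view A s l⟫) = preact q 1 (sampleProj A u s) := by
      ext l
      rw [inner_view, hq]
    simp only [h4]
    rw [h1, ← h3, sq, mul_assoc, ← h2, ← integral_const_mul]
    congr 1
    ext v
    ring
  simp only [hdec]
  have ih (k : Fin d) : AllMoments (fun s => s.hidden k * f fun l => ⟪u, view A s l⟫)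
      (sampleLaw n Pc ν) := (allMoments_hidden hPc k).mul mf
  have isum : AllMoments (fun s => ∑ k, q k * (s.hidden k * f fun l => ⟪u, view A s l⟫))
      (sampleLaw n Pc ν) := AllMoments.sum _ fun k _ => (ih k).const_mul _
  rw [integral_add, integral_sub, integral_const_mul, integral_add, integral_finsetSum, hb j, hg,
    integral_mul_inner_noiseVec hPc hν hF hA huz]
  · simp only [integral_const_mul, hb, add_zero]
  · exact fun k _ => ((ih k).const_mul _).integrable
  · exact isum.integrable
  · exact (mproj.mul mf).integrable
  · exact (ih j).integrable
  · exact ((isum.add (mproj.mul mf)).const_mul _).integrable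
  · exact ((ih j).sub ((isum.add (mproj.mul mf)).const_mul _)).integrable
  · exact (mf.mul (allMoments_inner_noiseVec z i)).integrable

/-- The mean gradient direction, projected to the tangent space of the sphere. -/
lemma integral_inner_sampleDir_eq (τ : ℝ) {A : Matrix (Fin (d + n)) (Fin (d + n)) ℝ}
    (hA : A ∈ Matrix.orthogonalGroup (Fin (d + n)) ℝ) {u : EuclideanSpace ℝ (Fin (d + n))}
    (hu : ‖u‖ = 1) {q : EuclideanSpace ℝ (Fin d)} (hq : hiddenProj A u = q) (j : Fin d) :
    τ / 2 * (-(∫ s, ⟪matCol A (Fin.castAdd n j), sampleDir σ (ybar σ Pc ν q) A u s⟫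
        ∂(sampleLaw n Pc ν))
      + q j * ∫ s, ⟪u, sampleDir σ (ybar σ Pc ν q) A u s⟫ ∂(sampleLaw n Pc ν))
    = (⟪q, gVec σ τ Pc ν q⟫ • q - gVec σ τ Pc ν q) j := by
  have h1 := integral_fFun_mul_inner_view (ν := ν) hPc hν hσ hσ_growth hA hu j (l := 1) (l' := 0)
    (by decide) 0 hq
  have h2 := integral_fFun_mul_inner_view (ν := ν) hPc hν hσ hσ_growth hA hu j (l := 0) (l' := 1)
    (by decide) 1 hq
  have hm (z : EuclideanSpace ℝ (Fin (d + n))) :=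
    (allMoments_inner_sampleDir (n := n) hPc hν hσ hσ_growth hA u z q).integrable
  have hf (l l' : Fin 2) := (lipFamily_fFun (ν := ν) hPc hσ hσ_growth l l').allMoments_sample
    (n := n) hPc hν hA u q
  have hv (z : EuclideanSpace ℝ (Fin (d + n))) (l : Fin 2) :=
    allMoments_inner_view (Pc := Pc) hν hA hPc z l
  -- Both terms combine into inner products with the tangent vector `matCol A j - q j • u`, for
  -- which the noise drops out.
  have hsplit : -(∫ s, ⟪matCol A (Fin.castAdd n j), sampleDir σ (ybar σ Pc ν q) A u s⟫
        ∂(sampleLaw n Pc ν)) + q j * ∫ s, ⟪u, sampleDir σ (ybar σ Pc ν q) A u s⟫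
        ∂(sampleLaw n Pc ν)
      = -(∫ s, fFun σ (ybar σ Pc ν q) 1 0 (fun l => ⟪u, view A s l⟫)
          * ⟪matCol A (Fin.castAdd n j) - q j • u, view A s 0⟫ ∂(sampleLaw n Pc ν)
        + ∫ s, fFun σ (ybar σ Pc ν q) 0 1 (fun l => ⟪u, view A s l⟫)
          * ⟪matCol A (Fin.castAdd n j) - q j • u, view A s 1⟫ ∂(sampleLaw n Pc ν)) := by
    rw [← integral_add ((hf 1 0).mul (hv _ 0)).integrable ((hf 0 1).mul (hv _ 1)).integrable,
      ← integral_const_mul, neg_add_eq_sub, ← neg_sub, ← integral_sub (hm _) ((hm _).const_mul _)]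
    congr 2
    ext s
    simp only [sampleDir, inner_add_right, inner_smul_right, inner_sub_left, inner_smul_left,
      conj_trivial]
    ring
  rw [hsplit, h1, h2]
  have hg (k : Fin d) := gVec_apply (ν := ν) hPc hσ hσ_growth τ q k
  have hinner : ⟪q, gVec σ τ Pc ν q⟫ = ∑ k, q k * gVec σ τ Pc ν q k := by
    simp [PiLp.inner_apply, mul_comm]
  simp only [PiLp.sub_apply, PiLp.smul_apply, smul_eq_mul, hinner, hg]
  -- In the factor `1 - ‖q‖ ^ 2` of `⟨f'⟩`, the `1` matches the term with `f'` in `-g` and the `‖q‖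
  -- ^ 2` the one in `⟪q, g⟫ q`.
  have hqn : ‖q‖ ^ 2 = ∑ k, q k * q k := by
    rw [EuclideanSpace.norm_sq_eq]
    simp [sq]
  rw [hqn]
  generalize bracket Pc ν (fun _ => 1) (fFun' σ (ybar σ Pc ν q) 0 1) q (√(1 - ⟪q, q⟫)) = D₁
  generalize bracket Pc ν (fun _ => 1) (fFun' σ (ybar σ Pc ν q) 1 0) q (√(1 - ⟪q, q⟫)) = D₂
  simp only [mul_sub, mul_add, Finset.sum_add_distrib, Finset.sum_sub_distrib]
  have e1 (E : Fin d → ℝ) : ∑ k, q k * (τ / 2 * E k) = τ / 2 * ∑ k, q k * E k := by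
    rw [Finset.mul_sum]; exact Finset.sum_congr rfl fun k _ => by ring
  have e2 (D : ℝ) : ∑ k, q k * ((τ / 2 * D) * q k) = τ / 2 * D * ∑ k, q k * q k := by
    rw [Finset.mul_sum]; exact Finset.sum_congr rfl fun k _ => by ring
  have e3 (D D' : ℝ) : ∑ k, q k * ((τ / 2 * D + τ / 2 * D') * q k)
      = (τ / 2 * D + τ / 2 * D') * ∑ k, q k * q k := by
    rw [Finset.mul_sum]; exact Finset.sum_congr rfl fun k _ => by ring
  rw [e3, e1 fun k => bracket Pc ν (fun c => c k) (fFun σ (ybar σ Pc ν q) 0 1) q (√(1 - ⟪q, q⟫)),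
    e1 fun k => bracket Pc ν (fun c => c k) (fFun σ (ybar σ Pc ν q) 1 0) q (√(1 - ⟪q, q⟫))]
  ring

end

/-! ### Averages over independent samples -/

section

section BatchMoments

variable {β : Type*} [MeasurableSpace β] {μ : Measure β} [IsProbabilityMeasure μ] {m : ℕ}

lemma AllMoments.eval {X : β → ℝ} (hX : AllMoments X μ) (b : Fin m) :
    AllMoments (fun x : Fin m → β => X (x b)) (Measure.pi fun _ : Fin m => μ) :=
  hX.comp_measurePreserving (measurePreserving_eval (fun _ : Fin m => μ) b)

lemma integral_sum_eval {X : β → ℝ} (hX : AllMoments X μ) :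
    ∫ x, ∑ b, X (x b) ∂(Measure.pi fun _ : Fin m => μ) = m * ∫ x, X x ∂μ := by
  rw [integral_finsetSum _ fun b _ => (hX.eval b).integrable]
  simp [integral_comp_eval (μ := fun _ : Fin m => μ) hX.1]

lemma sum_pow_four_le (a : Fin m → ℝ) : (∑ b, a b) ^ 4 ≤ m ^ 3 * ∑ b, a b ^ 4 := by
  have h1 : (∑ b, a b) ^ 2 ≤ m * ∑ b, a b ^ 2 := by
    simpa using sq_sum_le_card_mul_sum_sq (s := Finset.univ) (f := a)
  have h2 : (∑ b, a b ^ 2) ^ 2 ≤ m * ∑ b, (a b ^ 2) ^ 2 := by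
    simpa using sq_sum_le_card_mul_sum_sq (s := Finset.univ) (f := fun b => a b ^ 2)
  calc (∑ b, a b) ^ 4 = ((∑ b, a b) ^ 2) ^ 2 := by ring
    _ ≤ (m * ∑ b, a b ^ 2) ^ 2 := pow_le_pow_left₀ (sq_nonneg _) h1 2
    _ = (m : ℝ) ^ 2 * (∑ b, a b ^ 2) ^ 2 := by ring
    _ ≤ (m : ℝ) ^ 2 * (m * ∑ b, (a b ^ 2) ^ 2) := by gcongr
    _ = m ^ 3 * ∑ b, a b ^ 4 := by
      rw [← mul_assoc, ← pow_succ]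
      simp [← pow_mul]

lemma integral_sum_eval_pow_four_le {X : β → ℝ} (hX : AllMoments X μ) :
    ∫ x, (∑ b, X (x b)) ^ 4 ∂(Measure.pi fun _ : Fin m => μ) ≤ m ^ 4 * ∫ x, X x ^ 4 ∂μ := by
  have h := integral_sum_eval (m := m) (hX.pow 4)
  calc _ ≤ ∫ x, (m : ℝ) ^ 3 * ∑ b, X (x b) ^ 4 ∂(Measure.pi fun _ : Fin m => μ) :=
        integral_mono_of_nonneg (Eventually.of_forall fun x => by positivity)
          ((AllMoments.sum _ fun b _ => (hX.pow 4).eval b).const_mul _).integrable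
          (Eventually.of_forall fun x => sum_pow_four_le _)
    _ = m ^ 4 * ∫ x, X x ^ 4 ∂μ := by
      rw [integral_const_mul, h]
      ring

/-- There are `m` diagonal terms and `m * (m - 1)` pairs of independent factors. -/
lemma integral_sum_eval_sq {X : β → ℝ} (hX : AllMoments X μ) :
    ∫ x, (∑ b, X (x b)) ^ 2 ∂(Measure.pi fun _ : Fin m => μ)
      = m * ∫ x, X x ^ 2 ∂μ + m * (m - 1) * (∫ x, X x ∂μ) ^ 2 := by
  set e := ∫ x, X x ∂μ with he
  have hc : AllMoments (fun x => X x - e) μ := hX.sub (AllMoments.const e)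
  have h0 : ∫ x, (X x - e) ∂μ = 0 := by
    rw [integral_sub hX.integrable (integrable_const _)]
    simp [he]
  have h1 := integral_sum_sq_pi (ι := Fin m) (F := fun _ x => X x - e) (fun _ => hc.memLp_two)
    fun _ => h0
  have h2 : ∫ x, (X x - e) ^ 2 ∂μ = ∫ x, X x ^ 2 ∂μ - e ^ 2 := by
    have (x : β) : (X x - e) ^ 2 = X x ^ 2 - 2 * e * X x + e ^ 2 := by ring
    simp only [this]
    rw [integral_add ((hX.pow 2).sub (hX.const_mul _)).integrable (integrable_const _),
      integral_sub (hX.pow 2).integrable (hX.const_mul _).integrable, integral_const_mul, ← he]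
    simp
    ring
  have hs : AllMoments (fun x : Fin m → β => ∑ b, X (x b)) (Measure.pi fun _ : Fin m => μ) :=
    AllMoments.sum _ fun b _ => hX.eval b
  have h3 (x : Fin m → β) : (∑ b, (X (x b) - e)) ^ 2
      = (∑ b, X (x b)) ^ 2 - 2 * (m * e) * ∑ b, X (x b) + (m * e) ^ 2 := by
    rw [Finset.sum_sub_distrib]
    simp
    ring
  simp only [h3] at h1
  rw [integral_add ((hs.pow 2).sub (hs.const_mul _)).integrable (integrable_const _),
    integral_sub (hs.pow 2).integrable (hs.const_mul _).integrable, integral_const_mul,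
    integral_sum_eval hX, ← he, h2] at h1
  simp at h1
  linear_combination h1

end BatchMoments

lemma norm_sq_eq_sum_inner_single {N : ℕ} (x : EuclideanSpace ℝ (Fin N)) :
    ‖x‖ ^ 2 = ∑ i, ⟪EuclideanSpace.single i (1 : ℝ), x⟫ ^ 2 := by
  rw [EuclideanSpace.norm_sq_eq]
  simp [EuclideanSpace.inner_single_left]

variable {d n m : ℕ} {Pc : Measure (EuclideanSpace ℝ (Fin d))} [IsProbabilityMeasure Pc]
  {ν : Measure (Fin 2 → ℝ)} [IsGaussian ν]
  (hPc : ∀ p : ℕ, Integrable (fun c => ‖c‖ ^ p) Pc) (hν : ∀ l, ∫ γ, γ l ∂ν = 0)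

include hPc hν

/-- The inequality between the arithmetic and geometric means, weighted by `N ^ (∓1/2)`, balances a
second moment `O(1)` of the first factor against `O(1 / N)` of the deviation. -/
lemma LipFamily.exists_integral_mul_viewDev_le {F : EuclideanSpace ℝ (Fin d) → (Fin 2 → ℝ) → ℝ}
    (hF : LipFamily F) (l l' : Fin 2) :
    ∃ K, 0 ≤ K ∧ ∀ (n : ℕ) (A : Matrix (Fin (d + n)) (Fin (d + n)) ℝ), 0 < d + n →
      A ∈ Matrix.orthogonalGroup (Fin (d + n)) ℝ → ∀ u : EuclideanSpace ℝ (Fin (d + n)), ‖u‖ = 1 →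
        |∫ s, F (hiddenProj A u) (fun l => ⟪u, view A s l⟫) * viewDev ν A l l' s
          ∂(sampleLaw n Pc ν)| ≤ K / √((d + n : ℕ) : ℝ) := by
  obtain ⟨K₁, hK₁, h₁⟩ := hF.exists_integral_sample_le (ν := ν) hPc hν 2
  obtain ⟨K₂, hK₂, h₂⟩ := exists_integral_viewDev_sq_le (Pc := Pc) hPc hν l l'
  refine ⟨(K₁ + K₂) / 2, by positivity, fun n A hn hA u hu => ?_⟩
  have hX := hF.allMoments_sample hPc hν hA u (hiddenProj A u)
  have hZ := allMoments_viewDev (ν := ν) hPc hA l l'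
  set N : ℝ := ((d + n : ℕ) : ℝ) with hNdef
  have hN : 0 < N := Nat.cast_pos.2 hn
  set X := fun s => F (hiddenProj A u) fun l => ⟪u, view A s l⟫ with hXdef
  set Z := viewDev ν A l l' with hZdef
  have hr : 0 < √N := Real.sqrt_pos.2 hN
  have hrr : √N * √N = N := Real.mul_self_sqrt hN.le
  have h₁' : ∫ s, X s ^ 2 ∂(sampleLaw n Pc ν) ≤ K₁ := by simpa [sq_abs] using h₁ n A hA u hu
  have h₂' := h₂ n A hA hn
  have hpt (s : Sample d n) : |X s * Z s| ≤ (√N)⁻¹ / 2 * X s ^ 2 + √N / 2 * Z s ^ 2 := by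
    have e : (√N)⁻¹ / 2 * X s ^ 2 + √N / 2 * Z s ^ 2 - X s * Z s
        = √N / 2 * ((√N)⁻¹ * X s - Z s) ^ 2 := by field_simp; ring
    have e' : (√N)⁻¹ / 2 * X s ^ 2 + √N / 2 * Z s ^ 2 + X s * Z s
        = √N / 2 * ((√N)⁻¹ * X s + Z s) ^ 2 := by field_simp; ring
    have p1 : 0 ≤ √N / 2 * ((√N)⁻¹ * X s - Z s) ^ 2 := by positivity
    have p2 : 0 ≤ √N / 2 * ((√N)⁻¹ * X s + Z s) ^ 2 := by positivity
    rw [abs_le]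
    constructor <;> linarith
  calc |∫ s, X s * Z s ∂(sampleLaw n Pc ν)| ≤ ∫ s, |X s * Z s| ∂(sampleLaw n Pc ν) :=
        abs_integral_le_integral_abs
    _ ≤ ∫ s, ((√N)⁻¹ / 2 * X s ^ 2 + √N / 2 * Z s ^ 2) ∂(sampleLaw n Pc ν) :=
        integral_mono (hX.mul hZ).abs.integrable
          (((hX.pow 2).const_mul _).add ((hZ.pow 2).const_mul _)).integrable hpt
    _ = (√N)⁻¹ / 2 * ∫ s, X s ^ 2 ∂(sampleLaw n Pc ν)
          + √N / 2 * ∫ s, Z s ^ 2 ∂(sampleLaw n Pc ν) := by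
        rw [integral_add ((hX.pow 2).const_mul _).integrable ((hZ.pow 2).const_mul _).integrable,
          integral_const_mul, integral_const_mul]
    _ ≤ (√N)⁻¹ / 2 * K₁ + √N / 2 * (K₂ / N) := by gcongr
    _ = (K₁ + K₂) / 2 / √N := by
        rw [show √N / 2 * (K₂ / N) = K₂ / 2 * (√N / N) by ring, Real.sqrt_div_self]
        ring

variable {σ : ℝ → ℝ} (hσ : ContDiff ℝ 4 σ)
  (hσ_growth : ∃ (C : ℝ) (p : ℕ), ∀ j ≤ 4, ∀ x : ℝ, |iteratedDeriv j σ x| ≤ C * (1 + |x|) ^ p)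

include hσ hσ_growth

/-- The mean squared norm of the gradient direction of one sample. -/
lemma exists_integral_norm_sampleDir_sub_le :
    ∃ K, 0 ≤ K ∧ ∀ (n : ℕ) (A : Matrix (Fin (d + n)) (Fin (d + n)) ℝ), 0 < d + n →
      A ∈ Matrix.orthogonalGroup (Fin (d + n)) ℝ →
      ∀ (u : EuclideanSpace ℝ (Fin (d + n))) (q : EuclideanSpace ℝ (Fin d)), ‖u‖ = 1 →
        hiddenProj A u = q →
        |(∫ s, ‖sampleDir σ (ybar σ Pc ν q) A u s‖ ^ 2 ∂(sampleLaw n Pc ν)) / ((d + n : ℕ) : ℝ)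
          - ((1 + ∫ γ, γ 1 ^ 2 ∂ν)
              * (∫ v, fFun σ (ybar σ Pc ν q) 0 1 (Theta q v) ^ 2 ∂(effLaw Pc ν))
            + (1 + ∫ γ, γ 0 ^ 2 ∂ν)
              * (∫ v, fFun σ (ybar σ Pc ν q) 1 0 (Theta q v) ^ 2 ∂(effLaw Pc ν))
            + 2 * (1 + ∫ γ, γ 0 * γ 1 ∂ν)
              * (∫ v, fFun σ (ybar σ Pc ν q) 0 1 (Theta q v)
                * fFun σ (ybar σ Pc ν q) 1 0 (Theta q v) ∂(effLaw Pc ν)))|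
          ≤ K / √((d + n : ℕ) : ℝ) := by
  have f01 := lipFamily_fFun (ν := ν) hPc hσ hσ_growth 0 1
  have f10 := lipFamily_fFun (ν := ν) hPc hσ hσ_growth 1 0
  obtain ⟨K₁, hK₁, h₁⟩ := (f01.mul f01).exists_integral_mul_viewDev_le (ν := ν) hPc hν 1 1
  obtain ⟨K₂, hK₂, h₂⟩ := (f10.mul f10).exists_integral_mul_viewDev_le (ν := ν) hPc hν 0 0
  obtain ⟨K₃, hK₃, h₃⟩ := (f01.mul f10).exists_integral_mul_viewDev_le (ν := ν) hPc hν 0 1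
  refine ⟨K₁ + K₂ + 2 * K₃, by positivity, fun n A hn hA u q hu hq => ?_⟩
  specialize h₁ n A hn hA u hu
  specialize h₂ n A hn hA u hu
  specialize h₃ n A hn hA u hu
  rw [hq] at h₁ h₂ h₃
  have hb {F : EuclideanSpace ℝ (Fin d) → (Fin 2 → ℝ) → ℝ} (hF : LipFamily F) :
      ∫ v, F q (Theta q v) ∂(effLaw Pc ν)
        = ∫ s, F q (fun l => ⟪u, view A s l⟫) ∂(sampleLaw n Pc ν) := by
    have := integral_hidden_preact (Pc := Pc) (ν := ν) (Φ := fun _ => 1) hν hA hu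
      continuous_const (hF.polyGrowth q).1
    simp only [one_mul, bracket, hq] at this
    rw [this, Theta_eq_preact]
  have b1 := hb (f01.mul f01)
  have b2 := hb (f10.mul f10)
  have b3 := hb (f01.mul f10)
  have m1 := (f01.mul f01).allMoments_sample hPc hν hA u q
  have m2 := (f10.mul f10).allMoments_sample hPc hν hA u q
  have m3 := (f01.mul f10).allMoments_sample hPc hν hA u q
  have hv (l l' : Fin 2) := allMoments_viewDev (ν := ν) hPc hA l l'
  simp only [sq (fFun _ _ _ _ _), b1, b2, b3]
  set N : ℝ := ((d + n : ℕ) : ℝ) with hNdef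
  have hN : N ≠ 0 := Nat.cast_ne_zero.2 hn.ne'
  set F01 := fun s => fFun σ (ybar σ Pc ν q) 0 1 fun l => ⟪u, view A s l⟫ with hF01
  set F10 := fun s => fFun σ (ybar σ Pc ν q) 1 0 fun l => ⟪u, view A s l⟫ with hF10
  -- Expand the square of `f₂₁ • view 0 + f₁₂ • view 1` and replace each inner product of views by
  -- its limit plus `viewDev`.
  have hdec (s : Sample d n) : ‖sampleDir σ (ybar σ Pc ν q) A u s‖ ^ 2 / N
      = ((1 + ∫ γ, γ 1 * γ 1 ∂ν) * (F01 s * F01 s) + (1 + ∫ γ, γ 0 * γ 0 ∂ν) * (F10 s * F10 s)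
          + 2 * (1 + ∫ γ, γ 0 * γ 1 ∂ν) * (F01 s * F10 s))
        + (F01 s * F01 s * viewDev ν A 1 1 s + F10 s * F10 s * viewDev ν A 0 0 s
          + 2 * (F01 s * F10 s * viewDev ν A 0 1 s)) := by
    rw [← real_inner_self_eq_norm_sq]
    simp only [sampleDir, inner_add_left, inner_add_right, inner_smul_left, inner_smul_right,
      conj_trivial, viewDev, real_inner_comm (view A s 0) (view A s 1)]
    simp only [hF01, hF10, ← hNdef]
    field_simp
    ring
  rw [← integral_div]
  simp only [hdec]
  rw [integral_add, integral_add, integral_add, integral_add, integral_add, integral_const_mul,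
    integral_const_mul, integral_const_mul, integral_const_mul]
  · simp only [← sq] at h₁ h₂ h₃ ⊢
    rw [add_sub_cancel_left, add_div, add_div, mul_div_assoc]
    refine (abs_add_three _ _ _).trans ?_
    rw [abs_mul, abs_two]
    gcongr
  · exact (m1.mul (hv 1 1)).integrable
  · exact (m2.mul (hv 0 0)).integrable
  · exact ((m1.mul (hv 1 1)).add (m2.mul (hv 0 0))).integrable
  · exact ((m3.mul (hv 0 1)).const_mul _).integrable
  · exact (m1.const_mul _).integrable
  · exact (m2.const_mul _).integrable
  · exact ((m1.const_mul _).add (m2.const_mul _)).integrable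
  · exact (m3.const_mul _).integrable
  · exact (((m1.const_mul _).add (m2.const_mul _)).add (m3.const_mul _)).integrable
  · exact (((m1.mul (hv 1 1)).add (m2.mul (hv 0 0))).add
      ((m3.mul (hv 0 1)).const_mul _)).integrable

/-- The squared norm of the mean gradient direction is bounded uniformly in the dimension. -/
lemma exists_sum_integral_sampleDir_sq_le :
    ∃ K, 0 ≤ K ∧ ∀ (n : ℕ) (A : Matrix (Fin (d + n)) (Fin (d + n)) ℝ),
      A ∈ Matrix.orthogonalGroup (Fin (d + n)) ℝ →
      ∀ u : EuclideanSpace ℝ (Fin (d + n)), ‖u‖ = 1 →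
        ∑ i, (∫ s, ⟪EuclideanSpace.single i (1 : ℝ),
          sampleDir σ (ybar σ Pc ν (hiddenProj A u)) A u s⟫ ∂(sampleLaw n Pc ν)) ^ 2 ≤ K := by
  obtain ⟨K, hK, h⟩ := exists_integral_inner_sampleDir_pow_le hPc hν hσ hσ_growth
  refine ⟨(1 + K) ^ 2, by positivity, fun n A hA u hu => ?_⟩
  have hm (z : EuclideanSpace ℝ (Fin (d + n))) :=
    allMoments_inner_sampleDir (n := n) hPc hν hσ hσ_growth hA u z (hiddenProj A u)
  set G := sampleDir σ (ybar σ Pc ν (hiddenProj A u)) A u with hG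
  let M : EuclideanSpace ℝ (Fin (d + n)) :=
    WithLp.toLp 2 fun i => ∫ s, ⟪EuclideanSpace.single i (1 : ℝ), G s⟫ ∂(sampleLaw n Pc ν)
  have hM : ∑ i, (∫ s, ⟪EuclideanSpace.single i (1 : ℝ), G s⟫ ∂(sampleLaw n Pc ν)) ^ 2
      = ‖M‖ ^ 2 := by
    rw [EuclideanSpace.norm_sq_eq]
    simp [M]
  have hlin (z : EuclideanSpace ℝ (Fin (d + n))) :
      ∫ s, ⟪z, G s⟫ ∂(sampleLaw n Pc ν) = ⟪z, M⟫ := by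
    have e (s : Sample d n) : ⟪z, G s⟫ = ∑ i, z i * ⟪EuclideanSpace.single i (1 : ℝ), G s⟫ := by
      simp [PiLp.inner_apply, mul_comm]
    simp only [e]
    rw [integral_finsetSum _ fun i _ => ((hm _).const_mul _).integrable]
    simp only [integral_const_mul, M, PiLp.inner_apply]
    simp [mul_comm]
  rw [hM]
  rcases eq_or_ne M 0 with h0 | h0
  · rw [h0]
    simp
    positivity
  have hz : ‖(‖M‖⁻¹ : ℝ) • M‖ = 1 := norm_smul_inv_norm h0
  have hx (x : ℝ) : x ≤ 1 + x ^ 4 := by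
    nlinarith [sq_nonneg (x ^ 2 - 1 / 2), sq_nonneg (x - 1 / 2)]
  refine pow_le_pow_left₀ (norm_nonneg _) ?_ 2
  -- `M` is the mean of the gradient direction. Its norm is the mean of an inner product with one
  -- unit vector, and such moments are bounded uniformly in the dimension.
  calc ‖M‖ = ⟪(‖M‖⁻¹ : ℝ) • M, M⟫ := by
        rw [inner_smul_left, real_inner_self_eq_norm_sq]
        have := norm_ne_zero_iff.2 h0
        simp
        field_simp
    _ = ∫ s, ⟪(‖M‖⁻¹ : ℝ) • M, G s⟫ ∂(sampleLaw n Pc ν) := (hlin _).symm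
    _ ≤ ∫ s, (1 + ⟪(‖M‖⁻¹ : ℝ) • M, G s⟫ ^ 4) ∂(sampleLaw n Pc ν) :=
        integral_mono (hm _).integrable ((AllMoments.const 1).add ((hm _).pow 4)).integrable
          fun s => hx _
    _ ≤ 1 + K := by
        rw [integral_add (integrable_const _) ((hm _).pow 4).integrable]
        have := h n A hA u _ hu hz
        simpa using this

end

/-! ### Moments of the batch gradient -/

section

variable {d n : ℕ} {Pc : Measure (EuclideanSpace ℝ (Fin d))} [IsProbabilityMeasure Pc]
  {ν : Measure (Fin 2 → ℝ)} [IsGaussian ν]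
  (hPc : ∀ p : ℕ, Integrable (fun c => ‖c‖ ^ p) Pc) (hν : ∀ l, ∫ γ, γ l ∂ν = 0)
  {σ : ℝ → ℝ} (hσ : ContDiff ℝ 4 σ)
  (hσ_growth : ∃ (C : ℝ) (p : ℕ), ∀ j ≤ 4, ∀ x : ℝ, |iteratedDeriv j σ x| ≤ C * (1 + |x|) ^ p)
  (τ : ℝ) {m : ℕ}

lemma inner_batchDir (y : Fin 2 → ℝ) (A : Matrix (Fin (d + n)) (Fin (d + n)) ℝ)
    (u z : EuclideanSpace ℝ (Fin (d + n))) (batch : Fin m → Sample d n) :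
    ⟪z, batchDir σ τ y A u batch⟫ = τ / (2 * m) * ∑ b, ⟪z, sampleDir σ y A u (batch b)⟫ := by
  rw [batchDir, inner_smul_right, inner_sum]

include hPc hν hσ hσ_growth

lemma allMoments_inner_batchDir {A : Matrix (Fin (d + n)) (Fin (d + n)) ℝ}
    (hA : A ∈ Matrix.orthogonalGroup (Fin (d + n)) ℝ) (u z : EuclideanSpace ℝ (Fin (d + n)))
    (q : EuclideanSpace ℝ (Fin d)) :
    AllMoments (fun batch => ⟪z, batchDir σ τ (ybar σ Pc ν q) A u batch⟫)
      (Measure.pi fun _ : Fin m => sampleLaw n Pc ν) := by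
  simp only [inner_batchDir]
  exact (AllMoments.sum _ fun b _ =>
    (allMoments_inner_sampleDir hPc hν hσ hσ_growth hA u z q).eval b).const_mul _

lemma exists_integral_inner_batchDir_pow_le :
    ∃ K, 0 ≤ K ∧ ∀ (n : ℕ) (A : Matrix (Fin (d + n)) (Fin (d + n)) ℝ),
      A ∈ Matrix.orthogonalGroup (Fin (d + n)) ℝ →
      ∀ u z : EuclideanSpace ℝ (Fin (d + n)), ‖u‖ = 1 → ‖z‖ = 1 →
        ∫ batch, ⟪z, batchDir σ τ (ybar σ Pc ν (hiddenProj A u)) A u batch⟫ ^ 4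
          ∂(Measure.pi fun _ : Fin m => sampleLaw n Pc ν) ≤ K := by
  obtain ⟨K, hK, h⟩ := exists_integral_inner_sampleDir_pow_le hPc hν hσ hσ_growth
  refine ⟨(τ / 2) ^ 4 * K, by positivity, fun n A hA u z hu hz => ?_⟩
  simp only [inner_batchDir, mul_pow]
  rw [integral_const_mul]
  have h1 := integral_sum_eval_pow_four_le (m := m)
    (allMoments_inner_sampleDir (n := n) hPc hν hσ hσ_growth hA u z (hiddenProj A u))
  calc _ ≤ (τ / (2 * m)) ^ 4 * (m ^ 4 * K) := by
        gcongr
        exact h1.trans (by gcongr; exact h n A hA u z hu hz)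
    _ ≤ (τ / 2) ^ 4 * K := by
        rw [← mul_assoc]
        gcongr
        rw [← mul_pow]
        rcases Nat.eq_zero_or_pos m with rfl | hm
        · simp
          positivity
        · have : (m : ℝ) ≠ 0 := Nat.cast_ne_zero.2 hm.ne'
          refine le_of_eq ?_
          congr 1
          field_simp

lemma integral_inner_batchDir (hm : 0 < m) {A : Matrix (Fin (d + n)) (Fin (d + n)) ℝ}
    (hA : A ∈ Matrix.orthogonalGroup (Fin (d + n)) ℝ) (u z : EuclideanSpace ℝ (Fin (d + n)))
    (q : EuclideanSpace ℝ (Fin d)) :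
    ∫ batch, ⟪z, batchDir σ τ (ybar σ Pc ν q) A u batch⟫
        ∂(Measure.pi fun _ : Fin m => sampleLaw n Pc ν)
      = τ / 2 * ∫ s, ⟪z, sampleDir σ (ybar σ Pc ν q) A u s⟫ ∂(sampleLaw n Pc ν) := by
  simp only [inner_batchDir]
  rw [integral_const_mul,
    integral_sum_eval (allMoments_inner_sampleDir hPc hν hσ hσ_growth hA u z q)]
  have : (m : ℝ) ≠ 0 := Nat.cast_ne_zero.2 hm.ne'
  field_simp

lemma allMoments_norm_batchDir_sq {A : Matrix (Fin (d + n)) (Fin (d + n)) ℝ}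
    (hA : A ∈ Matrix.orthogonalGroup (Fin (d + n)) ℝ) (u : EuclideanSpace ℝ (Fin (d + n)))
    (q : EuclideanSpace ℝ (Fin d)) :
    AllMoments (fun batch => ‖batchDir σ τ (ybar σ Pc ν q) A u batch‖ ^ 2)
      (Measure.pi fun _ : Fin m => sampleLaw n Pc ν) := by
  simp only [norm_sq_eq_sum_inner_single (batchDir _ _ _ _ _ _)]
  exact AllMoments.sum _ fun i _ =>
    (allMoments_inner_batchDir hPc hν hσ hσ_growth τ hA u _ q).pow 2

/-- The mean squared norm of the batch gradient converges to `Λ`. -/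
lemma exists_integral_norm_batchDir_sub_le (hm : 0 < m) :
    ∃ K, 0 ≤ K ∧ ∀ (n : ℕ) (A : Matrix (Fin (d + n)) (Fin (d + n)) ℝ), 0 < d + n →
      A ∈ Matrix.orthogonalGroup (Fin (d + n)) ℝ →
      ∀ (u : EuclideanSpace ℝ (Fin (d + n))) (q : EuclideanSpace ℝ (Fin d)), ‖u‖ = 1 →
        hiddenProj A u = q →
        |∫ batch, ‖batchDir σ τ (ybar σ Pc ν q) A u batch‖ ^ 2 / ((d + n : ℕ) : ℝ)
            ∂(Measure.pi fun _ : Fin m => sampleLaw n Pc ν) - LambdaCoef σ τ m Pc ν q|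
          ≤ K / √((d + n : ℕ) : ℝ) := by
  obtain ⟨K₁, hK₁, h₁⟩ := exists_integral_norm_sampleDir_sub_le hPc hν hσ hσ_growth
  obtain ⟨K₂, hK₂, h₂⟩ := exists_sum_integral_sampleDir_sq_le hPc hν hσ hσ_growth
  have hm0 : (0 : ℝ) < m := Nat.cast_pos.2 hm
  refine ⟨τ ^ 2 / (4 * m) * (K₁ + m * K₂), by positivity, fun n A hn hA u q hu hq => ?_⟩
  specialize h₁ n A hn hA u q hu hq
  specialize h₂ n A hA u hu
  rw [hq] at h₂
  have hm1 (z : EuclideanSpace ℝ (Fin (d + n))) :=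
    allMoments_inner_sampleDir (n := n) hPc hν hσ hσ_growth hA u z q
  have hm2 (z : EuclideanSpace ℝ (Fin (d + n))) :=
    allMoments_inner_batchDir (n := n) (m := m) hPc hν hσ hσ_growth τ hA u z q
  rw [integral_div]
  set N : ℝ := ((d + n : ℕ) : ℝ) with hNdef
  have hN1 : 1 ≤ N := Nat.one_le_cast.2 hn
  set M₂ := ∑ i, (∫ s, ⟪EuclideanSpace.single i (1 : ℝ),
    sampleDir σ (ybar σ Pc ν q) A u s⟫ ∂(sampleLaw n Pc ν)) ^ 2 with hM₂
  have hM0 : 0 ≤ M₂ := Finset.sum_nonneg fun i _ => sq_nonneg _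
  -- Pairs of distinct samples contribute the squared norm `M₂` of the mean direction, which is
  -- bounded and vanishes after division by `N`. The prefactor is `(τ / (2m)) ^ 2` times the `m`
  -- diagonal terms.
  have hsq : ∫ batch, ‖batchDir σ τ (ybar σ Pc ν q) A u batch‖ ^ 2
        ∂(Measure.pi fun _ : Fin m => sampleLaw n Pc ν)
      = τ ^ 2 / (4 * m) * (∫ s, ‖sampleDir σ (ybar σ Pc ν q) A u s‖ ^ 2 ∂(sampleLaw n Pc ν)
          + (m - 1) * M₂) := by
    simp only [norm_sq_eq_sum_inner_single (batchDir _ _ _ _ _ _),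
      norm_sq_eq_sum_inner_single (sampleDir _ _ _ _ _)]
    rw [integral_finsetSum _ fun i _ => ((hm2 _).pow 2).integrable,
      integral_finsetSum _ fun i _ => ((hm1 _).pow 2).integrable, hM₂, Finset.mul_sum,
      ← Finset.sum_add_distrib, Finset.mul_sum]
    refine Finset.sum_congr rfl fun i _ => ?_
    simp only [inner_batchDir, mul_pow]
    rw [integral_const_mul, integral_sum_eval_sq (hm1 _)]
    field_simp
    ring
  rw [hsq, LambdaCoef]
  generalize ∫ s, ‖sampleDir σ (ybar σ Pc ν q) A u s‖ ^ 2 ∂(sampleLaw n Pc ν) = J at h₁ ⊢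
  rw [show τ ^ 2 / (4 * m) * (J + (m - 1) * M₂) / N
      = τ ^ 2 / (4 * m) * (J / N + (m - 1) * M₂ / N) by ring, ← mul_sub, abs_mul,
    abs_of_nonneg (a := τ ^ 2 / (4 * m)) (by positivity),
    mul_div_assoc _ (K₁ + m * K₂)]
  refine mul_le_mul_of_nonneg_left ?_ (by positivity)
  rw [add_sub_right_comm, add_div]
  refine (abs_add_le _ _).trans (add_le_add h₁ ?_)
  have h1m : (1 : ℝ) ≤ m := Nat.one_le_cast.2 hm
  rw [abs_of_nonneg (div_nonneg (mul_nonneg (by linarith) hM0) (by linarith))]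
  have hs0 : 0 < √N := Real.sqrt_pos.2 (by linarith)
  have hs : √N ≤ N := Real.sqrt_le_iff.2 ⟨by linarith, by nlinarith⟩
  exact div_le_div₀ (by positivity) (mul_le_mul (by linarith) h₂ hM0 hm0.le) hs0 hs

/-- The random variable that controls the second order terms of one step of SGD. -/
def stepSize (A : Matrix (Fin (d + n)) (Fin (d + n)) ℝ)
    (u G : EuclideanSpace ℝ (Fin (d + n))) : ℝ :=
  1 + ⟪u, G⟫ ^ 2 + (‖G‖ ^ 2 / ((d + n : ℕ) : ℝ)) ^ 2 + ‖hiddenProj A G‖ ^ 2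

lemma allMoments_norm_hiddenProj_sq {A : Matrix (Fin (d + n)) (Fin (d + n)) ℝ}
    (hA : A ∈ Matrix.orthogonalGroup (Fin (d + n)) ℝ) (u : EuclideanSpace ℝ (Fin (d + n)))
    (q : EuclideanSpace ℝ (Fin d)) :
    AllMoments (fun batch => ‖hiddenProj A (batchDir σ τ (ybar σ Pc ν q) A u batch)‖ ^ 2)
      (Measure.pi fun _ : Fin m => sampleLaw n Pc ν) := by
  simp only [EuclideanSpace.norm_sq_eq (hiddenProj _ _), hiddenProj_apply, Real.norm_eq_abs, sq_abs]
  exact AllMoments.sum _ fun i _ =>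
    (allMoments_inner_batchDir hPc hν hσ hσ_growth τ hA u _ q).pow 2

lemma allMoments_stepSize {A : Matrix (Fin (d + n)) (Fin (d + n)) ℝ}
    (hA : A ∈ Matrix.orthogonalGroup (Fin (d + n)) ℝ) (u : EuclideanSpace ℝ (Fin (d + n)))
    (q : EuclideanSpace ℝ (Fin d)) :
    AllMoments (fun batch => stepSize A u (batchDir σ τ (ybar σ Pc ν q) A u batch))
      (Measure.pi fun _ : Fin m => sampleLaw n Pc ν) := by
  simp only [stepSize, div_eq_inv_mul]
  exact (((AllMoments.const 1).add ((allMoments_inner_batchDir hPc hν hσ hσ_growth τ hA u u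
    q).pow 2)).add (((allMoments_norm_batchDir_sq hPc hν hσ hσ_growth τ hA u q).const_mul
    _).pow 2)).add (allMoments_norm_hiddenProj_sq hPc hν hσ hσ_growth τ hA u q)

/-- By Cauchy–Schwarz `(‖G‖ ^ 2 / N) ^ 2` is at most the average of the fourth powers of the `N`
coordinates of `G`, each of bounded mean; `‖Q G‖ ^ 2` involves only `d` directions. -/
lemma exists_integral_stepSize_le :
    ∃ K, 0 ≤ K ∧ ∀ (n : ℕ) (A : Matrix (Fin (d + n)) (Fin (d + n)) ℝ), 0 < d + n →
      A ∈ Matrix.orthogonalGroup (Fin (d + n)) ℝ →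
      ∀ (u : EuclideanSpace ℝ (Fin (d + n))), ‖u‖ = 1 →
        ∫ batch, stepSize A u (batchDir σ τ (ybar σ Pc ν (hiddenProj A u)) A u batch)
          ∂(Measure.pi fun _ : Fin m => sampleLaw n Pc ν) ≤ K := by
  obtain ⟨K, hK, h⟩ := exists_integral_inner_batchDir_pow_le (m := m) hPc hν hσ hσ_growth τ
  refine ⟨2 + K + K + d * (1 + K), by positivity, fun n A hn hA u hu => ?_⟩
  specialize h n A hA u
  have hmom (z : EuclideanSpace ℝ (Fin (d + n))) :=
    allMoments_inner_batchDir (n := n) (m := m) hPc hν hσ hσ_growth τ hA u z (hiddenProj A u)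
  have hmW := allMoments_stepSize (n := n) (m := m) hPc hν hσ hσ_growth τ hA u (hiddenProj A u)
  set G := batchDir (m := m) σ τ (ybar σ Pc ν (hiddenProj A u)) A u with hG
  set π := Measure.pi fun _ : Fin m => sampleLaw n Pc ν
  set N : ℝ := ((d + n : ℕ) : ℝ) with hNdef
  have hN0 : 0 < N := Nat.cast_pos.2 hn
  have hx (x : ℝ) : x ^ 2 ≤ 1 + x ^ 4 := by nlinarith [sq_nonneg (x ^ 2 - 1 / 2)]
  have hpt (batch : Fin m → Sample d n) : stepSize A u (G batch)
      ≤ 2 + ⟪u, G batch⟫ ^ 4 + N⁻¹ * ∑ i, ⟪EuclideanSpace.single i (1 : ℝ), G batch⟫ ^ 4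
        + ∑ j, (1 + ⟪matCol A (Fin.castAdd n j), G batch⟫ ^ 4) := by
    have h1 : (‖G batch‖ ^ 2 / N) ^ 2
        ≤ N⁻¹ * ∑ i, ⟪EuclideanSpace.single i (1 : ℝ), G batch⟫ ^ 4 := by
      have := sq_sum_le_card_mul_sum_sq (s := Finset.univ)
        (f := fun i => ⟪EuclideanSpace.single i (1 : ℝ), G batch⟫ ^ 2)
      rw [← norm_sq_eq_sum_inner_single] at this
      simp only [← pow_mul, Finset.card_univ, Fintype.card_fin] at this
      rw [div_pow, div_le_iff₀ (by positivity), ← pow_mul]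
      refine this.trans (le_of_eq ?_)
      rw [← hNdef]
      field_simp
    have h2 : ‖hiddenProj A (G batch)‖ ^ 2
        ≤ ∑ j, (1 + ⟪matCol A (Fin.castAdd n j), G batch⟫ ^ 4) := by
      simp only [EuclideanSpace.norm_sq_eq, hiddenProj_apply, Real.norm_eq_abs, sq_abs]
      exact Finset.sum_le_sum fun j _ => hx _
    rw [stepSize]
    linarith [hx ⟪u, G batch⟫]
  have i1 := (AllMoments.const 2).add ((hmom u).pow 4)
  have i2 : AllMoments (fun batch => ∑ i, ⟪EuclideanSpace.single i (1 : ℝ), G batch⟫ ^ 4) π :=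
    AllMoments.sum _ fun i _ => (hmom _).pow 4
  have i3 (j : Fin d) : AllMoments
      (fun batch => 1 + ⟪matCol A (Fin.castAdd n j), G batch⟫ ^ 4) π :=
    (AllMoments.const 1).add ((hmom _).pow 4)
  have i3' : AllMoments
      (fun batch => ∑ j, (1 + ⟪matCol A (Fin.castAdd n j), G batch⟫ ^ 4)) π :=
    AllMoments.sum _ fun j _ => i3 j
  calc ∫ batch, stepSize A u (G batch) ∂π ≤ _ :=
        integral_mono hmW.integrable ((i1.add (i2.const_mul _)).add i3').integrable hpt
    _ = 2 + ∫ batch, ⟪u, G batch⟫ ^ 4 ∂π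
          + N⁻¹ * ∑ i, ∫ batch, ⟪EuclideanSpace.single i (1 : ℝ), G batch⟫ ^ 4 ∂π
          + ∑ j, (1 + ∫ batch, ⟪matCol A (Fin.castAdd n j), G batch⟫ ^ 4 ∂π) := by
        rw [integral_add (i1.add (i2.const_mul _)).integrable i3'.integrable,
          integral_add i1.integrable (i2.const_mul _).integrable,
          integral_add (integrable_const _) ((hmom u).pow 4).integrable, integral_const_mul,
          integral_finsetSum _ fun i _ => ((hmom _).pow 4).integrable,
          integral_finsetSum _ fun j _ => (i3 j).integrable]
        congr 1
        · simp
        · refine Finset.sum_congr rfl fun j _ => ?_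
          rw [integral_add (integrable_const _) ((hmom _).pow 4).integrable]
          simp
    _ ≤ 2 + K + N⁻¹ * ∑ _i : Fin (d + n), K + ∑ _j : Fin d, (1 + K) := by
        gcongr with i _ j _
        · exact h u hu hu
        · exact h _ hu (by simp)
        · exact h _ hu ((orthonormal_matCol hA).1 _)
    _ = 2 + K + K + d * (1 + K) := by
        simp only [Finset.sum_const, Finset.card_univ, Fintype.card_fin, nsmul_eq_mul, ← hNdef]
        rw [inv_mul_cancel_left₀ hN0.ne']

/-- The first order change of the cosine similarities in one step. -/
def stepDrift (A : Matrix (Fin (d + n)) (Fin (d + n)) ℝ)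
    (u G : EuclideanSpace ℝ (Fin (d + n))) : EuclideanSpace ℝ (Fin d) :=
  -hiddenProj A G + (⟪u, G⟫ - ‖G‖ ^ 2 / ((d + n : ℕ) : ℝ) / 2) • hiddenProj A u

omit [IsProbabilityMeasure Pc] [IsGaussian ν] hPc hν hσ hσ_growth in
lemma norm_stepDrift_sq_le {A : Matrix (Fin (d + n)) (Fin (d + n)) ℝ}
    (hA : A ∈ Matrix.orthogonalGroup (Fin (d + n)) ℝ) {u : EuclideanSpace ℝ (Fin (d + n))}
    (hu : ‖u‖ = 1) (G : EuclideanSpace ℝ (Fin (d + n))) :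
    ‖stepDrift A u G‖ ^ 2 ≤ 3 * stepSize A u G := by
  have hq := norm_hiddenProj_le_one hA hu
  rw [stepDrift, stepSize]
  generalize ‖G‖ ^ 2 / ((d + n : ℕ) : ℝ) = T
  generalize ⟪u, G⟫ = S
  have h : ‖-hiddenProj A G + (S - T / 2) • hiddenProj A u‖
      ≤ ‖hiddenProj A G‖ + (|S| + |T| / 2) := by
    refine (norm_add_le _ _).trans ?_
    rw [norm_neg, norm_smul, Real.norm_eq_abs]
    have h1 : |S - T / 2| ≤ |S| + |T| / 2 := by
      refine (abs_sub _ _).trans ?_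
      rw [abs_div, abs_two]
    nlinarith [norm_nonneg (hiddenProj A u), abs_nonneg (S - T / 2)]
  calc _ ≤ (‖hiddenProj A G‖ + (|S| + |T| / 2)) ^ 2 := pow_le_pow_left₀ (norm_nonneg _) h 2
    _ ≤ 3 * (1 + |S| ^ 2 + |T| ^ 2 + ‖hiddenProj A G‖ ^ 2) := by
      nlinarith [sq_nonneg (‖hiddenProj A G‖ - |S|), sq_nonneg (‖hiddenProj A G‖ - |T| / 2),
        sq_nonneg (|S| - |T| / 2)]
    _ = _ := by rw [sq_abs, sq_abs]

omit [IsProbabilityMeasure Pc] [IsGaussian ν] hPc hν hσ hσ_growth in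
lemma inner_stepDrift (A : Matrix (Fin (d + n)) (Fin (d + n)) ℝ)
    (u G : EuclideanSpace ℝ (Fin (d + n))) (D : EuclideanSpace ℝ (Fin d)) :
    ⟪D, stepDrift A u G⟫ = ∑ j, D j * (-⟪matCol A (Fin.castAdd n j), G⟫
        + hiddenProj A u j * ⟪u, G⟫)
      - ⟪D, hiddenProj A u⟫ / 2 * (‖G‖ ^ 2 / ((d + n : ℕ) : ℝ)) := by
  have h1 : ⟪D, hiddenProj A G⟫ = ∑ j, D j * ⟪matCol A (Fin.castAdd n j), G⟫ := by
    simp [PiLp.inner_apply, hiddenProj_apply, mul_comm]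
  have h2 : ⟪D, hiddenProj A u⟫ = ∑ j, D j * hiddenProj A u j := by
    simp [PiLp.inner_apply, mul_comm]
  simp only [stepDrift, inner_add_right, inner_neg_right, inner_smul_right, mul_add, mul_neg,
    Finset.sum_add_distrib, Finset.sum_neg_distrib, ← mul_assoc, ← Finset.sum_mul, h1, h2]
  ring

lemma allMoments_inner_stepDrift {A : Matrix (Fin (d + n)) (Fin (d + n)) ℝ}
    (hA : A ∈ Matrix.orthogonalGroup (Fin (d + n)) ℝ) (u : EuclideanSpace ℝ (Fin (d + n)))
    (q D : EuclideanSpace ℝ (Fin d)) :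
    AllMoments (fun batch => ⟪D, stepDrift A u (batchDir σ τ (ybar σ Pc ν q) A u batch)⟫)
      (Measure.pi fun _ : Fin m => sampleLaw n Pc ν) := by
  have hmom (z : EuclideanSpace ℝ (Fin (d + n))) :=
    allMoments_inner_batchDir (n := n) (m := m) hPc hν hσ hσ_growth τ hA u z q
  simp only [inner_stepDrift, div_eq_inv_mul (‖batchDir _ _ _ _ _ _‖ ^ 2)]
  exact (AllMoments.sum _ fun j _ => ((hmom _).neg.add ((hmom u).const_mul _)).const_mul _).sub
    (((allMoments_norm_batchDir_sq hPc hν hσ hσ_growth τ hA u q).const_mul _).const_mul _)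

/-- The tangential part has exactly the right mean; only `‖G‖ ^ 2 / N` is off, by `O(N ^ (-1/2))`.
The vector `D` will be the deviation before the step, which is fixed while the batch is averaged. -/
lemma exists_integral_inner_stepDrift_sub_le (hm : 0 < m) :
    ∃ K, 0 ≤ K ∧ ∀ (n : ℕ) (A : Matrix (Fin (d + n)) (Fin (d + n)) ℝ), 0 < d + n →
      A ∈ Matrix.orthogonalGroup (Fin (d + n)) ℝ →
      ∀ (u : EuclideanSpace ℝ (Fin (d + n))) (q D : EuclideanSpace ℝ (Fin d)), ‖u‖ = 1 →
        hiddenProj A u = q →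
        |∫ batch, ⟪D, stepDrift A u (batchDir σ τ (ybar σ Pc ν q) A u batch)⟫
            ∂(Measure.pi fun _ : Fin m => sampleLaw n Pc ν) - ⟪D, driftField σ τ m Pc ν q⟫|
          ≤ ‖D‖ * (K / √((d + n : ℕ) : ℝ)) := by
  obtain ⟨K, hK, h⟩ := exists_integral_norm_batchDir_sub_le hPc hν hσ hσ_growth τ hm
  refine ⟨K, hK, fun n A hn hA u q D hu hq => ?_⟩
  specialize h n A hn hA u q hu hq
  have hmom (z : EuclideanSpace ℝ (Fin (d + n))) :=
    allMoments_inner_batchDir (n := n) (m := m) hPc hν hσ hσ_growth τ hA u z q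
  have hT := (allMoments_norm_batchDir_sq (n := n) (m := m) hPc hν hσ hσ_growth τ hA u q).const_mul
    ((d + n : ℕ) : ℝ)⁻¹
  simp only [← div_eq_inv_mul] at hT
  have hterm (j : Fin d) := ((hmom (matCol A (Fin.castAdd n j))).neg.add
    ((hmom u).const_mul (q j))).const_mul (D j)
  have hint : ∫ batch, ⟪D, stepDrift A u (batchDir σ τ (ybar σ Pc ν q) A u batch)⟫
        ∂(Measure.pi fun _ : Fin m => sampleLaw n Pc ν)
      = ⟪D, ⟪q, gVec σ τ Pc ν q⟫ • q - gVec σ τ Pc ν q⟫ - ⟪D, q⟫ / 2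
        * ∫ batch, ‖batchDir σ τ (ybar σ Pc ν q) A u batch‖ ^ 2 / ((d + n : ℕ) : ℝ)
          ∂(Measure.pi fun _ : Fin m => sampleLaw n Pc ν) := by
    simp only [inner_stepDrift, hq]
    rw [integral_sub (AllMoments.sum _ fun j _ => hterm j).integrable (hT.const_mul _).integrable,
      integral_const_mul, integral_finsetSum _ fun j _ => (hterm j).integrable]
    congr 1
    rw [PiLp.inner_apply]
    refine Finset.sum_congr rfl fun j _ => ?_
    rw [integral_const_mul, integral_add (hmom _).neg.integrable ((hmom u).const_mul _).integrable,
      integral_neg, integral_const_mul,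
      integral_inner_batchDir hPc hν hσ hσ_growth τ hm hA, integral_inner_batchDir hPc hν hσ
        hσ_growth τ hm hA, ← integral_inner_sampleDir_eq hPc hν hσ hσ_growth τ hA hu hq j]
    simp
    ring
  have hDq : |⟪D, q⟫| ≤ ‖D‖ := (abs_real_inner_le_norm _ _).trans
    (mul_le_of_le_one_right (norm_nonneg _) (hq ▸ norm_hiddenProj_le_one hA hu))
  have hR : ⟪D, driftField σ τ m Pc ν q⟫ = ⟪D, ⟪q, gVec σ τ Pc ν q⟫ • q - gVec σ τ Pc ν q⟫
      - ⟪D, q⟫ / 2 * LambdaCoef σ τ m Pc ν q := by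
    simp only [driftField, inner_sub_right, inner_smul_right]
    ring
  rw [hint, hR, sub_sub_sub_cancel_left, ← mul_sub, abs_mul, abs_sub_comm, abs_div, abs_two]
  exact mul_le_mul (by linarith [abs_nonneg ⟪D, q⟫]) h (abs_nonneg _) (norm_nonneg _)

end

/-! ### One step of SGD -/

section

variable {d n m : ℕ}

/-- The squared distance of the cosine similarities of `w` to `p`; it has the value `4` if `w` does
not have the norm `√N`. -/
def potential (A : Matrix (Fin (d + n)) (Fin (d + n)) ℝ) (w : EuclideanSpace ℝ (Fin (d + n)))
    (p : EuclideanSpace ℝ (Fin d)) : ℝ :=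
  -- The norm is lost exactly if a step hits zero, as `rescale 0 = 0`. The default `4` is the
  -- largest squared distance in the unit ball.
  if ‖w‖ = √((d + n : ℕ) : ℝ) then ‖cosSim A w - p‖ ^ 2 else 4

lemma potential_nonneg (A : Matrix (Fin (d + n)) (Fin (d + n)) ℝ)
    (w : EuclideanSpace ℝ (Fin (d + n))) (p : EuclideanSpace ℝ (Fin d)) : 0 ≤ potential A w p := by
  rw [potential]
  split_ifs <;> positivity

lemma norm_inv_sqrt_smul {N : ℕ} (hN : 0 < N) {w : EuclideanSpace ℝ (Fin N)}
    (hw : ‖w‖ = √(N : ℝ)) : ‖(√(N : ℝ))⁻¹ • w‖ = 1 := by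
  have : 0 < √(N : ℝ) := Real.sqrt_pos.2 (Nat.cast_pos.2 hN)
  rw [norm_smul, hw, Real.norm_of_nonneg (by positivity), inv_mul_cancel₀ this.ne']

lemma norm_cosSim_le_one (hN : 0 < d + n) {A : Matrix (Fin (d + n)) (Fin (d + n)) ℝ}
    (hA : A ∈ Matrix.orthogonalGroup (Fin (d + n)) ℝ) {w : EuclideanSpace ℝ (Fin (d + n))}
    (hw : ‖w‖ = √((d + n : ℕ) : ℝ)) : ‖cosSim A w‖ ≤ 1 := by
  rw [cosSim_eq_hiddenProj]
  exact norm_hiddenProj_le_one hA (norm_inv_sqrt_smul hN hw)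

lemma potential_le_four (hN : 0 < d + n) {A : Matrix (Fin (d + n)) (Fin (d + n)) ℝ}
    (hA : A ∈ Matrix.orthogonalGroup (Fin (d + n)) ℝ) (w : EuclideanSpace ℝ (Fin (d + n)))
    {p : EuclideanSpace ℝ (Fin d)} (hp : ‖p‖ ≤ 1) : potential A w p ≤ 4 := by
  rw [potential]
  split_ifs with hw
  · have := (norm_sub_le (cosSim A w) p).trans (add_le_add (norm_cosSim_le_one hN hA hw) hp)
    nlinarith [norm_nonneg (cosSim A w - p)]
  · exact le_rfl

/-- Expand the square about `q - p`. The first order terms are kept as inner products, because they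
become small only after averaging over the batch; all the rest is of second order. -/
lemma norm_sub_sq_le_of_expansion {E : Type*} [NormedAddCommGroup E] [InnerProductSpace ℝ E]
    {q p p' Δ x : E} {h c W : ℝ} (hq : ‖q‖ ≤ 1) (hp : ‖p‖ ≤ 1)
    (hx : ‖x‖ ≤ 1) (hΔ : ‖Δ‖ ^ 2 ≤ 3 * W) (hrem : ‖x - q - h • Δ‖ ≤ c * W * h ^ 2) :
    ‖x - p'‖ ^ 2 ≤ ‖q - p‖ ^ 2 + 2 * h * ⟪q - p, Δ⟫ - 2 * ⟪q - p, p' - p⟫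
      + (20 * c + 24) * W * h ^ 2 + 2 * ‖p' - p‖ ^ 2 := by
  set ρ := x - q - h • Δ with hρ
  have e1 : x - p' = (q - p) + ((x - q) - (p' - p)) := by abel
  have hD : ‖q - p‖ ≤ 2 := by linarith [norm_sub_le q p]
  have hδ : ‖x - q‖ ≤ 2 := by linarith [norm_sub_le x q]
  have hW : 0 ≤ W := by nlinarith [sq_nonneg ‖Δ‖]
  have hinner : ⟪q - p, (x - q) - (p' - p)⟫ = h * ⟪q - p, Δ⟫ + ⟪q - p, ρ⟫ - ⟪q - p, p' - p⟫ := by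
    have : x - q = h • Δ + ρ := by rw [hρ]; abel
    rw [this, inner_sub_right, inner_add_right, inner_smul_right]
  have h1 : ⟪q - p, ρ⟫ ≤ 2 * ‖ρ‖ :=
    (real_inner_le_norm _ _).trans (mul_le_mul_of_nonneg_right hD (norm_nonneg _))
  have h2 : ‖(x - q) - (p' - p)‖ ^ 2 ≤ 2 * ‖x - q‖ ^ 2 + 2 * ‖p' - p‖ ^ 2 := by
    have := norm_sub_le (x - q) (p' - p)
    nlinarith [norm_nonneg ((x - q) - (p' - p)), sq_nonneg (‖x - q‖ - ‖p' - p‖)]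
  have hlin : ‖h • Δ‖ ^ 2 ≤ 3 * W * h ^ 2 := by
    rw [norm_smul, mul_pow, Real.norm_eq_abs, sq_abs]
    nlinarith [sq_nonneg h]
  -- The remainder may enter only to the first power, since it is bounded by `W` and just the mean
  -- of `W` is controlled uniformly. The bound `‖x - q‖ ≤ 2` trades one power away.
  have h3 : ‖x - q‖ ^ 2 ≤ 4 * ‖h • Δ‖ ^ 2 + 8 * ‖ρ‖ := by
    have t1 : ‖x - q‖ ≤ ‖h • Δ‖ + ‖ρ‖ := by
      have : x - q = h • Δ + ρ := by rw [hρ]; abel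
      rw [this]
      exact norm_add_le _ _
    have t2 : ‖ρ‖ ≤ 2 + ‖h • Δ‖ := (norm_sub_le _ _).trans (by linarith)
    have n1 := norm_nonneg ρ
    have n2 := norm_nonneg (h • Δ)
    have n3 := norm_nonneg (x - q)
    have t3 : ‖x - q‖ ^ 2 ≤ 2 * ‖x - q‖ := by nlinarith
    rcases le_total ‖h • Δ‖ ‖ρ‖ with hle | hle
    · nlinarith
    · nlinarith
  rw [e1, norm_add_sq_real, hinner]
  nlinarith

lemma cosSim_rescale (hN : 0 < d + n) (A : Matrix (Fin (d + n)) (Fin (d + n)) ℝ)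
    (x : EuclideanSpace ℝ (Fin (d + n))) :
    cosSim A (rescale x) = ‖x‖⁻¹ • hiddenProj A x := by
  rw [cosSim_eq_hiddenProj, inv_sqrt_smul_rescale hN, map_smul]

lemma norm_inv_smul_hiddenProj_le {A : Matrix (Fin (d + n)) (Fin (d + n)) ℝ}
    (hA : A ∈ Matrix.orthogonalGroup (Fin (d + n)) ℝ) (x : EuclideanSpace ℝ (Fin (d + n))) :
    ‖‖x‖⁻¹ • hiddenProj A x‖ ≤ 1 := by
  rw [norm_smul, norm_inv, norm_norm]
  exact inv_mul_le_one_of_le₀ (norm_hiddenProj_le hA x) (norm_nonneg _)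

variable {Pc : Measure (EuclideanSpace ℝ (Fin d))} [IsProbabilityMeasure Pc]
  {ν : Measure (Fin 2 → ℝ)} [IsGaussian ν]
  (hPc : ∀ p : ℕ, Integrable (fun c => ‖c‖ ^ p) Pc) (hν : ∀ l, ∫ γ, γ l ∂ν = 0)
  {σ : ℝ → ℝ} (hσ : ContDiff ℝ 4 σ)
  (hσ_growth : ∃ (C : ℝ) (p : ℕ), ∀ j ≤ 4, ∀ x : ℝ, |iteratedDeriv j σ x| ≤ C * (1 + |x|) ^ p)
  (τ α : ℝ)

include hν hσ in
/-- The pointwise expansion of the potential after one step. -/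
lemma potential_step_le (hN : 0 < d + n) {A : Matrix (Fin (d + n)) (Fin (d + n)) ℝ}
    (hA : A ∈ Matrix.orthogonalGroup (Fin (d + n)) ℝ) {w u : EuclideanSpace ℝ (Fin (d + n))}
    (hw : ‖w‖ = √((d + n : ℕ) : ℝ)) (hwu : (√((d + n : ℕ) : ℝ))⁻¹ • w = u)
    {q p p' : EuclideanSpace ℝ (Fin d)}
    (hq : hiddenProj A u = q) (hp : ‖p‖ ≤ 1) (hp' : ‖p'‖ ≤ 1) (batch : Fin m → Sample d n) :
    potential A (rescale (gradStep σ (fun x => α * x) τ Pc ν A batch w)) p'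
      ≤ ‖q - p‖ ^ 2
        + 2 * ((d + n : ℕ) : ℝ)⁻¹
          * ⟪q - p, stepDrift A u (batchDir σ τ (ybar σ Pc ν q) A u batch)⟫
        - 2 * ⟪q - p, p' - p⟫
        + (24 * (200 * (1 + |τ * α|) ^ 4) + 24)
          * stepSize A u (batchDir σ τ (ybar σ Pc ν q) A u batch) * ((d + n : ℕ) : ℝ)⁻¹ ^ 2
        + 2 * ‖p' - p‖ ^ 2 := by
  have hu : ‖u‖ = 1 := hwu ▸ norm_inv_sqrt_smul hN hw
  have hy : popMean σ Pc ν A w = ybar σ Pc ν q := by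
    rw [popMean_eq_ybar hν hσ.continuous hA (hwu ▸ hu), cosSim_eq_hiddenProj, hwu, hq]
  have hs0 : 0 < √((d + n : ℕ) : ℝ) := Real.sqrt_pos.2 (Nat.cast_pos.2 hN)
  rw [gradStep_eq (hσ.differentiable (by norm_num)) τ α Pc ν A batch w hN, rescale_smul hs0, hwu,
    hy]
  set G := batchDir σ τ (ybar σ Pc ν q) A u batch
  set c := 200 * (1 + |τ * α|) ^ 4 with hc
  have hc0 : 0 ≤ c := by positivity
  obtain ⟨h1, h2⟩ := norm_normalized_step_sub_le (hiddenProj A) (norm_hiddenProj_le hA) hu G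
    (τ * α) (N := ((d + n : ℕ) : ℝ)) (Nat.one_le_cast.2 hN) rfl
  set ũ := (1 - τ * α / ((d + n : ℕ) : ℝ)) • u - (1 / ((d + n : ℕ) : ℝ)) • G
  have hform : c * (1 + ⟪u, G⟫ ^ 2 + (‖G‖ ^ 2 / ((d + n : ℕ) : ℝ)) ^ 2 + ‖hiddenProj A G‖ ^ 2)
      / ((d + n : ℕ) : ℝ) ^ 2 = c * stepSize A u G * ((d + n : ℕ) : ℝ)⁻¹ ^ 2 := by
    rw [stepSize, inv_pow, div_eq_mul_inv]
  rw [← hc, hform] at h1 h2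
  have hW : 0 ≤ stepSize A u G := by rw [stepSize]; positivity
  have hexp := norm_sub_sq_le_of_expansion (p := p) (p' := p')
    (hq ▸ norm_hiddenProj_le_one hA hu) hp (norm_inv_smul_hiddenProj_le hA ũ)
    (norm_stepDrift_sq_le hA hu G) (h := ((d + n : ℕ) : ℝ)⁻¹)
    (by rw [stepDrift, ← hq, inv_eq_one_div]; simpa only [← inv_eq_one_div] using h1)
  have hn0 : 0 ≤ c * stepSize A u G * ((d + n : ℕ) : ℝ)⁻¹ ^ 2 := by positivity
  -- If `ũ = 0` the potential jumps to at most `4`, but then the error bound of the expansion is at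
  -- least `1`. This is why the constant has `24 c` instead of `20 c`.
  rcases eq_or_ne ũ 0 with h0 | h0
  · have := h2 h0
    have h4 := potential_le_four hN hA (rescale ũ) hp'
    nlinarith [sq_nonneg ‖‖ũ‖⁻¹ • hiddenProj A ũ - p'‖]
  · rw [potential, if_pos (norm_rescale h0), cosSim_rescale hN]
    nlinarith

include hPc hν hσ hσ_growth in
/-- The mean of the potential grows at most by a factor `1 + O(1 / N)` in one step, up to an error
of the order `N ^ (-3 / 2)`, if the reference point moves along the limiting drift. -/
lemma exists_integral_potential_step_le (hm : 0 < m) {K₀ : ℝ} (hK₀ : 0 ≤ K₀) :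
    ∃ C, 0 ≤ C ∧ ∀ (n : ℕ) (A : Matrix (Fin (d + n)) (Fin (d + n)) ℝ), 0 < d + n →
      A ∈ Matrix.orthogonalGroup (Fin (d + n)) ℝ →
      ∀ (w : EuclideanSpace ℝ (Fin (d + n))) (p p' : EuclideanSpace ℝ (Fin d)), ‖p‖ ≤ 1 →
        ‖p'‖ ≤ 1 →
        ‖p' - p - ((d + n : ℕ) : ℝ)⁻¹ • driftField σ τ m Pc ν p‖ ≤ K₀ * ((d + n : ℕ) : ℝ)⁻¹ ^ 2 →
        ∫ batch, potential A (rescale (gradStep σ (fun x => α * x) τ Pc ν A batch w)) p'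
            ∂(Measure.pi fun _ : Fin m => sampleLaw n Pc ν)
          ≤ (1 + C * ((d + n : ℕ) : ℝ)⁻¹) * potential A w p
            + C * ((d + n : ℕ) : ℝ)⁻¹ * (√((d + n : ℕ) : ℝ))⁻¹ := by
  obtain ⟨K, L, hK, hL, hRK, hRL⟩ :=
    exists_driftField_bound_lipschitz (ν := ν) hPc hσ hσ_growth τ m
  obtain ⟨K₁, hK₁, h₁⟩ := exists_integral_stepSize_le (m := m) hPc hν hσ hσ_growth τ
  obtain ⟨K₂, hK₂, h₂⟩ := exists_integral_inner_stepDrift_sub_le hPc hν hσ hσ_growth τ hm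
  set c := 24 * (200 * (1 + |τ * α|) ^ 4) + 24 with hc
  have hc0 : 0 ≤ c := by positivity
  refine ⟨2 * L + 4 * K₂ + 4 * K₀ + c * K₁ + 2 * (K + K₀) ^ 2, by positivity,
    fun n A hn hA w p p' hp hp' hpp => ?_⟩
  have hr1 : (√((d + n : ℕ) : ℝ))⁻¹ * (√((d + n : ℕ) : ℝ))⁻¹ = ((d + n : ℕ) : ℝ)⁻¹ := by
    rw [← mul_inv, Real.mul_self_sqrt (Nat.cast_nonneg _)]
  have hh1 : ((d + n : ℕ) : ℝ)⁻¹ ≤ 1 := inv_le_one_of_one_le₀ (Nat.one_le_cast.2 hn)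
  have hh0 : 0 ≤ ((d + n : ℕ) : ℝ)⁻¹ := by positivity
  have hr0 : 0 ≤ (√((d + n : ℕ) : ℝ))⁻¹ := by positivity
  by_cases hw : ‖w‖ = √((d + n : ℕ) : ℝ)
  swap
  -- Once the norm is lost, the potential is already maximal and cannot increase.
  · have h4 : potential A w p = 4 := if_neg hw
    have : ∫ batch, potential A (rescale (gradStep σ (fun x => α * x) τ Pc ν A batch w)) p'
        ∂(Measure.pi fun _ : Fin m => sampleLaw n Pc ν)
        ≤ ∫ _, (4 : ℝ) ∂(Measure.pi fun _ : Fin m => sampleLaw n Pc ν) :=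
      integral_mono_of_nonneg (Eventually.of_forall fun _ => potential_nonneg _ _ _)
        (integrable_const _) (Eventually.of_forall fun _ => potential_le_four hn hA _ hp')
    refine this.trans ?_
    simp only [integral_const, probReal_univ, smul_eq_mul, one_mul, h4]
    have : 0 ≤ 2 * L + 4 * K₂ + 4 * K₀ + c * K₁ + 2 * (K + K₀) ^ 2 := by positivity
    nlinarith [mul_nonneg this hh0, mul_nonneg (mul_nonneg this hh0) hr0]
  set u := (√((d + n : ℕ) : ℝ))⁻¹ • w with hwu
  have hu : ‖u‖ = 1 := norm_inv_sqrt_smul hn hw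
  obtain ⟨q, hq⟩ : ∃ q, hiddenProj A u = q := ⟨_, rfl⟩
  have hq1 : ‖q‖ ≤ 1 := hq ▸ norm_hiddenProj_le_one hA hu
  have hpot : potential A w p = ‖q - p‖ ^ 2 := by
    rw [potential, if_pos hw, cosSim_eq_hiddenProj, ← hwu, hq]
  specialize h₁ n A hn hA u hu
  rw [hq] at h₁
  specialize h₂ n A hn hA u q (q - p) hu hq
  have i1 := allMoments_inner_stepDrift (n := n) (m := m) hPc hν hσ hσ_growth τ hA u q (q - p)
  have i2 := allMoments_stepSize (n := n) (m := m) hPc hν hσ hσ_growth τ hA u q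
  have hstep := potential_step_le (m := m) (Pc := Pc) hν hσ τ α hn hA hw hwu.symm hq hp hp'
  rw [hpot]
  generalize batchDir (m := m) σ τ (ybar σ Pc ν q) A u = G at h₁ h₂ i1 i2 hstep
  set π := Measure.pi fun _ : Fin m => sampleLaw n Pc ν
  set h := ((d + n : ℕ) : ℝ)⁻¹ with hh
  set r := (√((d + n : ℕ) : ℝ))⁻¹ with hrdef
  have hD2 : ‖q - p‖ ≤ 2 := (norm_sub_le _ _).trans (by linarith)
  have hint : ∫ batch, potential A (rescale (gradStep σ (fun x => α * x) τ Pc ν A batch w)) p' ∂π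
      ≤ ‖q - p‖ ^ 2 + 2 * h * ∫ batch, ⟪q - p, stepDrift A u (G batch)⟫ ∂π
        - 2 * ⟪q - p, p' - p⟫ + c * h ^ 2 * ∫ batch, stepSize A u (G batch) ∂π
        + 2 * ‖p' - p‖ ^ 2 := by
    have j1 := (AllMoments.const (μ := π) (‖q - p‖ ^ 2)).add (i1.const_mul (2 * h))
    have j2 := j1.sub (AllMoments.const (2 * ⟪q - p, p' - p⟫))
    have j3 := i2.const_mul (c * h ^ 2)
    refine (integral_mono_of_nonneg (Eventually.of_forall fun _ => potential_nonneg _ _ _)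
      ((j2.add j3).add (AllMoments.const (2 * ‖p' - p‖ ^ 2))).integrable
      (Eventually.of_forall fun batch => (hstep batch).trans (le_of_eq ?_))).trans (le_of_eq ?_)
    · ring
    · rw [integral_add (j2.add j3).integrable (integrable_const _),
        integral_add j2.integrable j3.integrable, integral_sub j1.integrable (integrable_const _),
        integral_add (integrable_const _) (i1.const_mul _).integrable, integral_const_mul]
      simp [integral_const_mul]
  refine hint.trans ?_
  have hdr : √((d + n : ℕ) : ℝ) = r⁻¹ := by rw [hrdef, inv_inv]
  have a1 : ∫ batch, ⟪q - p, stepDrift A u (G batch)⟫ ∂π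
      ≤ ⟪q - p, driftField σ τ m Pc ν q⟫ + 2 * (K₂ * r) := by
    have hb := (abs_le.1 h₂).2
    rw [hdr, div_inv_eq_mul] at hb
    have : ‖q - p‖ * (K₂ * r) ≤ 2 * (K₂ * r) := by gcongr
    linarith
  obtain ⟨ε, hε⟩ : ∃ ε, p' - p = ε := ⟨_, rfl⟩
  rw [hε] at hpp ⊢
  -- The reference point moves along `driftField p`, the mean of the step along `driftField q`. Of
  -- the first order terms only `2h` times the difference of drifts paired with `q - p` remains, and
  -- `a3` bounds it by the Lipschitz constant.
  have a2 : -⟪q - p, ε⟫ ≤ -(h * ⟪q - p, driftField σ τ m Pc ν p⟫) + 2 * (K₀ * h ^ 2) := by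
    have e : ⟪q - p, ε⟫ = h * ⟪q - p, driftField σ τ m Pc ν p⟫
        + ⟪q - p, ε - h • driftField σ τ m Pc ν p⟫ := by
      rw [inner_sub_right, inner_smul_right]
      ring
    have := (abs_real_inner_le_norm (q - p) (ε - h • driftField σ τ m Pc ν p)).trans
      (mul_le_mul hD2 hpp (norm_nonneg _) (by norm_num))
    linarith [(abs_le.1 this).1]
  have a3 : ⟪q - p, driftField σ τ m Pc ν q⟫ - ⟪q - p, driftField σ τ m Pc ν p⟫
      ≤ L * ‖q - p‖ ^ 2 := by
    rw [← inner_sub_right]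
    refine (real_inner_le_norm _ _).trans ?_
    nlinarith [hRL q p hq1 hp, norm_nonneg (q - p)]
  have a4 : ‖ε‖ ≤ (K + K₀) * h := by
    have t : ‖ε‖ ≤ ‖ε - h • driftField σ τ m Pc ν p‖ + ‖h • driftField σ τ m Pc ν p‖ := by
      simpa using norm_add_le (ε - h • driftField σ τ m Pc ν p) (h • driftField σ τ m Pc ν p)
    rw [norm_smul, Real.norm_of_nonneg hh0] at t
    have t2 := mul_le_mul_of_nonneg_left (hRK p hp) hh0
    have t3 : K₀ * h ^ 2 ≤ K₀ * h := by
      gcongr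
      exact pow_le_of_le_one hh0 hh1 two_ne_zero
    linarith
  have a5 : ‖ε‖ ^ 2 ≤ (K + K₀) ^ 2 * h ^ 2 := by
    rw [← mul_pow]
    exact pow_le_pow_left₀ (norm_nonneg _) a4 2
  have a6 : c * h ^ 2 * ∫ batch, stepSize A u (G batch) ∂π ≤ c * h ^ 2 * K₁ := by gcongr
  have hrle : r ≤ 1 := inv_le_one_of_one_le₀ (Real.one_le_sqrt.2 (Nat.one_le_cast.2 hn))
  -- The genuine second order terms `N⁻²` are absorbed in the error `N ^ (-3/2)` caused by the
  -- drift.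
  have hhr : h ^ 2 ≤ h * r := by
    rw [sq]
    exact mul_le_mul_of_nonneg_left (hr1 ▸ mul_le_of_le_one_left hr0 hrle) hh0
  have hcoef : 0 ≤ 4 * K₀ + c * K₁ + 2 * (K + K₀) ^ 2 := by positivity
  have hsum : (4 * K₀ + c * K₁ + 2 * (K + K₀) ^ 2) * h ^ 2
      ≤ (4 * K₀ + c * K₁ + 2 * (K + K₀) ^ 2) * (h * r) := by gcongr
  have b1 : 2 * h * ∫ batch, ⟪q - p, stepDrift A u (G batch)⟫ ∂π
      ≤ 2 * h * (⟪q - p, driftField σ τ m Pc ν q⟫ + 2 * (K₂ * r)) := by gcongr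
  have b3 : 2 * h * (⟪q - p, driftField σ τ m Pc ν q⟫ - ⟪q - p, driftField σ τ m Pc ν p⟫)
      ≤ 2 * h * (L * ‖q - p‖ ^ 2) := by gcongr
  have b4 : 0 ≤ (4 * K₂ + 4 * K₀ + c * K₁ + 2 * (K + K₀) ^ 2) * h * ‖q - p‖ ^ 2 := by positivity
  have b5 : 0 ≤ 2 * L * (h * r) := by positivity
  linarith

end

/-! ### Measurability of the training dynamics -/

section

section Measurability

variable {d n m : ℕ}

lemma continuous_view (l : Fin 2) :
    Continuous fun p : (Fin (d + n) → Fin (d + n) → ℝ) × Sample d n =>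
      view (Matrix.of p.1) p.2 l := by
  simp only [view, dataVec_eq, Sample.hidden, Sample.background, Sample.noise, matCol,
    Matrix.of_apply]
  fun_prop

variable {Pc : Measure (EuclideanSpace ℝ (Fin d))} [IsProbabilityMeasure Pc]
  {ν : Measure (Fin 2 → ℝ)} [IsGaussian ν] {σ : ℝ → ℝ} (hσ : ContDiff ℝ 4 σ)

include hσ

lemma measurable_popMean :
    Measurable fun p : (Fin (d + n) → Fin (d + n) → ℝ) × EuclideanSpace ℝ (Fin (d + n)) =>
      popMean σ Pc ν (Matrix.of p.1) p.2 := by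
  refine measurable_pi_lambda _ fun l => ?_
  have hc : Continuous fun p : ((Fin (d + n) → Fin (d + n) → ℝ)
      × EuclideanSpace ℝ (Fin (d + n))) × Sample d n =>
      output σ (Matrix.of p.1.1) p.2 l p.1.2 := by
    have hv := (continuous_view (d := d) (n := n) l).comp
      ((continuous_fst.comp continuous_fst).prodMk continuous_snd :
        Continuous fun p : ((Fin (d + n) → Fin (d + n) → ℝ)
          × EuclideanSpace ℝ (Fin (d + n))) × Sample d n => (p.1.1, p.2))
    exact hσ.continuous.comp ((((continuous_snd.comp continuous_fst).inner hv)).div_const _)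
  exact (StronglyMeasurable.integral_prod_right (ν := sampleLaw n Pc ν)
    hc.measurable.stronglyMeasurable).measurable

omit [IsProbabilityMeasure Pc] [IsGaussian ν] in
lemma continuous_sampleDir :
    Continuous fun p : ((Fin 2 → ℝ) × (Fin (d + n) → Fin (d + n) → ℝ)
        × EuclideanSpace ℝ (Fin (d + n))) × Sample d n =>
      sampleDir σ p.1.1 (Matrix.of p.1.2.1) p.1.2.2 p.2 := by
  have hv (l : Fin 2) := (continuous_view (d := d) (n := n) l).comp
    ((continuous_fst.comp (continuous_snd.comp continuous_fst)).prodMk continuous_snd :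
      Continuous fun p : ((Fin 2 → ℝ) × (Fin (d + n) → Fin (d + n) → ℝ)
        × EuclideanSpace ℝ (Fin (d + n))) × Sample d n => (p.1.2.1, p.2))
  have hθ (l : Fin 2) := (continuous_snd.comp (continuous_snd.comp continuous_fst)).inner (𝕜 := ℝ)
    (hv l)
  have hy (l : Fin 2) : Continuous fun p : ((Fin 2 → ℝ) × (Fin (d + n) → Fin (d + n) → ℝ)
        × EuclideanSpace ℝ (Fin (d + n))) × Sample d n => p.1.1 l :=
    (continuous_apply l).comp (continuous_fst.comp continuous_fst)
  have hd : Continuous (deriv σ) := hσ.continuous_deriv (by norm_num)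
  have hf (l l' : Fin 2) := ((hσ.continuous.comp (hθ l)).sub (hy l)).const_mul (-2) |>.mul
    (hd.comp (hθ l'))
  exact ((hf 1 0).smul (hv 0)).add ((hf 0 1).smul (hv 1))

section Composition

variable {Ω : Type*} [MeasurableSpace Ω] {y : Ω → Fin 2 → ℝ} {a : Ω → Fin (d + n) → Fin (d + n) → ℝ}
  {w : Ω → EuclideanSpace ℝ (Fin (d + n))}

omit [IsProbabilityMeasure Pc] [IsGaussian ν] in
lemma measurable_sampleDir_comp {s : Ω → Sample d n} (hy : Measurable y) (ha : Measurable a)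
    (hw : Measurable w) (hs : Measurable s) :
    Measurable fun ω => sampleDir σ (y ω) (Matrix.of (a ω)) (w ω) (s ω) := by
  have h := (continuous_sampleDir (d := d) (n := n) hσ).measurable
  have hf : Measurable fun ω => ((y ω, a ω, w ω), s ω) := (hy.prodMk (ha.prodMk hw)).prodMk hs
  have hcomp := h.comp hf
  exact hcomp

lemma measurable_popMean_comp (ha : Measurable a) (hw : Measurable w) :
    Measurable fun ω => popMean σ Pc ν (Matrix.of (a ω)) (w ω) := by
  have h := measurable_popMean (d := d) (n := n) (Pc := Pc) (ν := ν) hσ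
  have hf : Measurable fun ω => (a ω, w ω) := ha.prodMk hw
  have hcomp := h.comp hf
  exact hcomp

lemma measurable_step_comp (τ α : ℝ) {B : Ω → Fin m → Sample d n} (ha : Measurable a)
    (hw : Measurable w) (hB : ∀ b, Measurable fun ω => B ω b) :
    Measurable fun ω =>
      rescale (gradStep σ (fun x => α * x) τ Pc ν (Matrix.of (a ω)) (B ω) (w ω)) := by
  have hstep : Measurable fun ω =>
      gradStep σ (fun x => α * x) τ Pc ν (Matrix.of (a ω)) (B ω) (w ω) := by
    -- The explicit formula makes the dependence of the gradient on all parameters visibly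
    -- measurable.
    simp only [gradStep, (hasGradientAt_loss (hσ.differentiable (by norm_num)) _ _ _ _).gradient]
    have hφ : Continuous fun w : EuclideanSpace ℝ (Fin (d + n)) =>
        (WithLp.toLp 2 fun i => α * w i : EuclideanSpace ℝ (Fin (d + n))) := by fun_prop
    have hφw := hφ.measurable.comp hw
    have hpop := measurable_popMean_comp (Pc := Pc) (ν := ν) hσ ha hw
    have hsum := Finset.measurable_fun_sum Finset.univ fun b (_ : b ∈ Finset.univ) =>
      measurable_sampleDir_comp hσ hpop ha (hw.const_smul (√((d + n : ℕ) : ℝ))⁻¹) (hB b)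
    have h1 := (hsum.const_smul (1 / (2 * m * √((d + n : ℕ) : ℝ)))).const_smul τ
    have h2 := hφw.const_smul (τ / ((d + n : ℕ) : ℝ))
    have h3 := (hw.sub h1).sub h2
    exact h3
  have hfac := hstep.norm.const_div √((d + n : ℕ) : ℝ)
  have hprod := hfac.smul hstep
  exact hprod

lemma measurable_weights (τ α : ℝ) {B : Ω → ℕ → Fin m → Sample d n} (ha : Measurable a)
    (hw : Measurable w) (hB : ∀ k b, Measurable fun ω => B ω k b) (k : ℕ) :
    Measurable fun ω =>
      weights σ (fun x => α * x) τ Pc ν (Matrix.of (a ω)) (w ω) (B ω) k := by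
  induction k with
  | zero => exact hw
  | succ k ih => exact measurable_step_comp hσ τ α ha ih (hB k)

end Composition

omit [IsGaussian ν] [IsProbabilityMeasure Pc] hσ in
lemma continuous_cosSim :
    Continuous fun x : (Fin (d + n) → Fin (d + n) → ℝ) × EuclideanSpace ℝ (Fin (d + n)) =>
      cosSim (Matrix.of x.1) x.2 := by
  simp only [cosSim_eq_hiddenProj]
  refine (PiLp.continuous_toLp 2 _).comp (continuous_pi fun j => ?_)
  simp only [matCol, Matrix.of_apply]
  fun_prop

omit [IsGaussian ν] [IsProbabilityMeasure Pc] hσ in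
lemma measurable_potential (p : EuclideanSpace ℝ (Fin d)) :
    Measurable fun x : (Fin (d + n) → Fin (d + n) → ℝ) × EuclideanSpace ℝ (Fin (d + n)) =>
      potential (Matrix.of x.1) x.2 p := by
  have hc := continuous_cosSim (d := d) (n := n)
  refine Measurable.ite (measurableSet_eq_fun (by fun_prop) measurable_const) ?_ measurable_const
  exact ((hc.measurable.sub_const p).norm.pow_const 2)

omit [IsGaussian ν] [IsProbabilityMeasure Pc] hσ in
lemma weights_congr (φ : ℝ → ℝ) (τ : ℝ) (A : Matrix (Fin (d + n)) (Fin (d + n)) ℝ)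
    (w₀ : EuclideanSpace ℝ (Fin (d + n))) {B B' : ℕ → Fin m → Sample d n} {k : ℕ}
    (h : ∀ j < k, B j = B' j) :
    weights σ φ τ Pc ν A w₀ B k = weights σ φ τ Pc ν A w₀ B' k := by
  induction k with
  | zero => rfl
  | succ k ih =>
    rw [weights, weights, ih fun j hj => h j (hj.trans k.lt_succ_self), h k k.lt_succ_self]

end Measurability

/-! ### Independence of the fresh batch from the past -/

section Independence

variable {Ω : Type*} [MeasurableSpace Ω] {P : Measure Ω} [IsProbabilityMeasure P]

/-- Both hypotheses together factorize the joint law into three; the claim is its other bracketing.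
-/
lemma IndepFun.prodMk_of_indepFun_prodMk {β γ δ : Type*} [MeasurableSpace β] [MeasurableSpace γ]
    [MeasurableSpace δ] {X : Ω → β} {Y : Ω → γ} {W : Ω → δ} (hX : Measurable X)
    (hY : Measurable Y) (hW : Measurable W) (h1 : IndepFun X (fun ω => (Y ω, W ω)) P)
    (h2 : IndepFun Y W P) : IndepFun (fun ω => (X ω, Y ω)) W P := by
  have hXY : IndepFun X Y P := h1.comp measurable_id measurable_fst
  have := Measure.isProbabilityMeasure_map (μ := P) hX.aemeasurable
  have := Measure.isProbabilityMeasure_map (μ := P) hY.aemeasurable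
  have := Measure.isProbabilityMeasure_map (μ := P) hW.aemeasurable
  rw [indepFun_iff_map_prod_eq_prod_map_map (hX.prodMk hY).aemeasurable hW.aemeasurable,
    hXY.map_prod_eq_prod_map_map hX.aemeasurable hY.aemeasurable]
  apply MeasurableEquiv.prodAssoc.map_measurableEquiv_injective
  rw [Measure.prodAssoc_prod, ← h2.map_prod_eq_prod_map_map hY.aemeasurable hW.aemeasurable,
    ← h1.map_prod_eq_prod_map_map hX.aemeasurable (hY.prodMk hW).aemeasurable,
    Measure.map_map MeasurableEquiv.prodAssoc.measurable ((hX.prodMk hY).prodMk hW)]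
  rfl

/-- Fubini for the joint law: the fresh randomness is averaged first, with the past frozen. -/
lemma IndepFun.integral_comp_prodMk {β γ : Type*} [MeasurableSpace β] [MeasurableSpace γ]
    {X : Ω → β} {Y : Ω → γ} (h : IndepFun X Y P) (hX : Measurable X) (hY : Measurable Y)
    {ρ : Measure γ} (hρ : P.map Y = ρ) {g : β × γ → ℝ} (hg : Measurable g)
    (hi : Integrable (fun ω => g (X ω, Y ω)) P) :
    ∫ ω, g (X ω, Y ω) ∂P = ∫ ω, ∫ y, g (X ω, y) ∂ρ ∂P := by
  have := Measure.isProbabilityMeasure_map (μ := P) hX.aemeasurable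
  have := Measure.isProbabilityMeasure_map (μ := P) hY.aemeasurable
  subst hρ
  have hmap := h.map_prod_eq_prod_map_map hX.aemeasurable hY.aemeasurable
  have hi' : Integrable g ((P.map X).prod (P.map Y)) := by
    rw [← hmap, integrable_map_measure hg.aestronglyMeasurable (hX.prodMk hY).aemeasurable]
    exact hi
  rw [← integral_map (f := g) (hX.prodMk hY).aemeasurable hg.aestronglyMeasurable, hmap,
    integral_prod _ hi']
  exact integral_map hX.aemeasurable
    (StronglyMeasurable.integral_prod_right' hg.stronglyMeasurable).aestronglyMeasurable

variable {β γ : Type*} [MeasurableSpace β] [MeasurableSpace γ] {m : ℕ}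
  {Z : Ω → β} (hZ : Measurable Z) {S : ℕ → Fin m → Ω → γ} (hS : ∀ k b, Measurable (S k b))
  (hind : iIndepFun (fun i : ℕ × Fin m => S i.1 i.2) P)

include hS hind in
lemma map_batch {μ : Measure γ} [SigmaFinite μ] (hlaw : ∀ k b, P.map (S k b) = μ) (k : ℕ) :
    P.map (fun ω b => S k b ω) = Measure.pi fun _ : Fin m => μ := by
  have h := hind.precomp (g := fun b : Fin m => (k, b)) fun b b' h => (Prod.ext_iff.1 h).2
  rw [iIndepFun_iff_map_fun_eq_pi_map fun b => (hS k b).aemeasurable] at h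
  simpa only [hlaw] using h

include hZ hS hind in
/-- A function of the initial data and of the batches before step `k` is independent of the batch
of step `k`. -/
lemma indepFun_past_batch [Nonempty γ] (hinit : IndepFun Z (fun ω (i : ℕ × Fin m) => S i.1 i.2 ω) P)
    {δ : Type*} [MeasurableSpace δ] {f : β × (ℕ → Fin m → γ) → δ} (hf : Measurable f) (k : ℕ)
    (hfk : ∀ z B B', (∀ j < k, B j = B' j) → f (z, B) = f (z, B')) :
    IndepFun (fun ω => f (Z ω, fun j b => S j b ω)) (fun ω b => S k b ω) P := by
  classical
  let past : Finset (ℕ × Fin m) := Finset.range k ×ˢ Finset.univ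
  let now : Finset (ℕ × Fin m) := {k} ×ˢ Finset.univ
  have hdisj : Disjoint past now := by
    rw [Finset.disjoint_left]
    intro i hi hi'
    simp only [past, now, Finset.mem_product, Finset.mem_range, Finset.mem_singleton,
      Finset.mem_univ, and_true] at hi hi'
    omega
  have h2 := hind.indepFun_finset past now hdisj fun i => hS i.1 i.2
  have hb (b : Fin m) : (k, b) ∈ now := by simp [now]
  have h2' : IndepFun (fun ω (i : past) => S i.1.1 i.1.2 ω) (fun ω b => S k b ω) P :=
    h2.comp measurable_id
      (show Measurable fun (x : now → γ) b => x ⟨(k, b), hb b⟩ by fun_prop)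
  have h1 : IndepFun Z (fun ω => ((fun i : past => S i.1.1 i.1.2 ω), fun b => S k b ω)) P :=
    hinit.comp measurable_id
      (show Measurable fun x : ℕ × Fin m → γ => ((fun i : past => x i.1), fun b => x (k, b)) by
        fun_prop)
  have h3 := IndepFun.prodMk_of_indepFun_prodMk hZ
    (measurable_pi_lambda _ fun i : past => hS i.1.1 i.1.2)
    (measurable_pi_lambda _ fun b => hS k b) h1 h2'
  obtain ⟨c⟩ := ‹Nonempty γ›
  -- Batches from step `k` on are replaced by an arbitrary constant, which `f` does not notice.
  let ext (x : past → γ) (j : ℕ) (b : Fin m) : γ := if h : (j, b) ∈ past then x ⟨(j, b), h⟩ else c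
  have hext : Measurable ext := by
    refine measurable_pi_lambda _ fun j => measurable_pi_lambda _ fun b => ?_
    by_cases h : (j, b) ∈ past
    · simp only [ext, h, dif_pos]
      exact measurable_pi_apply _
    · simp only [ext, h, dif_neg, not_false_eq_true]
      exact measurable_const
  have hfe : Measurable fun x : β × (past → γ) => f (x.1, ext x.2) :=
    hf.comp (measurable_fst.prodMk (hext.comp measurable_snd))
  have h4 : IndepFun (fun ω => f (Z ω, ext fun i => S i.1.1 i.1.2 ω)) (fun ω b => S k b ω) P :=
    h3.comp hfe measurable_id
  have h5 (ω : Ω) : f (Z ω, fun j b => S j b ω) = f (Z ω, ext fun i => S i.1.1 i.1.2 ω) := by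
    refine hfk _ _ _ fun j hj => ?_
    funext b
    have : (j, b) ∈ past := by simp [past, hj]
    simp [ext, this]
  simpa only [h5] using h4

end Independence

end

/-! ### Convergence of the training dynamics -/

section

/-- Discrete Grönwall inequality, from `1 + x ≤ exp x`. -/
lemma le_exp_mul_of_recursion {v : ℕ → ℝ} {x y : ℝ} (hv : 0 ≤ v 0) (hx : 0 ≤ x) (hy : 0 ≤ y)
    (h : ∀ k, v (k + 1) ≤ (1 + x) * v k + y) (k : ℕ) :
    v k ≤ Real.exp (k * x) * (v 0 + k * y) := by
  induction k with
  | zero => simp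
  | succ k ih =>
    have h1 : 1 + x ≤ Real.exp x := by linarith [Real.add_one_le_exp x]
    have h2 : 0 ≤ Real.exp (k * x) * (v 0 + k * y) := by positivity
    have h3 : (1 : ℝ) ≤ Real.exp ((k + 1) * x) := Real.one_le_exp (by positivity)
    have h4 : Real.exp ((k + 1) * x) = Real.exp x * Real.exp (k * x) := by
      rw [← Real.exp_add]
      ring_nf
    calc v (k + 1) ≤ (1 + x) * v k + y := h k
      _ ≤ Real.exp x * (Real.exp (k * x) * (v 0 + k * y)) + Real.exp ((k + 1) * x) * y := by
        refine add_le_add ?_ (le_mul_of_one_le_left hy h3)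
        exact (mul_le_mul_of_nonneg_left ih (by positivity)).trans
          (mul_le_mul_of_nonneg_right h1 h2)
      _ = Real.exp ((k + 1 : ℕ) * x) * (v 0 + (k + 1 : ℕ) * y) := by
        push_cast
        rw [h4]
        ring

section Recursion

variable {d n m : ℕ} {Pc : Measure (EuclideanSpace ℝ (Fin d))} [IsProbabilityMeasure Pc]
  {ν : Measure (Fin 2 → ℝ)} [IsGaussian ν] {σ : ℝ → ℝ} (hσ : ContDiff ℝ 4 σ) {τ α : ℝ}
  {Ω : Type*} [MeasurableSpace Ω] {P : Measure Ω} [IsProbabilityMeasure P]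
  {A : Ω → Matrix (Fin (d + n)) (Fin (d + n)) ℝ} (hA_meas : ∀ i j, Measurable fun ω => A ω i j)
  (hA : ∀ᵐ ω ∂P, A ω ∈ Matrix.orthogonalGroup (Fin (d + n)) ℝ)
  {w₀ : Ω → EuclideanSpace ℝ (Fin (d + n))} (hw₀_meas : Measurable w₀)
  {S : ℕ → Fin m → Ω → Sample d n} (hS_meas : ∀ k b, Measurable (S k b))

include hσ hA_meas hA hw₀_meas hS_meas

lemma integrable_potential_weights (hn : 0 < d + n) {p : EuclideanSpace ℝ (Fin d)} (hp : ‖p‖ ≤ 1)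
    (k : ℕ) :
    Integrable (fun ω => potential (A ω) (weights σ (fun x => α * x) τ Pc ν (A ω) (w₀ ω)
      (fun k b => S k b ω) k) p) P := by
  have ha : Measurable fun ω => (fun i j => A ω i j : Fin (d + n) → Fin (d + n) → ℝ) :=
    measurable_pi_lambda _ fun i => measurable_pi_lambda _ fun j => hA_meas i j
  have hw := measurable_weights (Pc := Pc) (ν := ν) hσ τ α ha hw₀_meas
    (B := fun ω k b => S k b ω) (fun k b => hS_meas k b) k
  have hm := (measurable_potential p).comp (ha.prodMk hw)
  refine Integrable.of_bound (C := 4) hm.aestronglyMeasurable ?_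
  filter_upwards [hA] with ω hω
  rw [Real.norm_of_nonneg (potential_nonneg _ _ _)]
  exact potential_le_four hn hω _ hp

/-- The weights after `k` steps depend on the initial data and the earlier batches only, so batch
`k` is independent of them. The one-step bound holds for each orthogonal `A` and every `w`, and so
can be applied under the integral over the past. -/
lemma integral_potential_weights_succ_le (hn : 0 < d + n)
    (hS_law : ∀ k b, P.map (S k b) = sampleLaw n Pc ν)
    (hS_indep : iIndepFun (fun i : ℕ × Fin m => S i.1 i.2) P)
    (hinit : IndepFun
      (fun ω => ((fun i j => A ω i j : Fin (d + n) → Fin (d + n) → ℝ), w₀ ω))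
      (fun ω (i : ℕ × Fin m) => S i.1 i.2 ω) P)
    {p p' : EuclideanSpace ℝ (Fin d)} (hp : ‖p‖ ≤ 1) (hp' : ‖p'‖ ≤ 1) {c e : ℝ}
    (hstep : ∀ A ∈ Matrix.orthogonalGroup (Fin (d + n)) ℝ, ∀ w,
      ∫ batch, potential A (rescale (gradStep σ (fun x => α * x) τ Pc ν A batch w)) p'
        ∂(Measure.pi fun _ : Fin m => sampleLaw n Pc ν) ≤ c * potential A w p + e) (k : ℕ) :
    ∫ ω, potential (A ω) (weights σ (fun x => α * x) τ Pc ν (A ω) (w₀ ω)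
        (fun k b => S k b ω) (k + 1)) p' ∂P
      ≤ c * ∫ ω, potential (A ω) (weights σ (fun x => α * x) τ Pc ν (A ω) (w₀ ω)
        (fun k b => S k b ω) k) p ∂P + e := by
  have ha : Measurable fun ω => (fun i j => A ω i j : Fin (d + n) → Fin (d + n) → ℝ) :=
    measurable_pi_lambda _ fun i => measurable_pi_lambda _ fun j => hA_meas i j
  have hw := measurable_weights (Pc := Pc) (ν := ν) hσ τ α ha hw₀_meas
    (B := fun ω k b => S k b ω) (fun k b => hS_meas k b) k
  have hB : Measurable fun ω b => S k b ω := measurable_pi_lambda _ fun b => hS_meas k b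
  have hg : Measurable fun x : ((Fin (d + n) → Fin (d + n) → ℝ)
      × EuclideanSpace ℝ (Fin (d + n))) × (Fin m → Sample d n) =>
      potential (Matrix.of x.1.1)
        (rescale (gradStep σ (fun x => α * x) τ Pc ν (Matrix.of x.1.1) x.2 x.1.2)) p' := by
    have ha' : Measurable fun x : ((Fin (d + n) → Fin (d + n) → ℝ)
      × EuclideanSpace ℝ (Fin (d + n))) × (Fin m → Sample d n) => x.1.1 :=
      measurable_fst.comp measurable_fst
    have hs := measurable_step_comp (Pc := Pc) (ν := ν) (m := m) hσ τ α ha'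
      (measurable_snd.comp measurable_fst) (B := fun x => x.2)
      (fun b => (measurable_pi_apply b).comp measurable_snd)
    have := (measurable_potential p').comp (ha'.prodMk hs)
    exact this
  have hf : Measurable fun x : ((Fin (d + n) → Fin (d + n) → ℝ)
      × EuclideanSpace ℝ (Fin (d + n))) × (ℕ → Fin m → Sample d n) =>
      (x.1.1, weights σ (fun x => α * x) τ Pc ν (Matrix.of x.1.1) x.1.2 x.2 k) := by
    have ha' : Measurable fun x : ((Fin (d + n) → Fin (d + n) → ℝ)
      × EuclideanSpace ℝ (Fin (d + n))) × (ℕ → Fin m → Sample d n) => x.1.1 :=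
      measurable_fst.comp measurable_fst
    have hs := measurable_weights (Pc := Pc) (ν := ν) hσ τ α ha'
      (measurable_snd.comp measurable_fst) (B := fun x => x.2)
      (fun k b => (measurable_pi_apply b).comp ((measurable_pi_apply k).comp measurable_snd)) k
    exact ha'.prodMk hs
  have hne : Nonempty (Sample d n) := ⟨0⟩
  have hind := indepFun_past_batch (ha.prodMk hw₀_meas) hS_meas hS_indep hinit hf k
    fun z B B' h => by rw [weights_congr _ _ _ _ h]
  have hint := IndepFun.integral_comp_prodMk hind (ha.prodMk hw) hB
    (map_batch hS_meas hS_indep hS_law k) hg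
    (integrable_potential_weights (Pc := Pc) (ν := ν) (α := α) (τ := τ) hσ hA_meas hA hw₀_meas
      hS_meas hn hp' (k + 1))
  refine (le_of_eq hint).trans ?_
  have hi := integrable_potential_weights (Pc := Pc) (ν := ν) (α := α) (τ := τ) hσ hA_meas hA
    hw₀_meas hS_meas hn hp k
  rw [← integral_const_mul]
  have he : e = ∫ _, e ∂P := by simp
  rw [he, ← integral_add (hi.const_mul c) (integrable_const e)]
  refine integral_mono_of_nonneg
    (Eventually.of_forall fun ω => integral_nonneg fun b => potential_nonneg _ _ _)
    ((hi.const_mul c).add (integrable_const e)) ?_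
  filter_upwards [hA] with ω hω
  exact hstep (A ω) hω _

end Recursion

/-- If `‖x‖ > 1`, then almost surely `X` keeps the distance `‖x‖ - 1` from `x`. It is needed because
the limit of the initial similarities is not assumed to lie in the ball. -/
lemma norm_le_one_of_tendsto {d : ℕ} {Ω : ℕ → Type*} [∀ n, MeasurableSpace (Ω n)]
    (P : ∀ n, Measure (Ω n)) [∀ n, IsProbabilityMeasure (P n)]
    {E : Type*} [NormedAddCommGroup E] {X : ∀ n, Ω n → E}
    (hX : ∀ n, 0 < d + n → ∀ᵐ ω ∂(P n), ‖X n ω‖ ≤ 1) {x : E}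
    (h : ∀ ε : ℝ, 0 < ε → Tendsto (fun n => P n {ω | ε ≤ ‖X n ω - x‖}) atTop (𝓝 0)) :
    ‖x‖ ≤ 1 := by
  by_contra! hx
  have h0 := h (‖x‖ - 1) (by linarith)
  have h1 : Tendsto (fun n => P n {ω | ‖x‖ - 1 ≤ ‖X n ω - x‖}) atTop (𝓝 1) := by
    refine tendsto_const_nhds.congr' ?_
    filter_upwards [eventually_gt_atTop 0] with n hn
    have hae : ∀ᵐ ω ∂(P n), ω ∈ {ω | ‖x‖ - 1 ≤ ‖X n ω - x‖} := by
      filter_upwards [hX n (by omega)] with ω hω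
      have := norm_sub_norm_le x (X n ω)
      rw [norm_sub_rev] at this
      exact (by linarith : ‖x‖ - 1 ≤ ‖X n ω - x‖)
    exact (measure_univ (μ := P n)).symm.trans (measure_congr (eventuallyEq_univ.2 hae)).symm
  exact zero_ne_one (tendsto_nhds_unique h0 h1)

/-- The mean of a bounded nonnegative function that is controlled by the square of a sequence that
converges to zero in probability converges to zero. -/
lemma tendsto_integral_zero_of_tendsto_measure {Ω : ℕ → Type*} [∀ n, MeasurableSpace (Ω n)]
    (P : ∀ n, Measure (Ω n)) [∀ n, IsProbabilityMeasure (P n)] {V X : ∀ n, Ω n → ℝ} {K : ℝ}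
    (hV : ∀ n ω, 0 ≤ V n ω) (hX : ∀ n, Measurable (X n))
    (hVK : ∀ᶠ n in atTop, ∀ᵐ ω ∂(P n), V n ω ≤ K ∧ V n ω ≤ X n ω ^ 2)
    (hX0 : ∀ n ω, 0 ≤ X n ω)
    (h : ∀ ε : ℝ, 0 < ε → Tendsto (fun n => P n {ω | ε ≤ X n ω}) atTop (𝓝 0)) :
    Tendsto (fun n => ∫ ω, V n ω ∂(P n)) atTop (𝓝 0) := by
  have hlim (ε : ℝ) (hε : 0 < ε) : Tendsto (fun n => (P n).real {ω | ε ≤ X n ω}) atTop (𝓝 0) :=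
    (ENNReal.tendsto_toReal ENNReal.zero_ne_top).comp (h ε hε)
  refine tendsto_order.2 ⟨fun a ha => Eventually.of_forall fun n =>
    ha.trans_le (integral_nonneg (hV n)), fun a ha => ?_⟩
  -- Where `X` is below this threshold its square is at most `a / 2`; elsewhere `V ≤ K`, on a set of
  -- small probability.
  have hs : 0 < √(a / 2) := Real.sqrt_pos.2 (by linarith)
  have hs2 : √(a / 2) ^ 2 = a / 2 := Real.sq_sqrt (by linarith)
  have h1 := ((hlim _ hs).const_mul |K|).eventually_lt_const (u := a / 2) (by simpa using half_pos ha)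
  filter_upwards [h1, hVK] with n hn hb
  have hset : MeasurableSet {ω | √(a / 2) ≤ X n ω} := measurableSet_le measurable_const (hX n)
  calc ∫ ω, V n ω ∂(P n)
      ≤ ∫ ω, (a / 2 + {ω | √(a / 2) ≤ X n ω}.indicator (fun _ => |K|) ω) ∂(P n) := by
        refine integral_mono_of_nonneg (Eventually.of_forall (hV n))
          ((integrable_const _).add ((integrable_const _).indicator hset)) ?_
        filter_upwards [hb] with ω hω
        by_cases hmem : √(a / 2) ≤ X n ω
        · rw [Set.indicator_of_mem (show ω ∈ {ω | √(a / 2) ≤ X n ω} from hmem)]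
          linarith [hω.1, le_abs_self K]
        · rw [Set.indicator_of_notMem (show ω ∉ {ω | √(a / 2) ≤ X n ω} from hmem), add_zero]
          refine hω.2.trans ?_
          rw [← hs2]
          exact pow_le_pow_left₀ (hX0 n ω) (not_le.1 hmem).le 2
    _ = a / 2 + |K| * (P n).real {ω | √(a / 2) ≤ X n ω} := by
        rw [integral_add (integrable_const _) ((integrable_const _).indicator hset),
          integral_indicator_const _ hset]
        simp [mul_comm]
    _ < a := by linarith

end

end ContrastiveDynamics

end

/-! ### Proof of the theorem -/

open ContrastiveDynamics in
theorem theorem2 {d m : ℕ} (hm : 0 < m)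
    -- activation function, learning rate, coefficient of the L2 regularization
    (σ : ℝ → ℝ) (hσ : ContDiff ℝ 4 σ)
    (hσ_growth : ∃ (C : ℝ) (p : ℕ), ∀ j ≤ 4, ∀ x : ℝ, |iteratedDeriv j σ x| ≤ C * (1 + |x|) ^ p)
    (τ : ℝ) (hτ : 0 < τ) (α : ℝ)
    -- law of the hidden variable
    (Pc : Measure (EuclideanSpace ℝ (Fin d))) [IsProbabilityMeasure Pc]
    (hPc : ∀ p : ℕ, Integrable (fun c => ‖c‖ ^ p) Pc)
    -- law of the pair of additive noises at one coordinate
    (ν : Measure (Fin 2 → ℝ)) [IsGaussian ν] (hν : ∀ l, ∫ γ, γ l ∂ν = 0)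
    -- for each dimension `N = d + n`: orthonormal matrix, initial weights, training samples
    {Ω : ℕ → Type*} [∀ n, MeasurableSpace (Ω n)] (P : ∀ n, Measure (Ω n))
    [∀ n, IsProbabilityMeasure (P n)]
    (A : ∀ n, Ω n → Matrix (Fin (d + n)) (Fin (d + n)) ℝ)
    (hA_meas : ∀ n i j, Measurable fun ω => A n ω i j)
    (hA : ∀ n, ∀ᵐ ω ∂(P n), A n ω ∈ Matrix.orthogonalGroup (Fin (d + n)) ℝ)
    (w₀ : ∀ n, Ω n → EuclideanSpace ℝ (Fin (d + n))) (hw₀_meas : ∀ n, Measurable (w₀ n))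
    (hw₀ : ∀ n, ∀ᵐ ω ∂(P n), ‖w₀ n ω‖ = √((d + n : ℕ) : ℝ))
    (S : ∀ n, ℕ → Fin m → Ω n → Sample d n) (hS_meas : ∀ n k b, Measurable (S n k b))
    (hS_law : ∀ n k b, (P n).map (S n k b) = sampleLaw n Pc ν)
    (hS_indep : ∀ n, iIndepFun (fun (i : ℕ × Fin m) => S n i.1 i.2) (P n))
    (hS_indep_init : ∀ n, IndepFun
      (fun ω => ((fun i j => A n ω i j : Fin (d + n) → Fin (d + n) → ℝ), w₀ n ω))
      (fun ω (i : ℕ × Fin m) => S n i.1 i.2 ω) (P n))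
    -- convergence of the cosine similarity at time `0`
    (q₀ : EuclideanSpace ℝ (Fin d))
    (hq₀ : ∀ ε : ℝ, 0 < ε →
      Tendsto (fun n => P n {ω | ε ≤ ‖cosSim (A n ω) (w₀ n ω) - q₀‖}) atTop (𝓝 0)) :
    ∃ q : ℝ → EuclideanSpace ℝ (Fin d),
      IsSolution σ τ m Pc ν q₀ q ∧
      (∀ q' : ℝ → EuclideanSpace ℝ (Fin d), IsSolution σ τ m Pc ν q₀ q' →
        ∀ t, 0 ≤ t → q' t = q t) ∧
      ∀ t : ℝ, 0 ≤ t → ∀ ε : ℝ, 0 < ε →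
        Tendsto (fun n => P n {ω | ε ≤ ‖cosSim (A n ω)
            (weights σ (fun x => α * x) τ Pc ν (A n ω) (w₀ n ω) (fun k b => S n k b ω)
              ⌊t * ((d + n : ℕ) : ℝ)⌋₊) - q t‖}) atTop (𝓝 0) := by
  obtain ⟨K, L, hK, hL, hRK, hRL⟩ :=
    exists_driftField_bound_lipschitz (ν := ν) hPc hσ hσ_growth τ m
  have hcos (n : ℕ) (hn : 0 < d + n) : ∀ᵐ ω ∂(P n), ‖cosSim (A n ω) (w₀ n ω)‖ ≤ 1 := by
    filter_upwards [hA n, hw₀ n] with ω h1 h2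
    exact norm_cosSim_le_one hn h1 h2
  have hq₀1 : ‖q₀‖ ≤ 1 := norm_le_one_of_tendsto P hcos hq₀
  obtain ⟨q, hq⟩ := exists_isBallSolution hK hL hRK hRL
    (fun q h => inner_driftField_le hPc hσ hσ_growth h) hq₀1
  refine ⟨q, hq, fun q' hq' t ht => hq.eq hL hRL hq' ht, fun t ht ε hε => ?_⟩
  -- The permitted error `L * K / N ^ 2` of the reference point is that of one Euler step of length
  -- `1 / N` along the solution. The constant `C` may depend on `α`; the limit does not.
  obtain ⟨C, hC, hstep⟩ := exists_integral_potential_step_le hPc hν hσ hσ_growth τ α hm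
    (mul_nonneg hL hK)
  set h : ℕ → ℝ := fun n => ((d + n : ℕ) : ℝ)⁻¹ with hh
  set r : ℕ → ℝ := fun n => (√((d + n : ℕ) : ℝ))⁻¹ with hr
  have hh0 (n : ℕ) : 0 ≤ h n := by positivity
  have hr0 (n : ℕ) : 0 ≤ r n := by positivity
  have hcast : Tendsto (fun n : ℕ => ((d + n : ℕ) : ℝ)) atTop atTop :=
    tendsto_natCast_atTop_atTop.comp (tendsto_atTop_mono (fun n => Nat.le_add_left n d) tendsto_id)
  have hlim_h : Tendsto h atTop (𝓝 0) := tendsto_inv_atTop_zero.comp hcast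
  have hlim_r : Tendsto r atTop (𝓝 0) :=
    tendsto_inv_atTop_zero.comp (Real.tendsto_sqrt_atTop.comp hcast)
  let w (n k : ℕ) (ω : Ω n) := weights σ (fun x => α * x) τ Pc ν (A n ω) (w₀ n ω)
    (fun k b => S n k b ω) k
  -- Step `k` is compared with the solution at time `k / N`.
  let v (n k : ℕ) : ℝ := ∫ ω, potential (A n ω) (w n k ω) (q (k * h n)) ∂(P n)
  have hball (s : ℝ) (hs : 0 ≤ s) : ‖q s‖ ≤ 1 := (hq.2 s hs).1
  have hv0 (n : ℕ) : 0 ≤ v n 0 := integral_nonneg fun ω => potential_nonneg _ _ _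
  have hrec (n : ℕ) (hn : 0 < d + n) (k : ℕ) :
      v n (k + 1) ≤ (1 + C * h n) * v n k + C * h n * r n := by
    have hs0 : 0 ≤ k * h n := mul_nonneg (Nat.cast_nonneg k) (hh0 n)
    have hst : k * h n ≤ (k + 1 : ℕ) * h n := by
      push_cast
      linarith [hh0 n]
    have hdiff : ((k + 1 : ℕ) : ℝ) * h n - k * h n = h n := by
      push_cast
      ring
    have heuler := (hq.norm_euler_le hL hRK hRL hs0 hst).2
    rw [hdiff] at heuler
    exact integral_potential_weights_succ_le hσ (hA_meas n) (hA n) (hw₀_meas n) (hS_meas n) hn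
      (hS_law n) (hS_indep n) (hS_indep_init n) (hball _ hs0) (hball _ (hs0.trans hst))
      (fun A hA w => hstep n A hn hA w _ _ (hball _ hs0) (hball _ (hs0.trans hst)) heuler) k
  have hlim_v0 : Tendsto (fun n => v n 0) atTop (𝓝 0) := by
    have hX (n : ℕ) : Measurable fun ω => ‖cosSim (A n ω) (w₀ n ω) - q₀‖ := by
      have ha : Measurable fun ω => (fun i j => A n ω i j : Fin (d + n) → Fin (d + n) → ℝ) :=
        measurable_pi_lambda _ fun i => measurable_pi_lambda _ fun j => hA_meas n i j
      exact (((continuous_cosSim.measurable.comp (ha.prodMk (hw₀_meas n))).sub_const q₀).norm)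
    refine tendsto_integral_zero_of_tendsto_measure P (K := 4)
      (fun n ω => potential_nonneg _ _ _) hX ?_ (fun n ω => norm_nonneg _) hq₀
    filter_upwards [eventually_gt_atTop 0] with n hn
    filter_upwards [hA n, hw₀ n] with ω h1 h2
    have hq0 : q ((0 : ℕ) * h n) = q₀ := by
      rw [Nat.cast_zero, zero_mul]
      exact hq.1
    rw [hq0]
    refine ⟨potential_le_four (by omega) h1 _ hq₀1, le_of_eq ?_⟩
    exact if_pos h2
  set k : ℕ → ℕ := fun n => ⌊t * ((d + n : ℕ) : ℝ)⌋₊ with hk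
  have hkt (n : ℕ) (hn : 0 < d + n) : k n * h n ≤ t ∧ t - k n * h n ≤ h n := by
    have hN : (0 : ℝ) < ((d + n : ℕ) : ℝ) := Nat.cast_pos.2 hn
    have h1 := Nat.floor_le (mul_nonneg ht hN.le)
    have h2 := Nat.lt_floor_add_one (t * ((d + n : ℕ) : ℝ))
    have e : t = t * ((d + n : ℕ) : ℝ) * h n := by rw [mul_assoc, hh, mul_inv_cancel₀ hN.ne', mul_one]
    have h3 := mul_le_mul_of_nonneg_right h1 (hh0 n)
    have h4 := mul_le_mul_of_nonneg_right h2.le (hh0 n)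
    constructor <;> linarith
  -- `4` accounts for weights that lost their norm. For the others, `q t` is within `ε / 2` of the
  -- solution at time `⌊tN⌋ / N` for large `N`, so a deviation `ε` from `q t` forces one of `ε / 2`
  -- from that point.
  set η := min (ε ^ 2 / 4) 4 with hη
  have hη0 : 0 < η := by positivity
  have hbound : ∀ᶠ n in atTop,
      P n {ω | ε ≤ ‖cosSim (A n ω) (w n (k n) ω) - q t‖}
        ≤ ENNReal.ofReal (Real.exp (C * t) * (v n 0 + C * t * r n) / η) := by
    have hsmall := (hlim_h.const_mul K).eventually_le_const (u := ε / 2) (by simpa using half_pos hε)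
    filter_upwards [eventually_gt_atTop 0, hsmall] with n hn hKh
    have hn' : 0 < d + n := by omega
    obtain ⟨hk1, hk2⟩ := hkt n hn'
    have hks : 0 ≤ k n * h n := mul_nonneg (Nat.cast_nonneg _) (hh0 n)
    have hvk : v n (k n) ≤ Real.exp (C * t) * (v n 0 + C * t * r n) := by
      refine (le_exp_mul_of_recursion (hv0 n) (mul_nonneg hC (hh0 n))
        (mul_nonneg (mul_nonneg hC (hh0 n)) (hr0 n)) (hrec n hn') (k n)).trans ?_
      -- There are at most `tN` steps, so the growth factors multiply to at most `exp (C * t)` and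
      -- the errors of order `N ^ (-3/2)` add up to `C * t * N ^ (-1/2)`.
      have e1 : k n * (C * h n) ≤ C * t := by nlinarith
      have e2 : k n * (C * h n * r n) ≤ C * t * r n := by
        rw [← mul_assoc]
        exact mul_le_mul_of_nonneg_right e1 (hr0 n)
      have := hv0 n
      have := hr0 n
      have := hh0 n
      gcongr
    have hsub : {ω | ε ≤ ‖cosSim (A n ω) (w n (k n) ω) - q t‖}
        ⊆ {ω | η ≤ potential (A n ω) (w n (k n) ω) (q (k n * h n))} := by
      intro ω hω
      change ε ≤ _ at hω
      change η ≤ potential _ _ _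
      rw [potential]
      split_ifs
      · refine (min_le_left _ _).trans ?_
        have hqq : ‖q t - q (k n * h n)‖ ≤ ε / 2 :=
          (hq.norm_euler_le hL hRK hRL hks hk1).1.trans
            ((mul_le_mul_of_nonneg_left hk2 hK).trans hKh)
        have htri := norm_sub_le_norm_sub_add_norm_sub (cosSim (A n ω) (w n (k n) ω))
          (q (k n * h n)) (q t)
        rw [norm_sub_rev (q (k n * h n))] at htri
        nlinarith
      · exact min_le_right _ _
    have hmarkov := mul_meas_ge_le_integral_of_nonneg
      (μ := P n) (f := fun ω => potential (A n ω) (w n (k n) ω) (q (k n * h n)))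
      (Eventually.of_forall fun ω => potential_nonneg _ _ _)
      (integrable_potential_weights hσ (hA_meas n) (hA n) (hw₀_meas n) (hS_meas n) hn'
        (hball _ hks) (k n)) η
    refine (measure_mono hsub).trans ?_
    rw [← ofReal_measureReal]
    refine ENNReal.ofReal_le_ofReal ?_
    rw [le_div_iff₀ hη0, mul_comm]
    exact hmarkov.trans hvk
  have hlim : Tendsto (fun n => ENNReal.ofReal
      (Real.exp (C * t) * (v n 0 + C * t * r n) / η)) atTop (𝓝 0) := by
    have := ((hlim_v0.add (hlim_r.const_mul (C * t))).const_mul (Real.exp (C * t))).div_const η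
    simpa using ENNReal.tendsto_ofReal this
  exact tendsto_of_tendsto_of_tendsto_of_le_of_le' tendsto_const_nhds hlim
    (Eventually.of_forall fun n => zero_le) hbound
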